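/- **Setting.** Let $\{\eta_\theta:\theta\in\Theta\}$ be a canonical one-parameter exponential family on $\mathbb R$: $\Theta$ is a nonempty open interval, $d\eta_\theta/d\rho=e^{\theta x-b(\theta)}$ for a reference measure $\rho$, and $b$ is finite and strictly convex on $\Theta$. There are $K\ge 2$ arms with distributions $\eta_{\theta_1},\dots,\eta_{\theta_K}$, of which exactly one has the largest mean (the best arm). For a real $m$ and a member $\eta_\theta$ with mean $x$ put $\mathrm{KL}(m,x)=\sup_{\theta'\in\Theta}\{(\theta'-\theta)m-(b(\theta')-b(\theta))\}\in[0,\infty]$, which is the Kullback–Leibler divergence between the members with means $m$ and $x$ whenever $m$ is the mean of a member. An arbitrary unknown (possibly randomized and adaptive) offline policy first collects $\tau_1\ge 0$ samples from the arms; let $N^o_a$ be the number of those from arm $a$. Then the algorithm samples online. Offline and online, the reward of each sample, given all previous arms and rewards, the arm chosen and any auxiliary randomization, has the distribution of the chosen arm. After $t$ online samples let $N_a(t)$ be the number of online samples of arm $a$, $\hat\mu_a(t)$ the empirical mean of all $N^o_a+N_a(t)$ samples of arm $a$, $i^*(t)\in\arg\max_a\hat\mu_a(t)$ (ties broken arbitrarily),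 and for $\mathbf N\in\mathbb R_{\ge0}^K$ $$Z_{a,b}(\mathbf N,\hat\mu(t))=\inf_x\{(N^o_a+N_a)\mathrm{KL}(\hat\mu_a(t),x)+(N^o_b+N_b)\mathrm{KL}(\hat\mu_b(t),x)\},$$ where $x$ ranges over the means of the family. **Batch Track-and-Stop.** Let $\delta\in(0,1)$, let $\varepsilon\ge 0$ be a numerical accuracy, and let $\mathbf N(t)=(N_1(t),\dots,N_K(t))$. Stopping rule and output: with $$\beta(t,\delta)=\log\tfrac{K-1}{\delta}+6\log\!\big(\log\tfrac t2+1\big)+8\log\!\big(1+\log\tfrac{K-1}{\delta}\big),$$ the algorithm stops after $$\tau_\delta=\min\{t\ge K:\ Z_{i^*(t),b}(\mathbf N(t),\hat\mu(t))\ge\beta(\tau_1+t,\delta)\ \ \forall b\ne i^*(t)\}$$ online samples and outputs $i^*(\tau_\delta)$. Sampling rule: first pull each arm once, and set $w_a(K)=1/K$ and $\mathrm{count}=0$. Then, at each $t\ge K$ at which it has not stopped: * if $\lfloor t/K\rfloor$ is a perfect square, set $w_a(t+1)=\frac{t}{t+1}w_a(t)+\frac1{t+1}\frac1K$ and increase $\mathrm{count}$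 by one; if $\mathrm{count}$ is now divisible by $K$, reset it to $0$ and let $\hat w(t+1)$ be a vector of proportions (nonnegative, with sum $1$) that agrees, up to $\varepsilon$ in each coordinate, with $N^*_a/\sum_bN^*_b$ for an optimal solution $\mathbf N^*\neq0$ of: minimize $\sum_aN_a$ over $\mathbf N\ge0$ subject to $Z_{i^*(t),b}(\mathbf N,\hat\mu(t))\ge\log\frac1\delta+\log\log\frac1\delta$ for all $b\ne i^*(t)$ (an arbitrary vector of proportions if there is no nonzero optimal solution); if $\mathrm{count}$ is not divisible by $K$, put $\hat w(t+1)=\hat w(t)$; * otherwise put $\hat w(t+1)=\hat w(t)$ and $w_a(t+1)=\frac{t}{t+1}w_a(t)+\frac1{t+1}\hat w_a(t+1)$; and in both cases pull next an arm in $\arg\max_a w_a(t+1)/N_a(t)$ (ties broken arbitrarily). **Theorem.** For every such family and arms, every $\delta\in(0,1)$, $\varepsilon\ge0$ and $\tau_1\ge0$, and every offline policy, the batch Track-and-Stop algorithm is $\delta$-correct with respect to the joint randomness of the offline policy, the offline samples, the online policy and the online samples: almost surely $\tau_\delta<\infty$, and the probability that the output $i^*(\tau_\delta)$ is not the best arm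 is at most $\delta$. -/

import Mathlib

open MeasureTheory ProbabilityTheory
open scoped ENNReal

noncomputable section

/-- A canonical single-parameter exponential family of distributions on `ℝ`: a reference measure
`ρ`, and a nonempty open interval `Θ` of natural parameters at which the exponential moments of
`ρ` are finite and the log-partition function is strictly convex. -/
structure ExpFamily where
  ρ : Measure ℝ
  Θ : Set ℝ
  isOpen_param : IsOpen Θ
  ordConnected_param : Θ.OrdConnected
  nonempty_param : Θ.Nonempty
  integrable_exp : ∀ θ ∈ Θ, Integrable (fun x => Real.exp (θ * x)) ρ
  strictConvexOn_logPartition :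
    StrictConvexOn ℝ Θ (fun θ => Real.log (∫ x, Real.exp (θ * x) ∂ρ))

namespace ExpFamily

variable (F : ExpFamily)

/-- The normalizing function `b`. -/
def b (θ : ℝ) : ℝ := Real.log (∫ x, Real.exp (θ * x) ∂F.ρ)

/-- The distribution `η_θ`, with density `exp (θ x - b θ)` with respect to `ρ`. -/
def dist (θ : ℝ) : Measure ℝ :=
  F.ρ.withDensity (fun x => ENNReal.ofReal (Real.exp (θ * x - F.b θ)))

/-- The mean of `η_θ`. -/
def mean (θ : ℝ) : ℝ := ∫ x, x ∂(F.dist θ)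

/-- The divergence `KL(m, x)` of a mean value `m` from the member `η_θ` of the family whose mean
is `x`: the largest log-likelihood ratio per observation of a member of the family against `η_θ`,
for observations with average `m`. If `m` is the mean of a member of the family, this is the
Kullback-Leibler divergence between the two members (see `kl_mean`); the formula also covers
empirical means that are not the mean of any member, such as `0` and `1` for Bernoulli rewards. -/
def kl (m θ : ℝ) : ℝ≥0∞ :=
  ⨆ θ' ∈ F.Θ, ENNReal.ofReal ((θ' - θ) * m - (F.b θ' - F.b θ))

/-- `inf_x { n * KL(p, x) + m * KL(q, x) }`, where `x` ranges over the family. -/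
def glr (n p m q : ℝ) : ℝ≥0∞ :=
  ⨅ θ ∈ F.Θ, (ENNReal.ofReal n * F.kl p θ + ENNReal.ofReal m * F.kl q θ)

/-! ### `kl` is the Kullback-Leibler divergence between members of the family -/

theorem neZero_ρ : NeZero F.ρ := by
  refine ⟨fun h => ?_⟩
  obtain ⟨x, hx⟩ := F.nonempty_param
  obtain ⟨r, hr, hball⟩ := Metric.isOpen_iff.1 F.isOpen_param x hx
  have hy : x + r / 2 ∈ F.Θ := hball (by
    rw [Metric.mem_ball, Real.dist_eq, add_sub_cancel_left, abs_of_pos (by positivity)]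
    linarith)
  have hne : x ≠ x + r / 2 := by linarith
  have hlt := F.strictConvexOn_logPartition.2 hx hy hne (half_pos one_pos) (half_pos one_pos)
    (add_halves 1)
  simp [h] at hlt

theorem dist_eq_tilted {θ : ℝ} (hθ : θ ∈ F.Θ) :
    F.dist θ = F.ρ.tilted (fun x => θ * x) := by
  have := F.neZero_ρ
  have hpos := integral_exp_pos (F.integrable_exp θ hθ)
  unfold dist Measure.tilted b
  congr 1
  funext x
  rw [Real.exp_sub, Real.exp_log hpos]

theorem isProbabilityMeasure_dist {θ : ℝ} (hθ : θ ∈ F.Θ) : IsProbabilityMeasure (F.dist θ) := by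
  have := F.neZero_ρ
  rw [F.dist_eq_tilted hθ]
  exact isProbabilityMeasure_tilted (F.integrable_exp θ hθ)

theorem integrable_id_dist {θ : ℝ} (hθ : θ ∈ F.Θ) : Integrable (fun x : ℝ => x) (F.dist θ) := by
  rw [F.dist_eq_tilted hθ]
  have hint : θ ∈ interior (integrableExpSet id F.ρ) :=
    interior_maximal (fun t ht => F.integrable_exp t ht) F.isOpen_param hθ
  have hL := memLp_tilted_mul hint 1
  rw [ENNReal.coe_one] at hL
  exact memLp_one_iff_integrable.1 hL

theorem dist_eq_tilted_dist {θ₁ θ₂ : ℝ} (h₁ : θ₁ ∈ F.Θ) (h₂ : θ₂ ∈ F.Θ) :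
    F.dist θ₁ = (F.dist θ₂).tilted (fun x => (θ₁ - θ₂) * x) := by
  rw [F.dist_eq_tilted h₁, F.dist_eq_tilted h₂, tilted_tilted (F.integrable_exp θ₂ h₂)]
  congr 1
  funext x
  simp only [Pi.add_apply]
  ring

theorem llr_dist {θ₁ θ₂ : ℝ} (h₁ : θ₁ ∈ F.Θ) (h₂ : θ₂ ∈ F.Θ) :
    F.dist θ₁ ≪ F.dist θ₂ ∧ llr (F.dist θ₁) (F.dist θ₂) =ᵐ[F.dist θ₁]
      fun x => (θ₁ - θ₂) * x - (F.b θ₁ - F.b θ₂) := by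
  have := F.neZero_ρ
  have := F.isProbabilityMeasure_dist h₂
  have hac : F.dist θ₁ ≪ F.dist θ₂ := by
    rw [F.dist_eq_tilted_dist h₁ h₂]
    exact tilted_absolutelyContinuous _ _
  have hsum : (fun x : ℝ => θ₂ * x) + (fun x : ℝ => (θ₁ - θ₂) * x) = fun x => θ₁ * x := by
    funext x
    simp only [Pi.add_apply]
    ring
  have hexp : Integrable (fun x => Real.exp ((θ₁ - θ₂) * x)) (F.dist θ₂) := by
    rw [F.dist_eq_tilted h₂, integrable_tilted_iff (F.integrable_exp θ₂ h₂)]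
    refine (F.integrable_exp θ₁ h₁).congr (ae_of_all _ fun x => ?_)
    simp only [smul_eq_mul]
    rw [← Real.exp_add]
    ring_nf
  have hlog : Real.log (∫ x, Real.exp ((θ₁ - θ₂) * x) ∂(F.dist θ₂)) = F.b θ₁ - F.b θ₂ := by
    rw [F.dist_eq_tilted h₂, integral_exp_tilted, hsum,
      Real.log_div (integral_exp_pos (F.integrable_exp θ₁ h₁)).ne'
        (integral_exp_pos (F.integrable_exp θ₂ h₂)).ne']
    rfl
  refine ⟨hac, hac.ae_le ?_⟩
  have key := log_rnDeriv_tilted_left_self hexp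
  rw [← F.dist_eq_tilted_dist h₁ h₂, hlog] at key
  exact key

theorem integral_llr_dist {θ₁ θ₂ : ℝ} (h₁ : θ₁ ∈ F.Θ) (h₂ : θ₂ ∈ F.Θ) :
    Integrable (llr (F.dist θ₁) (F.dist θ₂)) (F.dist θ₁) ∧
      ∫ x, llr (F.dist θ₁) (F.dist θ₂) x ∂(F.dist θ₁)
        = (θ₁ - θ₂) * F.mean θ₁ - (F.b θ₁ - F.b θ₂) := by
  have := F.isProbabilityMeasure_dist h₁
  have hi := (F.integrable_id_dist h₁).const_mul (θ₁ - θ₂)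
  have hae := (F.llr_dist h₁ h₂).2
  refine ⟨(hi.sub (integrable_const (F.b θ₁ - F.b θ₂))).congr hae.symm, ?_⟩
  rw [integral_congr_ae hae, integral_sub hi (integrable_const _), integral_const_mul]
  simp [mean]

theorem kl_mean {θ₁ θ₂ : ℝ} (h₁ : θ₁ ∈ F.Θ) (h₂ : θ₂ ∈ F.Θ) :
    F.kl (F.mean θ₁) θ₂ = InformationTheory.klDiv (F.dist θ₁) (F.dist θ₂) := by
  have := F.isProbabilityMeasure_dist h₁
  have := F.isProbabilityMeasure_dist h₂
  rw [InformationTheory.klDiv_of_ac_of_integrable (F.llr_dist h₁ h₂).1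
    (F.integral_llr_dist h₁ h₂).1, (F.integral_llr_dist h₁ h₂).2, kl]
  simp only [probReal_univ, add_sub_cancel_right]
  refine le_antisymm (iSup₂_le fun θ' h' => ENNReal.ofReal_le_ofReal ?_)
    (le_iSup₂_of_le θ₁ h₁ le_rfl)
  have := F.isProbabilityMeasure_dist h'
  have hnn := InformationTheory.integral_llr_add_sub_measure_univ_nonneg (F.llr_dist h₁ h').1
    (F.integral_llr_dist h₁ h').1
  rw [(F.integral_llr_dist h₁ h').2] at hnn
  simp only [probReal_univ, add_sub_cancel_right] at hnn
  nlinarith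

end ExpFamily

/-! ### The interaction with the bandit -/

/-- A (randomized, adaptive) sampling process for the arms `η_{θ 0}, …, η_{θ (K-1)}`. The `n`-th
sample, counted from `0`, pulls arm `A n` and yields the reward `X n`. The σ-algebra `ℱ n` is the
information present when the `n`-th reward is drawn: all earlier arms and rewards, the arm `A n`
and any auxiliary randomization of the policy. Given `ℱ n`, the reward has the law of arm `A n`. -/
structure IsBanditProcess {Ω : Type*} [mΩ : MeasurableSpace Ω] (P : Measure Ω) (F : ExpFamily)
    {K : ℕ} (θ : Fin K → ℝ) (ℱ : Filtration ℕ mΩ) (A : ℕ → Ω → Fin K) (X : ℕ → Ω → ℝ) :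
    Prop where
  measurable_arm : ∀ n, Measurable[ℱ n] (A n)
  measurable_reward : ∀ n, Measurable[ℱ (n + 1)] (X n)
  reward_law : ∀ n (s : Set ℝ), MeasurableSet s →
    P[(X n ⁻¹' s).indicator (fun _ => (1 : ℝ)) | ℱ n]
      =ᵐ[P] fun ω => (F.dist (θ (A n ω))).real s

/-! ### The algorithm, along one sequence of arms and rewards

The samples with index `l < τ₁` are the offline data; the `t`-th online sample has index
`τ₁ + t - 1`. -/

/-- Number of pulls of arm `a` among the samples with index in `[m, n)`. -/
def pulls {K : ℕ} (arm : ℕ → Fin K) (a : Fin K) (m n : ℕ) : ℕ :=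
  ((Finset.Ico m n).filter (fun l => arm l = a)).card

/-- Empirical mean of arm `a` over the first `n` samples. -/
def empMean {K : ℕ} (arm : ℕ → Fin K) (reward : ℕ → ℝ) (a : Fin K) (n : ℕ) : ℝ :=
  (∑ l ∈ (Finset.range n).filter (fun l => arm l = a), reward l) / (pulls arm a 0 n : ℝ)

/-- The statistic `Z_{a,b}(N, μ̂(t))`, at a vector `N` of numbers of online samples. -/
def Zstat (F : ExpFamily) {K : ℕ} (τ₁ : ℕ) (arm : ℕ → Fin K) (reward : ℕ → ℝ) (t : ℕ)
    (N : Fin K → ℝ) (a b : Fin K) : ℝ≥0∞ :=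
  F.glr ((pulls arm a 0 τ₁ : ℝ) + N a) (empMean arm reward a (τ₁ + t))
    ((pulls arm b 0 τ₁ : ℝ) + N b) (empMean arm reward b (τ₁ + t))

/-- The threshold `β(t, δ)`. -/
def threshold (K : ℕ) (δ : ℝ) (t : ℕ) : ℝ :=
  Real.log (((K : ℝ) - 1) / δ) + 6 * Real.log (Real.log ((t : ℝ) / 2) + 1)
    + 8 * Real.log (1 + Real.log (((K : ℝ) - 1) / δ))

/-- The stopping test after `t` online samples, for the empirical best arm `i`. -/
def StopTest (F : ExpFamily) {K : ℕ} (τ₁ : ℕ) (δ : ℝ) (arm : ℕ → Fin K) (reward : ℕ → ℝ)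
    (t : ℕ) (i : Fin K) : Prop :=
  ∀ b, b ≠ i → ENNReal.ofReal (threshold K δ (τ₁ + t)) ≤
    Zstat F τ₁ arm reward t (fun a => (pulls arm a τ₁ (τ₁ + t) : ℝ)) i b

/-- The number `t` of online samples after which the algorithm stops: the first one, from the end
of the initialization on, at which the stopping test is passed. -/
def IsStopTime (F : ExpFamily) {K : ℕ} (τ₁ : ℕ) (δ : ℝ) (arm : ℕ → Fin K) (reward : ℕ → ℝ)
    (istar : ℕ → Fin K) (t : ℕ) : Prop :=
  IsLeast {s | K ≤ s ∧ StopTest F τ₁ δ arm reward s (istar s)} t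

/-- Feasible points of the plug-in optimization problem at time `t`. -/
def PlugInFeasible (F : ExpFamily) {K : ℕ} (τ₁ : ℕ) (δ : ℝ) (arm : ℕ → Fin K) (reward : ℕ → ℝ)
    (t : ℕ) (i : Fin K) (N : Fin K → ℝ) : Prop :=
  (∀ a, 0 ≤ N a) ∧ ∀ b, b ≠ i →
    ENNReal.ofReal (Real.log (1 / δ) + Real.log (Real.log (1 / δ))) ≤
      Zstat F τ₁ arm reward t N i b

/-- Optimal solutions of the plug-in optimization problem at time `t`: minimize `∑ a, N a`. -/
def PlugInOptimal (F : ExpFamily) {K : ℕ} (τ₁ : ℕ) (δ : ℝ) (arm : ℕ → Fin K) (reward : ℕ → ℝ)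
    (t : ℕ) (i : Fin K) (N : Fin K → ℝ) : Prop :=
  PlugInFeasible F τ₁ δ arm reward t i N ∧
    ∀ N', PlugInFeasible F τ₁ δ arm reward t i N' → ∑ a, N a ≤ ∑ a, N' a

/-- `v` is a vector of estimated fractions `N a / ∑ b, N b` of an optimal solution `N` of the
plug-in problem, up to the numerical accuracy `ε`. If there is no nonzero optimal solution, the
fractions are not defined, and `v` may be any vector of proportions. -/
def PlugInFractions (F : ExpFamily) {K : ℕ} (τ₁ : ℕ) (δ ε : ℝ) (arm : ℕ → Fin K)
    (reward : ℕ → ℝ) (t : ℕ) (i : Fin K) (v : Fin K → ℝ) : Prop :=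
  v ∈ stdSimplex ℝ (Fin K) ∧
    ((∃ N, PlugInOptimal F τ₁ δ arm reward t i N ∧ 0 < ∑ b, N b) →
      ∃ N, PlugInOptimal F τ₁ δ arm reward t i N ∧ 0 < ∑ b, N b ∧
        ∀ a, |v a - N a / ∑ b, N b| ≤ ε)

/-- The sequences `arm`, `reward` and empirical best arms `istar` (ties broken arbitrarily) are
a run of the batch Track-and-Stop algorithm. The loop body is imposed only as long as the
algorithm has not stopped; what comes after the stopping time is irrelevant and left free. -/
def IsBatchTrackAndStopRun (F : ExpFamily) {K : ℕ} (τ₁ : ℕ) (δ ε : ℝ) (arm : ℕ → Fin K)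
    (reward : ℕ → ℝ) (istar : ℕ → Fin K) : Prop :=
  -- `istar t` is an empirical best arm
  (∀ t, K ≤ t → ∀ a, empMean arm reward a (τ₁ + t) ≤ empMean arm reward (istar t) (τ₁ + t)) ∧
  -- initialization: pull each arm once
  (∀ a, pulls arm a τ₁ (τ₁ + K) = 1) ∧
  ∃ (count : ℕ → ℕ) (w what : ℕ → Fin K → ℝ),
    count K = 0 ∧ (∀ a, w K a = 1 / K) ∧
    -- the loop
    ∀ t, K ≤ t → (∀ s, K ≤ s → s ≤ t → ¬ StopTest F τ₁ δ arm reward s (istar s)) →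
      -- exploration step
      (IsSquare (t / K) →
        (∀ a, w (t + 1) a = (t : ℝ) / (t + 1) * w t a + 1 / (t + 1) * (1 / K)) ∧
        (K ∣ count t + 1 →
          PlugInFractions F τ₁ δ ε arm reward t (istar t) (what (t + 1)) ∧ count (t + 1) = 0) ∧
        (¬ K ∣ count t + 1 → what (t + 1) = what t ∧ count (t + 1) = count t + 1)) ∧
      -- tracking step
      (¬ IsSquare (t / K) →
        what (t + 1) = what t ∧ count (t + 1) = count t ∧
        ∀ a, w (t + 1) a = (t : ℝ) / (t + 1) * w t a + 1 / (t + 1) * what (t + 1) a) ∧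
      -- the next arm maximizes `w_a(t+1) / N_a(t)`
      (∀ a, w (t + 1) a / pulls arm a τ₁ (τ₁ + t) ≤
        w (t + 1) (arm (τ₁ + t)) / pulls arm (arm (τ₁ + t)) τ₁ (τ₁ + t))

/-- `δ`-correctness of a procedure that may stop after `t` online samples on the event
`stops t` and then outputs the arm `out t`: it stops almost surely, and the arm that it outputs
differs from `best` with probability at most `δ`. -/
structure IsDeltaCorrect {Ω : Type*} [MeasurableSpace Ω] (P : Measure Ω) {K : ℕ} (δ : ℝ)
    (best : Fin K) (stops : ℕ → Ω → Prop) (out : ℕ → Ω → Fin K) : Prop where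
  stops_ae : ∀ᵐ ω ∂P, ∃ t, stops t ω
  error_le : P {ω | ∃ t, stops t ω ∧ out t ω ≠ best} ≤ ENNReal.ofReal δ

end

/-! Error probability. It is enough to bound by `δ / (K - 1)` the probability of outputting a given
arm `i` with `θ i < θ j`, where `j` is the best arm. Take the parameter `θ₀` of `j` as a common
reference. When `i` looks at least as good as `j`, the GLR statistic of the pair is at most the best
log-likelihood ratio of the sample of `i` against `θ₀` over parameters `≥ θ₀`, plus that of the
sample of `j` over parameters `≤ θ₀` (`ExpFamily.glr_le_of_forall_le`). Both are maxima of
statistics `λ S_n - n ψ(λ)` whose exponentials are supermartingales; for arm `i` this holds because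
the increments of the convex function `b` increase.

The sampling is adaptive, but completing the recorded rewards of the two arms by fresh independent
draws gives two independent i.i.d. stacks (`IsBanditProcess.lintegral_splice`). A wrong stop
therefore forces two independent stacks to cross the threshold at some pair of sample sizes `(n,
m)`. The iterated logarithm term of the threshold dominates `3 * iterLog n + 3 * iterLog m`, so the
sum of two independent excesses must reach `baseLevel L`, with `L = log ((K - 1) / δ)`. Maximal
inequalities give each excess an exponential tail, and a convolution estimate bounds the sum.

The target is `exp (-L)`. For `L ≥ 2` geometric peeling suffices. For `0.69 ≤ L ≤ 2` a finer
weighting of lines gives the tail `33/20 * exp (-3v/4)`. Smaller `L` occurs only for `K = 2`. Then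
the initial exploration leaves few pairs in which one sample size is `1`; these pairs and the event
that both sizes are at least `2` are increasing events of product measures. By positive association
their non-occurrence probabilities multiply, which yields a nontrivial bound even where a union
bound exceeds `1` (`small_level_estimate`).

Stopping. Forced exploration and tracking sample every arm more than `M` times within `trackTime K
M` rounds unless the algorithm has stopped. Outside events of probability tending to `0`, the
empirical means are then near the true ones and the GLR statistic grows linearly in `M`, while the
threshold at that time is at most logarithmic in `M`. -/

/-! ### Partial sums of finite stacks of rewards -/

/-- The sum of the first `n` entries of a finite stack. -/
def prefixSum {T : ℕ} (n : ℕ) (u : Fin T → ℝ) : ℝ := ∑ k : Fin T, if (k : ℕ) < n then u k else 0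

@[simp] theorem prefixSum_zero {T : ℕ} (u : Fin T → ℝ) : prefixSum 0 u = 0 := by
  simp [prefixSum]

theorem prefixSum_succ_cons {T : ℕ} (n : ℕ) (x : ℝ) (u : Fin T → ℝ) :
    prefixSum (n + 1) (Fin.cons x u : Fin (T + 1) → ℝ) = x + prefixSum n u := by
  simp [prefixSum, Fin.sum_univ_succ]

theorem prefixSum_mono {T : ℕ} (n : ℕ) : Monotone (prefixSum (T := T) n) := by
  intro u v h
  refine Finset.sum_le_sum fun k _ => ?_
  split_ifs
  · exact h k
  · exact le_rfl

@[fun_prop] theorem measurable_prefixSum {T : ℕ} (n : ℕ) : Measurable (prefixSum (T := T) n) := by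
  refine Finset.measurable_sum _ fun k _ => ?_
  split_ifs
  · exact measurable_pi_apply k
  · exact measurable_const

theorem measurable_finCons {T : ℕ} :
    Measurable (fun p : ℝ × (Fin T → ℝ) => (Fin.cons p.1 p.2 : Fin (T + 1) → ℝ)) := by
  refine measurable_pi_iff.2 fun i => ?_
  refine Fin.cases ?_ (fun j => ?_) i
  · simpa using measurable_fst
  · simp only [Fin.cons_succ]
    exact (measurable_pi_apply j).comp measurable_snd

theorem lintegral_pi_succ {T : ℕ} (μ : Measure ℝ) [IsProbabilityMeasure μ]
    {f : (Fin (T + 1) → ℝ) → ℝ≥0∞} (hf : Measurable f) :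
    ∫⁻ u, f u ∂(Measure.pi fun _ : Fin (T + 1) => μ)
      = ∫⁻ x, ∫⁻ u, f (Fin.cons x u) ∂(Measure.pi fun _ : Fin T => μ) ∂μ := by
  have h := (measurePreserving_piFinSuccAbove (fun _ : Fin (T + 1) => μ) 0).symm
  rw [← h.lintegral_comp_emb (MeasurableEquiv.measurableEmbedding _)]
  have hm := (hf.comp (MeasurableEquiv.measurable
    (MeasurableEquiv.piFinSuccAbove (fun _ : Fin (T + 1) => ℝ) 0).symm)).aemeasurable
    (μ := μ.prod (Measure.pi fun _ : Fin T => μ))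
  refine (lintegral_prod _ hm).trans ?_
  simp only [Function.comp_apply]
  refine lintegral_congr fun x => lintegral_congr fun u => ?_
  congr 1
  exact Fin.insertNth_zero' x u

/-- **Ville's maximal inequality** for a finite mixture of exponential martingales. -/
theorem measure_exists_mixture_le {ι : Type*} (J : Finset ι) (lam ψ : ι → ℝ)
    (μ : Measure ℝ) [IsProbabilityMeasure μ]
    (hμ : ∀ j ∈ J, ∫⁻ x, ENNReal.ofReal (Real.exp (lam j * x - ψ j)) ∂μ ≤ 1) (T : ℕ)
    (w : ι → ℝ≥0∞) :
    (Measure.pi fun _ : Fin T => μ) {u | ∃ n ≤ T,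
      1 ≤ ∑ j ∈ J, w j * ENNReal.ofReal (Real.exp (lam j * prefixSum n u - n * ψ j))}
      ≤ ∑ j ∈ J, w j := by
  -- Given the first entry `x`, the mixture starts afresh with weights `w j * exp (lam j * x - ψ
  -- j)`, whose mean is at most `w j`; hence the weights vary in the induction. If they already sum
  -- to `1`, the bound is trivial.
  induction T generalizing w with
  | zero =>
    by_cases h : 1 ≤ ∑ j ∈ J, w j
    · exact prob_le_one.trans h
    · convert zero_le (a := ∑ j ∈ J, w j)
      refine measure_mono_null (t := ∅) ?_ measure_empty
      rintro u ⟨n, hn, h1⟩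
      obtain rfl : n = 0 := by omega
      simp at h1
      exact h h1
  | succ T ih =>
    by_cases h : 1 ≤ ∑ j ∈ J, w j
    · exact prob_le_one.trans h
    have hmeas : MeasurableSet {u : Fin (T + 1) → ℝ | ∃ n ≤ T + 1,
        1 ≤ ∑ j ∈ J, w j * ENNReal.ofReal (Real.exp (lam j * prefixSum n u - n * ψ j))} := by
      simp only [Set.ofPred_exists, Set.ofPred_and]
      refine MeasurableSet.iUnion fun n => MeasurableSet.inter (.const _) ?_
      exact measurableSet_le measurable_const (by fun_prop)
    rw [← lintegral_indicator_one hmeas, lintegral_pi_succ μ (measurable_one.indicator hmeas)]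
    have key : ∀ x, ∫⁻ u : Fin T → ℝ, Set.indicator {u : Fin (T + 1) → ℝ | ∃ n ≤ T + 1,
        1 ≤ ∑ j ∈ J, w j * ENNReal.ofReal (Real.exp (lam j * prefixSum n u - n * ψ j))}
          (1 : (Fin (T + 1) → ℝ) → ℝ≥0∞) (Fin.cons x u) ∂(Measure.pi fun _ : Fin T => μ)
        ≤ ∑ j ∈ J, w j * ENNReal.ofReal (Real.exp (lam j * x - ψ j)) := by
      intro x
      refine le_trans ?_ (ih fun j => w j * ENNReal.ofReal (Real.exp (lam j * x - ψ j)))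
      rw [← lintegral_indicator_one₀]
      · have hsub : (fun u => (Fin.cons x u : Fin (T + 1) → ℝ)) ⁻¹' {u : Fin (T + 1) → ℝ |
            ∃ n ≤ T + 1, 1 ≤ ∑ j ∈ J,
              w j * ENNReal.ofReal (Real.exp (lam j * prefixSum n u - n * ψ j))}
            ⊆ {u | ∃ n ≤ T, 1 ≤ ∑ j ∈ J, w j * ENNReal.ofReal (Real.exp (lam j * x - ψ j)) *
              ENNReal.ofReal (Real.exp (lam j * prefixSum n u - n * ψ j))} := by
          rintro u ⟨n, hn, h1⟩
          cases n with
          | zero => simp at h1; exact absurd h1 h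
          | succ n =>
            refine ⟨n, by omega, h1.trans (Finset.sum_le_sum fun j _ => ?_)⟩
            rw [mul_assoc, ← ENNReal.ofReal_mul (Real.exp_nonneg _), ← Real.exp_add,
              prefixSum_succ_cons]
            push_cast
            gcongr w j * ENNReal.ofReal (Real.exp ?_)
            linarith
        refine lintegral_mono fun u => Set.indicator_apply_le' (fun hu => ?_) fun _ => zero_le
        rw [Set.indicator_of_mem (hsub hu)]
        rfl
      · refine MeasurableSet.nullMeasurableSet ?_
        simp only [Set.ofPred_exists, Set.ofPred_and]
        refine MeasurableSet.iUnion fun n => MeasurableSet.inter (.const _) ?_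
        exact measurableSet_le measurable_const (by fun_prop)
    refine (lintegral_mono key).trans ?_
    rw [lintegral_finsetSum _ fun j _ => by fun_prop]
    refine Finset.sum_le_sum fun j hj => ?_
    rw [lintegral_const_mul _ (by fun_prop)]
    exact (mul_le_mul_right (hμ j hj) _).trans_eq (mul_one _)

/-! ### Maxima of finitely many exponential statistics -/

/-- A finite set `D` of nonnegative exponents, containing `0`, together with upper bounds `ψ` of
the cumulant generating function of `μ` on `D`. -/
structure IsCumulantBound (μ : Measure ℝ) (D : Finset ℝ) (ψ : ℝ → ℝ) : Prop where
  nonneg : ∀ l ∈ D, 0 ≤ l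
  zero_mem : (0 : ℝ) ∈ D
  map_zero : ψ 0 = 0
  lintegral_le : ∀ l ∈ D, ∫⁻ x, ENNReal.ofReal (Real.exp (l * x - ψ l)) ∂μ ≤ 1

namespace IsCumulantBound

variable {μ : Measure ℝ} {D : Finset ℝ} {ψ : ℝ → ℝ}

/-- The largest of the statistics `λ S_n - n ψ(λ)` for `λ ∈ D`. -/
def stat (h : IsCumulantBound μ D ψ) {T : ℕ} (n : ℕ) (u : Fin T → ℝ) : ℝ :=
  D.sup' ⟨0, h.zero_mem⟩ fun l => l * prefixSum n u - n * ψ l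

theorem le_stat_iff (h : IsCumulantBound μ D ψ) {T : ℕ} {n : ℕ} {u : Fin T → ℝ} {x : ℝ} :
    x ≤ h.stat n u ↔ ∃ l ∈ D, x ≤ l * prefixSum n u - n * ψ l :=
  Finset.le_sup'_iff _

theorem stat_nonneg (h : IsCumulantBound μ D ψ) {T : ℕ} (n : ℕ) (u : Fin T → ℝ) :
    0 ≤ h.stat n u :=
  h.le_stat_iff.2 ⟨0, h.zero_mem, by simp [h.map_zero]⟩

theorem stat_mono (h : IsCumulantBound μ D ψ) {T : ℕ} (n : ℕ) :
    Monotone (h.stat (T := T) n) := by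
  intro u v huv
  obtain ⟨l, hl, hle⟩ := h.le_stat_iff.1 (le_refl (h.stat n u))
  refine h.le_stat_iff.2 ⟨l, hl, hle.trans ?_⟩
  have := mul_le_mul_of_nonneg_left (prefixSum_mono n huv) (h.nonneg l hl)
  linarith

@[fun_prop]
theorem measurable_stat (h : IsCumulantBound μ D ψ) {T : ℕ} (n : ℕ) :
    Measurable (h.stat (T := T) n) := by
  have := Finset.measurable_sup' (f := fun l (u : Fin T → ℝ) => l * prefixSum n u - n * ψ l)
    ⟨0, h.zero_mem⟩ (fun l _ => by fun_prop)
  convert this using 1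
  funext u
  exact (Finset.sup'_apply (⟨0, h.zero_mem⟩ : D.Nonempty)
    (fun l (u : Fin T → ℝ) => l * prefixSum n u - n * ψ l) u).symm

/-- A union bound over lines through the origin: a crossing of the boundary `ℓ` at time `n` is a
crossing of all the lines that lie below the boundary at time `n`. -/
theorem measure_exists_le_stat_le (h : IsCumulantBound μ D ψ) [IsProbabilityMeasure μ] (T : ℕ)
    {ι : Type*} (J : Finset ι) (κ w : ι → ℝ) (hκ : ∀ j ∈ J, 0 < κ j) (hw : ∀ j ∈ J, 0 ≤ w j)
    (I : Set ℕ) (ℓ : ℕ → ℝ)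
    (hI : ∀ n ∈ I, n ≤ T → 0 < n ∧ ∃ J' ⊆ J, (∀ j ∈ J', n * κ j ≤ ℓ n) ∧
      1 ≤ ∑ j ∈ J', w j * Real.exp (n * κ j)) :
    (Measure.pi fun _ : Fin T => μ) {u | ∃ n ≤ T, n ∈ I ∧ ℓ n ≤ h.stat n u}
      ≤ ENNReal.ofReal (∑ j ∈ J, w j) := by
  classical
  by_cases hD : ∃ l ∈ D, 0 < l
  -- The exponent `l` crosses the line of slope `κ j` exactly when the sample average reaches `(κ j
  -- + ψ l) / l`. The minimizer of this ratio crosses as soon as any exponent does, so one exponent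
  -- per line suffices and the maximum over `D` costs nothing.
  · have hmin : ∀ j, ∃ l ∈ D, 0 < l ∧ ∀ l' ∈ D, 0 < l' →
        (κ j + ψ l) / l ≤ (κ j + ψ l') / l' := by
      intro j
      obtain ⟨l, hl, hl'⟩ := (D.filter (0 < ·)).exists_min_image (fun l => (κ j + ψ l) / l)
        (by obtain ⟨l, h1, h2⟩ := hD; exact ⟨l, by simp [h1, h2]⟩)
      simp only [Finset.mem_filter] at hl hl'
      exact ⟨l, hl.1, hl.2, fun l' h1 h2 => hl' l' ⟨h1, h2⟩⟩
    choose lam hlD hlpos hlmin using hmin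
    refine le_trans (measure_mono ?_) ((measure_exists_mixture_le J lam (fun j => ψ (lam j)) μ
      (fun j _ => h.lintegral_le _ (hlD j)) T (fun j => ENNReal.ofReal (w j))).trans_eq
      (ENNReal.ofReal_sum_of_nonneg hw).symm)
    rintro u ⟨n, hn, hnI, hle⟩
    obtain ⟨hn0, J', hJ', hbelow, hone⟩ := hI n hnI hn
    refine ⟨n, hn, ?_⟩
    obtain ⟨l, hl, hlu⟩ := h.le_stat_iff.1 hle
    have hn0' : (0 : ℝ) < n := by exact_mod_cast hn0
    have hstep : ∀ j ∈ J', n * κ j ≤ lam j * prefixSum n u - n * ψ (lam j) := by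
      intro j hj
      have hκj := hκ j (hJ' hj)
      have hb := hbelow j hj
      have hlpos' : 0 < l := by
        rcases (h.nonneg l hl).lt_or_eq with h0 | h0
        · exact h0
        · subst h0
          have : 0 < n * κ j := by positivity
          simp [h.map_zero] at hlu
          linarith
      have h1 : n * ((κ j + ψ l) / l) ≤ prefixSum n u := by
        rw [← mul_div_assoc, div_le_iff₀ hlpos']
        linarith
      have h2 : n * ((κ j + ψ (lam j)) / lam j) ≤ prefixSum n u :=
        (mul_le_mul_of_nonneg_left (hlmin j l hl hlpos') hn0'.le).trans h1
      rw [← mul_div_assoc, div_le_iff₀ (hlpos j)] at h2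
      linarith
    rw [← ENNReal.ofReal_one]
    calc ENNReal.ofReal 1 ≤ ENNReal.ofReal (∑ j ∈ J', w j * Real.exp (n * κ j)) :=
          ENNReal.ofReal_le_ofReal hone
      _ ≤ ENNReal.ofReal
          (∑ j ∈ J, w j * Real.exp (lam j * prefixSum n u - n * ψ (lam j))) := by
          refine ENNReal.ofReal_le_ofReal ((Finset.sum_le_sum fun j hj => ?_).trans
            (Finset.sum_le_sum_of_subset_of_nonneg hJ' fun j hj _ =>
              mul_nonneg (hw j hj) (Real.exp_nonneg _)))
          exact mul_le_mul_of_nonneg_left (Real.exp_le_exp.2 (hstep j hj)) (hw j (hJ' hj))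
      _ = _ := by
          rw [ENNReal.ofReal_sum_of_nonneg fun j hj => mul_nonneg (hw j hj) (Real.exp_nonneg _)]
          exact Finset.sum_congr rfl fun j hj => ENNReal.ofReal_mul (hw j hj)
  · push Not at hD
    convert zero_le (a := ENNReal.ofReal (∑ j ∈ J, w j))
    refine measure_mono_null (t := ∅) ?_ measure_empty
    rintro u ⟨n, hn, hnI, hle⟩
    obtain ⟨hn0, J', hJ', hbelow, hone⟩ := hI n hnI hn
    obtain ⟨l, hl, hlu⟩ := h.le_stat_iff.1 hle
    obtain rfl : l = 0 := le_antisymm (hD l hl) (h.nonneg l hl)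
    have : J'.Nonempty := by
      rw [Finset.nonempty_iff_ne_empty]
      rintro rfl
      simp at hone
      linarith
    obtain ⟨j, hj⟩ := this
    have hκj := hκ j (hJ' hj)
    have hb := hbelow j hj
    have hn0' : (0 : ℝ) < n := by exact_mod_cast hn0
    have : 0 < n * κ j := by positivity
    simp [h.map_zero] at hlu
    linarith

end IsCumulantBound

/-! ### Positive association -/

/-- `μ` is positively associated: decreasing functions are positively correlated. -/
def IsAssociated {α : Type*} [Preorder α] [MeasurableSpace α] (μ : Measure α) : Prop :=
  ∀ f g : α → ℝ≥0∞, Measurable f → Measurable g → Antitone f → Antitone g →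
    (∫⁻ x, f x ∂μ) * (∫⁻ x, g x ∂μ) ≤ ∫⁻ x, f x * g x ∂μ

/-- Chebyshev's argument: for independent copies `x`, `y`, the product of the differences of `f` and
of `g` is nonnegative. It is expanded here so that no subtraction occurs in `ℝ≥0∞`. -/
theorem isAssociated_of_linearOrder (μ : Measure ℝ)
    [IsProbabilityMeasure μ] : IsAssociated μ := by
  intro f g hf hg hfa hga
  have key : ∀ x y, f x * g y + f y * g x ≤ f x * g x + f y * g y := by
    intro x y
    rcases le_total x y with h | h
    · obtain ⟨e, he⟩ := exists_add_of_le (hfa h)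
      obtain ⟨k, hk⟩ := exists_add_of_le (hga h)
      rw [he, hk]
      exact le_add_right (c := e * k) le_rfl |>.trans_eq (by ring)
    · obtain ⟨e, he⟩ := exists_add_of_le (hfa h)
      obtain ⟨k, hk⟩ := exists_add_of_le (hga h)
      rw [he, hk]
      exact le_add_right (c := e * k) le_rfl |>.trans_eq (by ring)
  have h2 : ∫⁻ x, ∫⁻ y, (f x * g y + f y * g x) ∂μ ∂μ ≤
      ∫⁻ x, ∫⁻ y, (f x * g x + f y * g y) ∂μ ∂μ :=
    lintegral_mono fun x => lintegral_mono fun y => key x y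
  have e1 : ∫⁻ x, ∫⁻ y, (f x * g y + f y * g x) ∂μ ∂μ
      = 2 * ((∫⁻ x, f x ∂μ) * (∫⁻ x, g x ∂μ)) := by
    have : ∀ x, ∫⁻ y, (f x * g y + f y * g x) ∂μ
        = f x * (∫⁻ y, g y ∂μ) + (∫⁻ y, f y ∂μ) * g x := by
      intro x
      rw [lintegral_add_left (by fun_prop), lintegral_const_mul _ hg, lintegral_mul_const _ hf]
    simp only [this]
    rw [lintegral_add_left (by fun_prop), lintegral_mul_const _ hf, lintegral_const_mul _ hg,
      two_mul]
  have e2 : ∫⁻ x, ∫⁻ y, (f x * g x + f y * g y) ∂μ ∂μ = 2 * ∫⁻ x, f x * g x ∂μ := by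
    have : ∀ x, ∫⁻ y, (f x * g x + f y * g y) ∂μ = f x * g x + ∫⁻ y, f y * g y ∂μ := by
      intro x
      rw [lintegral_add_left (by fun_prop)]
      simp
    simp only [this]
    rw [lintegral_add_left (by fun_prop), two_mul]
    simp
  rw [e1, e2] at h2
  exact (ENNReal.mul_le_mul_iff_right (by simp) (by simp)).1 h2

/-- Association of `ν` is applied on each fibre, and that of `μ` to the fibre integrals, which are
again antitone. -/
theorem IsAssociated.prod {α β : Type*} [Preorder α] [MeasurableSpace α] [Preorder β]
    [MeasurableSpace β] {μ : Measure α} {ν : Measure β} [SFinite ν] [SFinite μ]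
    (hμ : IsAssociated μ) (hν : IsAssociated ν) : IsAssociated (μ.prod ν) := by
  intro f g hf hg hfa hga
  rw [lintegral_prod _ hf.aemeasurable, lintegral_prod _ hg.aemeasurable,
    lintegral_prod (fun x => f x * g x) (hf.mul hg).aemeasurable]
  refine (hμ _ _ hf.lintegral_prod_right' hg.lintegral_prod_right' ?_ ?_).trans
    (lintegral_mono fun x => ?_)
  · exact fun x y h => lintegral_mono fun z => hfa (Prod.mk_le_mk.2 ⟨h, le_rfl⟩)
  · exact fun x y h => lintegral_mono fun z => hga (Prod.mk_le_mk.2 ⟨h, le_rfl⟩)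
  · exact hν _ _ (by fun_prop) (by fun_prop)
      (fun y z h => hfa (Prod.mk_le_mk.2 ⟨le_rfl, h⟩))
      (fun y z h => hga (Prod.mk_le_mk.2 ⟨le_rfl, h⟩))

theorem isAssociated_pi (μ : Measure ℝ) [IsProbabilityMeasure μ] (T : ℕ) :
    IsAssociated (Measure.pi fun _ : Fin T => μ) := by
  induction T with
  | zero =>
    intro f g hf hg hfa hga
    rw [Measure.pi_of_empty (fun _ : Fin 0 => μ) (fun i => i.elim0)]
    simp [lintegral_dirac]
  | succ T ih =>
    intro f g hf hg hfa hga
    rw [lintegral_pi_succ μ hf, lintegral_pi_succ μ hg, lintegral_pi_succ μ (f := fun x => f x * g x)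
      (hf.mul hg)]
    have hc := measurable_finCons (T := T)
    have hm : ∀ {x y : ℝ} {u v : Fin T → ℝ}, x ≤ y → u ≤ v →
        (Fin.cons x u : Fin (T + 1) → ℝ) ≤ Fin.cons y v := by
      intro x y u v h1 h2
      exact Fin.cons_le_cons.2 ⟨h1, h2⟩
    have := (isAssociated_of_linearOrder μ).prod ih
      (fun p => f (Fin.cons p.1 p.2)) (fun p => g (Fin.cons p.1 p.2)) (hf.comp hc) (hg.comp hc)
      (fun p q h => hfa (hm h.1 h.2)) (fun p q h => hga (hm h.1 h.2))
    rwa [lintegral_prod (fun p : ℝ × (Fin T → ℝ) => f (Fin.cons p.1 p.2))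
        (hf.comp hc).aemeasurable,
      lintegral_prod (fun p : ℝ × (Fin T → ℝ) => g (Fin.cons p.1 p.2))
        (hg.comp hc).aemeasurable,
      lintegral_prod (fun p : ℝ × (Fin T → ℝ) => f (Fin.cons p.1 p.2) * g (Fin.cons p.1 p.2))
        ((hf.comp hc).mul (hg.comp hc)).aemeasurable] at this

theorem IsAssociated.measure_mul_le {α : Type*} [Preorder α] [MeasurableSpace α] {μ : Measure α}
    (hμ : IsAssociated μ) {s t : Set α} (hs : MeasurableSet s) (ht : MeasurableSet t)
    (hsl : IsLowerSet s) (htl : IsLowerSet t) : μ s * μ t ≤ μ (s ∩ t) := by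
  have hanti : ∀ {s : Set α}, IsLowerSet s → Antitone (s.indicator (1 : α → ℝ≥0∞)) := by
    intro s hs x y h
    by_cases hy : y ∈ s
    · simp [hy, hs h hy]
    · simp [hy]
  have := hμ _ _ (measurable_one.indicator hs) (measurable_one.indicator ht) (hanti hsl)
    (hanti htl)
  rw [lintegral_indicator_one hs, lintegral_indicator_one ht] at this
  refine this.trans_eq ?_
  rw [← lintegral_indicator_one (hs.inter ht), Set.inter_indicator_one]
  rfl

/-! ### Sums of independent variables with exponential tails -/

/-- A prefactor `s ≥ 1` is the same as a shift of the variable by `log s / ρ`. -/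
theorem exp_tail_shift {α : Type*} [MeasurableSpace α] {μ : Measure α} {A : α → ℝ} {s ρ : ℝ}
    (hs : 1 ≤ s) (hρ : 0 < ρ)
    (hAt : ∀ v, 0 < v → μ {a | v ≤ A a} ≤ ENNReal.ofReal (s * Real.exp (-(ρ * v)))) :
    ∀ v, 0 < v → μ {a | v ≤ max (A a - Real.log s / ρ) 0}
      ≤ ENNReal.ofReal (1 * Real.exp (-(ρ * v))) := by
  have hlog := Real.log_nonneg hs
  have hc0 : 0 ≤ Real.log s / ρ := by positivity
  have hρc : ρ * (Real.log s / ρ) = Real.log s := by field_simp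
  have hsexp : s = Real.exp (Real.log s) := (Real.exp_log (by linarith)).symm
  intro v hv
  refine (measure_mono fun a ha => ?_).trans
    ((hAt (v + Real.log s / ρ) (by linarith)).trans_eq ?_)
  · simp only [Set.mem_ofPred_eq, le_max_iff] at ha ⊢
    rcases ha with ha | ha <;> linarith
  · nth_rewrite 1 [hsexp]
    rw [← Real.exp_add, one_mul, mul_add, hρc]
    ring_nf

section Convolution

variable {α β : Type*} [MeasurableSpace α] [MeasurableSpace β] {μ : Measure α} {ν : Measure β}
  [IsProbabilityMeasure μ] [IsProbabilityMeasure ν] {A : α → ℝ} {B : β → ℝ}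

theorem lintegral_Ioc_exp {s x c : ℝ} (hs : 0 ≤ s) (hc : 0 ≤ c) :
    ∫⁻ a in Set.Ioc 0 c, ENNReal.ofReal (s * Real.exp (a - x))
      = ENNReal.ofReal (s * (Real.exp (c - x) - Real.exp (-x))) := by
  rw [← ofReal_integral_eq_lintegral_ofReal]
  · rw [← intervalIntegral.integral_of_le hc]
    congr 1
    rw [intervalIntegral.integral_const_mul, intervalIntegral.integral_comp_sub_right
      (fun a => Real.exp a), integral_exp]
    simp
  · exact (Continuous.integrableOn_Ioc (by fun_prop))
  · exact ae_of_all _ fun a => mul_nonneg hs (Real.exp_nonneg _)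

/-- Given `A = a < x`, the tail of `B` gives `s * exp (a - x)`. Writing this as `s * exp (-x)` plus
an integral over `0 < v ≤ a` turns its expectation into an integral of tails of `A`, which
contributes `s² x exp (-x)`. The part `A ≥ x`, where the conditional probability is bounded by `1`
instead of `s`, adds `(1 - s) s exp (-x)`. -/
theorem measure_prod_le_of_exp_tail_aux (hA : Measurable A) (hB : Measurable B)
    (hA0 : ∀ a, 0 ≤ A a) {s : ℝ} (hs : 0 ≤ s) (hs1 : s ≤ 1)
    (hAt : ∀ v, 0 < v → μ {a | v ≤ A a} ≤ ENNReal.ofReal (s * Real.exp (-v)))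
    (hBt : ∀ v, 0 < v → ν {b | v ≤ B b} ≤ ENNReal.ofReal (s * Real.exp (-v)))
    {x : ℝ} (hx' : 0 < x) :
    (μ.prod ν) {p | x ≤ A p.1 + B p.2}
      ≤ ENNReal.ofReal (s * Real.exp (-x) * (2 - s + s * x)) := by
  have hx := hx'.le
  have hmeas : MeasurableSet {p : α × β | x ≤ A p.1 + B p.2} :=
    measurableSet_le measurable_const (by fun_prop)
  rw [Measure.prod_apply hmeas]
  have hpt : ∀ a, ν (Prod.mk a ⁻¹' {p : α × β | x ≤ A p.1 + B p.2}) ≤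
      ENNReal.ofReal (s * Real.exp (-x))
      + (∫⁻ v in Set.Ioc 0 x, ENNReal.ofReal (s * Real.exp (v - x)) *
          {a | v ≤ A a}.indicator 1 a)
      + ENNReal.ofReal (1 - s) * {a | x ≤ A a}.indicator 1 a := by
    intro a
    have hint : ∫⁻ v in Set.Ioc 0 x, ENNReal.ofReal (s * Real.exp (v - x)) *
          {a | v ≤ A a}.indicator 1 a
        = ENNReal.ofReal (s * (Real.exp (min (A a) x - x) - Real.exp (-x))) := by
      rw [← lintegral_Ioc_exp hs (le_min (hA0 a) hx)]
      have : ∀ v, ENNReal.ofReal (s * Real.exp (v - x)) * {a | v ≤ A a}.indicator 1 a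
          = (Set.Iic (A a)).indicator (fun v => ENNReal.ofReal (s * Real.exp (v - x))) v := by
        intro v
        by_cases h : v ≤ A a <;> simp [h]
      simp only [this]
      rw [setLIntegral_indicator measurableSet_Iic]
      congr 2
      ext v
      simp
      tauto
    rw [hint]
    by_cases h : x ≤ A a
    · refine prob_le_one.trans ?_
      rw [min_eq_right h, ← ENNReal.ofReal_add (by positivity)
        (mul_nonneg hs (by simp [hx]))]
      simp only [Set.indicator, Set.mem_ofPred_eq, h, if_true, Pi.one_apply, mul_one]
      rw [← ENNReal.ofReal_add (add_nonneg (by positivity)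
        (mul_nonneg hs (by simp [hx]))) (by linarith), ← ENNReal.ofReal_one]
      refine ENNReal.ofReal_le_ofReal ?_
      simp
      linarith
    · push Not at h
      have hpre : Prod.mk a ⁻¹' {p : α × β | x ≤ A p.1 + B p.2} = {b | x - A a ≤ B b} := by
        ext b
        simp [add_comm]
      rw [hpre, min_eq_left h.le, ← ENNReal.ofReal_add (by positivity)
        (mul_nonneg hs (by simp [hA0 a]))]
      refine ((hBt _ (by linarith)).trans_eq ?_).trans le_self_add
      congr 1
      rw [neg_sub]
      ring
  refine (lintegral_mono hpt).trans ?_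
  have hind : Measurable fun p : α × ℝ => {a | p.2 ≤ A a}.indicator (1 : α → ℝ≥0∞) p.1 := by
    have : (fun p : α × ℝ => {a | p.2 ≤ A a}.indicator (1 : α → ℝ≥0∞) p.1)
        = {p : α × ℝ | p.2 ≤ A p.1}.indicator 1 := by
      ext p
      simp [Set.indicator]
    rw [this]
    exact measurable_one.indicator (measurableSet_le (by fun_prop) (by fun_prop))
  have hset : MeasurableSet {a | x ≤ A a} := measurableSet_le measurable_const hA
  rw [lintegral_add_right _ ((measurable_one.indicator hset).const_mul _),
    lintegral_add_left measurable_const, lintegral_const_mul _ (measurable_one.indicator hset),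
    lintegral_indicator_one hset, lintegral_const, measure_univ, mul_one,
    lintegral_lintegral_swap (by
      apply Measurable.aemeasurable
      exact Measurable.mul (by fun_prop) hind)]
  have hin : ∀ v ∈ Set.Ioc (0 : ℝ) x, ∫⁻ a, ENNReal.ofReal (s * Real.exp (v - x)) *
      {a | v ≤ A a}.indicator 1 a ∂μ ≤ ENNReal.ofReal (s * s * Real.exp (-x)) := by
    intro v hv
    have hset : MeasurableSet {a | v ≤ A a} := measurableSet_le measurable_const hA
    rw [lintegral_const_mul _ (measurable_one.indicator hset), lintegral_indicator_one hset]
    refine (mul_le_mul_right (hAt v hv.1) _).trans_eq ?_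
    rw [← ENNReal.ofReal_mul (by positivity)]
    congr 1
    rw [mul_mul_mul_comm, ← Real.exp_add]
    ring_nf
  have hmid := setLIntegral_mono' measurableSet_Ioc (μ := volume) hin
  rw [setLIntegral_const, Real.volume_Ioc, sub_zero] at hmid
  refine (add_le_add (add_le_add le_rfl hmid) (mul_le_mul_right (hAt x hx') _)).trans_eq ?_
  rw [← ENNReal.ofReal_mul (by positivity), ← ENNReal.ofReal_mul (by linarith),
    ← ENNReal.ofReal_add (by positivity) (by positivity), ← ENNReal.ofReal_add (by positivity)
      (mul_nonneg (by linarith) (by positivity))]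
  congr 1
  ring

/-- The tail of a sum of independent variables, each with tail `s * exp (-ρ v)`, `s ≤ 1`. -/
theorem measure_prod_le_of_exp_tail (hA : Measurable A) (hB : Measurable B)
    (hA0 : ∀ a, 0 ≤ A a) {s ρ : ℝ} (hs : 0 ≤ s) (hs1 : s ≤ 1) (hρ : 0 < ρ)
    (hAt : ∀ v, 0 < v → μ {a | v ≤ A a} ≤ ENNReal.ofReal (s * Real.exp (-(ρ * v))))
    (hBt : ∀ v, 0 < v → ν {b | v ≤ B b} ≤ ENNReal.ofReal (s * Real.exp (-(ρ * v))))
    {x : ℝ} (hx : 0 < x) :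
    (μ.prod ν) {p | x ≤ A p.1 + B p.2}
      ≤ ENNReal.ofReal (s * Real.exp (-(ρ * x)) * (2 - s + s * (ρ * x))) := by
  have h := measure_prod_le_of_exp_tail_aux (μ := μ) (ν := ν) (A := fun a => ρ * A a)
    (B := fun b => ρ * B b) (by fun_prop) (by fun_prop)
    (fun a => mul_nonneg hρ.le (hA0 a)) hs hs1 (fun v hv => ?_) (fun v hv => ?_)
    (mul_pos hρ hx)
  · refine le_trans (measure_mono fun p hp => ?_) h
    simp only [Set.mem_ofPred_eq] at hp ⊢
    rw [← mul_add]
    exact mul_le_mul_of_nonneg_left hp hρ.le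
  · have := hAt (v / ρ) (by positivity)
    rw [mul_div_cancel₀ _ hρ.ne'] at this
    refine le_trans (measure_mono fun p hp => ?_) this
    simp only [Set.mem_ofPred_eq] at hp ⊢
    rwa [div_le_iff₀' hρ]
  · have := hBt (v / ρ) (by positivity)
    rw [mul_div_cancel₀ _ hρ.ne'] at this
    refine le_trans (measure_mono fun p hp => ?_) this
    simp only [Set.mem_ofPred_eq] at hp ⊢
    rwa [div_le_iff₀' hρ]

/-- The tail of a sum of independent variables, each with tail `s * exp (-ρ v)`, `1 ≤ s`. -/
theorem measure_prod_le_of_exp_tail_of_one_le (hA : Measurable A) (hB : Measurable B)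
    {s ρ : ℝ} (hs : 1 ≤ s) (hρ : 0 < ρ)
    (hAt : ∀ v, 0 < v → μ {a | v ≤ A a} ≤ ENNReal.ofReal (s * Real.exp (-(ρ * v))))
    (hBt : ∀ v, 0 < v → ν {b | v ≤ B b} ≤ ENNReal.ofReal (s * Real.exp (-(ρ * v))))
    {x : ℝ} (hx : 0 ≤ x) :
    (μ.prod ν) {p | x ≤ A p.1 + B p.2}
      ≤ ENNReal.ofReal (s ^ 2 * Real.exp (-(ρ * x)) * (1 + ρ * x)) := by
  have hlog := Real.log_nonneg hs
  set c := Real.log s / ρ with hc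
  have hc0 : 0 ≤ c := by positivity
  have hρc : ρ * c = Real.log s := by rw [hc]; field_simp
  have hsexp : s = Real.exp (Real.log s) := (Real.exp_log (by linarith)).symm
  -- Both variables are shifted by `c`. If the level does not exceed the total shift, the claimed
  -- bound is at least `1`.
  rcases le_or_gt (x - 2 * c) 0 with hlt | hge
  · refine prob_le_one.trans ?_
    rw [← ENNReal.ofReal_one]
    refine ENNReal.ofReal_le_ofReal ?_
    have h1 : (1 : ℝ) ≤ s ^ 2 * Real.exp (-(ρ * x)) := by
      rw [hsexp, ← Real.exp_nat_mul, ← Real.exp_add]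
      refine Real.one_le_exp ?_
      push_cast
      nlinarith
    have : 0 ≤ ρ * x := by positivity
    nlinarith
  have h := measure_prod_le_of_exp_tail (μ := μ) (ν := ν) (A := fun a => max (A a - c) 0)
    (B := fun b => max (B b - c) 0) (by fun_prop) (by fun_prop) (fun a => le_max_right _ _)
    zero_le_one le_rfl hρ 
    (exp_tail_shift hs hρ hAt) (exp_tail_shift hs hρ hBt) hge
  refine (measure_mono fun p hp => ?_).trans (h.trans (ENNReal.ofReal_le_ofReal ?_))
  · simp only [Set.mem_ofPred_eq] at hp ⊢
    have h1 := le_max_left (A p.1 - c) 0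
    have h2 := le_max_left (B p.2 - c) 0
    linarith
  · have he : Real.exp (-(ρ * (x - 2 * c))) = s ^ 2 * Real.exp (-(ρ * x)) := by
      nth_rewrite 1 [hsexp]
      rw [← Real.exp_nat_mul, ← Real.exp_add, mul_sub]
      congr 1
      push_cast
      linear_combination 2 * hρc
    rw [he]
    have h0 : 0 ≤ ρ * c := by positivity
    have : 0 ≤ s ^ 2 * Real.exp (-(ρ * x)) := by positivity
    nlinarith

end Convolution

/-! ### The boundary `3 log (1 + log n)` -/

/-- `log (1 + log n)`. -/
noncomputable def iterLog (n : ℕ) : ℝ := Real.log (1 + Real.log n)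

theorem iterLog_nonneg (n : ℕ) : 0 ≤ iterLog n :=
  Real.log_nonneg (by linarith [Real.log_natCast_nonneg n])

@[simp] theorem iterLog_one : iterLog 1 = 0 := by simp [iterLog]

theorem iterLog_mono {m n : ℕ} (hm : 1 ≤ m) (h : m ≤ n) : iterLog m ≤ iterLog n := by
  have h1 : Real.log m ≤ Real.log n :=
    Real.log_le_log (by exact_mod_cast hm) (by exact_mod_cast h)
  exact Real.log_le_log (by linarith [Real.log_natCast_nonneg m]) (by linarith)

theorem iterLog_le_add {m n : ℕ} (hm : 1 ≤ m) (h : m ≤ n) :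
    iterLog n ≤ iterLog m + Real.log (n / m) / (1 + Real.log m) := by
  have hm' : (0 : ℝ) < m := by exact_mod_cast hm
  have hn' : (0 : ℝ) < n := by exact_mod_cast hm.trans h
  have h0 : 0 < 1 + Real.log m := by linarith [Real.log_natCast_nonneg m]
  have h1 : 0 < 1 + Real.log n := by linarith [Real.log_natCast_nonneg n]
  have h2 := Real.log_le_sub_one_of_pos (div_pos h1 h0)
  rw [Real.log_div h1.ne' h0.ne'] at h2
  rw [Real.log_div hn'.ne' hm'.ne']
  have : (1 + Real.log n) / (1 + Real.log m) - 1
      = (Real.log n - Real.log m) / (1 + Real.log m) := by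
    field_simp
    ring
  unfold iterLog
  linarith

/-- With a rational `c` slightly above `e`, a comparison of two integer powers certifies a rational
lower bound of a logarithm. -/
theorem div_le_log_of_pow_le {p q : ℕ} {x c : ℝ} (hq : 0 < q) (hx : 0 < x)
    (hc : Real.exp 1 < c) (h : c ^ p ≤ x ^ q) : (p / q : ℝ) ≤ Real.log x := by
  have hq' : (0 : ℝ) < q := by exact_mod_cast hq
  rw [div_le_iff₀ hq', mul_comm, ← Real.log_pow, Real.le_log_iff_exp_le (by positivity)]
  refine le_trans ?_ h
  rw [← mul_one (p : ℝ), Real.exp_nat_mul]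
  exact pow_le_pow_left₀ (Real.exp_nonneg _) hc.le _

theorem log_le_div_of_pow_le {p q : ℕ} {x c : ℝ} (hq : 0 < q) (hx : 0 < x) (hc0 : 0 ≤ c)
    (hc : c < Real.exp 1) (h : x ^ q ≤ c ^ p) : Real.log x ≤ (p / q : ℝ) := by
  have hq' : (0 : ℝ) < q := by exact_mod_cast hq
  rw [le_div_iff₀ hq', mul_comm, ← Real.log_pow, Real.log_le_iff_le_exp (by positivity)]
  refine h.trans ?_
  rw [← mul_one (p : ℝ), Real.exp_nat_mul]
  exact pow_le_pow_left₀ hc0 hc.le _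

theorem le_log_2 : (9 / 13 : ℝ) ≤ Real.log 2 :=
  mod_cast div_le_log_of_pow_le (p := 9) (q := 13) (by norm_num) (by norm_num)
    Real.exp_one_lt_d9 (by norm_num)

theorem le_log_3 : (56 / 51 : ℝ) ≤ Real.log 3 :=
  mod_cast div_le_log_of_pow_le (p := 56) (q := 51) (by norm_num) (by norm_num)
    Real.exp_one_lt_d9 (by norm_num)

theorem le_log_4 : (79 / 57 : ℝ) ≤ Real.log 4 :=
  mod_cast div_le_log_of_pow_le (p := 79) (q := 57) (by norm_num) (by norm_num)
    Real.exp_one_lt_d9 (by norm_num)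

theorem le_log_5 : (37 / 23 : ℝ) ≤ Real.log 5 :=
  mod_cast div_le_log_of_pow_le (p := 37) (q := 23) (by norm_num) (by norm_num)
    Real.exp_one_lt_d9 (by norm_num)

theorem le_log_7 : (107 / 55 : ℝ) ≤ Real.log 7 :=
  mod_cast div_le_log_of_pow_le (p := 107) (q := 55) (by norm_num) (by norm_num)
    Real.exp_one_lt_d9 (by norm_num)

theorem le_log_9 : (123 / 56 : ℝ) ≤ Real.log 9 :=
  mod_cast div_le_log_of_pow_le (p := 123) (q := 56) (by norm_num) (by norm_num)
    Real.exp_one_lt_d9 (by norm_num)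

theorem le_log_12 : (82 / 33 : ℝ) ≤ Real.log 12 :=
  mod_cast div_le_log_of_pow_le (p := 82) (q := 33) (by norm_num) (by norm_num)
    Real.exp_one_lt_d9 (by norm_num)

theorem le_log_15 : (111 / 41 : ℝ) ≤ Real.log 15 :=
  mod_cast div_le_log_of_pow_le (p := 111) (q := 41) (by norm_num) (by norm_num)
    Real.exp_one_lt_d9 (by norm_num)

theorem le_log_18 : (26 / 9 : ℝ) ≤ Real.log 18 :=
  mod_cast div_le_log_of_pow_le (p := 26) (q := 9) (by norm_num) (by norm_num)
    Real.exp_one_lt_d9 (by norm_num)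

theorem le_log_23 : (116 / 37 : ℝ) ≤ Real.log 23 :=
  mod_cast div_le_log_of_pow_le (p := 116) (q := 37) (by norm_num) (by norm_num)
    Real.exp_one_lt_d9 (by norm_num)

/-- The increment of `iterLog` at `k` is at most `1 / (k * (1 + log k))`, so it suffices that `(1 +
log k) * iterLog k ≥ 1`. This holds from `k = 3` on; `k = 2` is checked numerically. -/
theorem iterLog_div_le_succ {k : ℕ} (hk : 2 ≤ k) :
    iterLog (k + 1) / (k + 1 : ℕ) ≤ iterLog k / k := by
  have hk0 : (0 : ℝ) < k := by positivity
  rw [div_le_div_iff₀ (by positivity) hk0]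
  obtain rfl | hk3 : k = 2 ∨ 2 < k := by omega
  · have h2 : (1 / 2 : ℝ) ≤ iterLog 2 := by
      refine le_trans ?_ (Real.log_le_log (x := 22 / 13) (by norm_num) ?_)
      · have := div_le_log_of_pow_le (p := 1) (q := 2) (x := 22 / 13) (by norm_num)
          (by norm_num) Real.exp_one_lt_d9 (by norm_num)
        norm_num at this ⊢
        linarith
      · have := le_log_2
        norm_num
        linarith
    have h3 : iterLog 3 ≤ 3 / 4 := by
      have h3' : Real.log 3 ≤ 11 / 10 := by
        have := log_le_div_of_pow_le (p := 11) (q := 10) (x := 3) (by norm_num)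
          (by norm_num) (by norm_num) Real.exp_one_gt_d9 (by norm_num)
        exact_mod_cast this
      refine (Real.log_le_log (y := 21 / 10) ?_ ?_).trans ?_
      · norm_num; linarith [le_log_3]
      · norm_num; linarith
      · have := log_le_div_of_pow_le (p := 3) (q := 4) (x := 21 / 10) (by norm_num)
          (by norm_num) (by norm_num) Real.exp_one_gt_d9 (by norm_num)
        exact_mod_cast this
    norm_num at h2 h3 ⊢
    linarith
  · have hk3' : (3 : ℕ) ≤ k := hk3
    have hlog3 : (56 / 51 : ℝ) ≤ Real.log k :=
      le_log_3.trans (Real.log_le_log (by norm_num) (by exact_mod_cast hk3))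
    have hit : (7 / 10 : ℝ) ≤ iterLog k := by
      refine le_trans ?_ (Real.log_le_log (x := 2 + 5 / 51) (by norm_num) (by linarith))
      have := div_le_log_of_pow_le (p := 7) (q := 10) (x := 2 + 5 / 51) (by norm_num)
          (by norm_num) Real.exp_one_lt_d9 (by norm_num)
      exact_mod_cast this
    have h := iterLog_le_add (m := k) (n := k + 1) (by omega) (by omega)
    have hlog : Real.log ((k + 1 : ℕ) / k) ≤ 1 / k := by
      refine (Real.log_le_sub_one_of_pos (by positivity)).trans_eq ?_
      push_cast
      field_simp
      ring
    have h1 : Real.log ((k + 1 : ℕ) / k) / (1 + Real.log k) ≤ iterLog k / k := by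
      rw [div_le_div_iff₀ (by linarith) hk0]
      have : Real.log ((k + 1 : ℕ) / k) * k ≤ 1 := by
        calc _ ≤ 1 / (k : ℝ) * k := by gcongr
          _ = 1 := by field_simp
      nlinarith
    have h2 : iterLog (k + 1) ≤ iterLog k + iterLog k / k := by linarith
    push_cast
    calc iterLog (k + 1) * k ≤ (iterLog k + iterLog k / k) * k := by gcongr
      _ = iterLog k * (k + 1) := by field_simp

theorem iterLog_div_anti {m n : ℕ} (hm : 2 ≤ m) (h : m ≤ n) :
    iterLog n / n ≤ iterLog m / m := by
  induction n, h using Nat.le_induction with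
  | base => exact le_rfl
  | succ k hk ih => exact (iterLog_div_le_succ (hm.trans hk)).trans ih

/-! ### Weights for the lines -/

/-- Weights of the lines that control the first few sample sizes. -/
noncomputable def headWeight (N : ℕ) : ℝ :=
  if N = 2 then 267/2500 else
  if N = 3 then 483/10000 else
  if N = 4 then 63/2000 else
  if N = 5 then 201/10000 else
  if N = 7 then 189/5000 else
  if N = 9 then 231/10000 else
  if N = 12 then 7/250 else
  if N = 15 then 12/625 else
  if N = 18 then 29/2500 else
  if N = 23 then 299/10000 else
  0

/-- The contribution at sample size `n` of the line through `(N, 3 * iterLog N + v)`. -/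
noncomputable def lineTerm (n : ℕ) (v : ℝ) (N : ℕ) : ℝ :=
  Real.exp (-(3 / 4 * v)) * Real.exp (n * ((3 * iterLog N + v) / N))

/-- The term increases with `n`, so a block of sample sizes is represented by its least element
`n₀`. The factor free of `v` is bounded below by a rational `q`, the other one by `1 + y ≤ exp y`,
so that the result is affine in `v`. -/
theorem lineTerm_ge {n₀ n N : ℕ} {q r v : ℝ} (hn : n₀ ≤ n) (hN : 0 < N) (hr : r ≤ Real.log N)
    (hr0 : 0 ≤ r) (hq : 0 < q) (hle : q ^ N ≤ (1 + r) ^ (3 * n₀)) (hv : 0 ≤ v) :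
    q * (1 + ((n₀ : ℝ) / N - 3 / 4) * v) ≤ lineTerm n v N := by
  have hN' : (0 : ℝ) < N := by exact_mod_cast hN
  have hq' : q ≤ Real.exp (3 * n₀ * iterLog N / N) := by
    rw [← Real.log_le_iff_le_exp hq, le_div_iff₀ hN', mul_comm, ← Real.log_pow]
    refine (Real.log_le_log (by positivity) hle).trans ?_
    rw [Real.log_pow]
    push_cast
    refine mul_le_mul_of_nonneg_left (Real.log_le_log (by linarith) (by linarith)) (by positivity)
  calc q * (1 + ((n₀ : ℝ) / N - 3 / 4) * v)
      ≤ Real.exp (3 * n₀ * iterLog N / N) * Real.exp (((n₀ : ℝ) / N - 3 / 4) * v) := by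
        refine (mul_le_mul_of_nonneg_left ?_ hq.le).trans
          (mul_le_mul_of_nonneg_right hq' (Real.exp_nonneg _))
        linarith [Real.add_one_le_exp (((n₀ : ℝ) / N - 3 / 4) * v)]
    _ = lineTerm n₀ v N := by
        rw [lineTerm, ← Real.exp_add, ← Real.exp_add]
        congr 1
        field_simp
        ring
    _ ≤ lineTerm n v N := by
        unfold lineTerm
        have := iterLog_nonneg N
        gcongr

/-- In each block the weighted sum of the affine bounds has constant term at least `1` and a
nonnegative coefficient of `v`: lines with `N` close to `n` compensate those with `n / N < 3/4`,
whose terms decrease in `v`. -/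
theorem exists_head_lines {n : ℕ} (hn : 2 ≤ n) (hn' : n ≤ 23) {v : ℝ} (hv : 0 ≤ v) :
    ∃ J ⊆ Finset.Ico 2 24, (∀ N ∈ J, n ≤ N) ∧ 1 ≤ ∑ N ∈ J, headWeight N * lineTerm n v N := by
  have hcases : n = 2 ∨ n = 3 ∨ n = 4 ∨ n = 5 ∨ (6 ≤ n ∧ n ≤ 7) ∨ (8 ≤ n ∧ n ≤ 9) ∨
      (10 ≤ n ∧ n ≤ 12) ∨ (13 ≤ n ∧ n ≤ 15) ∨ (16 ≤ n ∧ n ≤ 18) ∨ (19 ≤ n ∧ n ≤ 23) := by omega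
  rcases hcases with h | h | h | h | h | h | h | h | h | h
  · refine ⟨{2, 3, 4, 5, 7}, by decide, by simp; omega, ?_⟩
    have h2 := lineTerm_ge (n₀ := 2) (n := n) (N := 2) (q := 2423/500) (by omega) (by norm_num)
      le_log_2 (by norm_num) (by norm_num) (by norm_num) hv
    have h3 := lineTerm_ge (n₀ := 2) (n := n) (N := 3) (q := 4401/1000) (by omega) (by norm_num)
      le_log_3 (by norm_num) (by norm_num) (by norm_num) hv
    have h4 := lineTerm_ge (n₀ := 2) (n := n) (N := 4) (q := 737/200) (by omega) (by norm_num)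
      le_log_4 (by norm_num) (by norm_num) (by norm_num) hv
    have h5 := lineTerm_ge (n₀ := 2) (n := n) (N := 5) (q := 79/25) (by omega) (by norm_num)
      le_log_5 (by norm_num) (by norm_num) (by norm_num) hv
    have h7 := lineTerm_ge (n₀ := 2) (n := n) (N := 7) (q := 1197/500) (by omega) (by norm_num)
      le_log_7 (by norm_num) (by norm_num) (by norm_num) hv
    norm_num [headWeight] at *
    linarith
  · refine ⟨{3, 4, 5, 7, 9}, by decide, by simp; omega, ?_⟩
    have h3 := lineTerm_ge (n₀ := 3) (n := n) (N := 3) (q := 1847/200) (by omega) (by norm_num)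
      le_log_3 (by norm_num) (by norm_num) (by norm_num) hv
    have h4 := lineTerm_ge (n₀ := 3) (n := n) (N := 4) (q := 283/40) (by omega) (by norm_num)
      le_log_4 (by norm_num) (by norm_num) (by norm_num) hv
    have h5 := lineTerm_ge (n₀ := 3) (n := n) (N := 5) (q := 5617/1000) (by omega) (by norm_num)
      le_log_5 (by norm_num) (by norm_num) (by norm_num) hv
    have h7 := lineTerm_ge (n₀ := 3) (n := n) (N := 7) (q := 401/100) (by omega) (by norm_num)
      le_log_7 (by norm_num) (by norm_num) (by norm_num) hv
    have h9 := lineTerm_ge (n₀ := 3) (n := n) (N := 9) (q := 1443/500) (by omega) (by norm_num)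
      le_log_9 (by norm_num) (by norm_num) (by norm_num) hv
    norm_num [headWeight] at *
    linarith
  · refine ⟨{4, 5, 7, 9, 12}, by decide, by simp; omega, ?_⟩
    have h4 := lineTerm_ge (n₀ := 4) (n := n) (N := 4) (q := 6791/500) (by omega) (by norm_num)
      le_log_4 (by norm_num) (by norm_num) (by norm_num) hv
    have h5 := lineTerm_ge (n₀ := 4) (n := n) (N := 5) (q := 4993/500) (by omega) (by norm_num)
      le_log_5 (by norm_num) (by norm_num) (by norm_num) hv
    have h7 := lineTerm_ge (n₀ := 4) (n := n) (N := 7) (q := 6371/1000) (by omega) (by norm_num)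
      le_log_7 (by norm_num) (by norm_num) (by norm_num) hv
    have h9 := lineTerm_ge (n₀ := 4) (n := n) (N := 9) (q := 1177/250) (by omega) (by norm_num)
      le_log_9 (by norm_num) (by norm_num) (by norm_num) hv
    have h12 := lineTerm_ge (n₀ := 4) (n := n) (N := 12) (q := 98/125) (by omega) (by norm_num)
      le_log_12 (by norm_num) (by norm_num) (by norm_num) hv
    norm_num [headWeight] at *
    linarith
  · refine ⟨{5, 7, 9, 12}, by decide, by simp; omega, ?_⟩
    have h5 := lineTerm_ge (n₀ := 5) (n := n) (N := 5) (q := 2219/125) (by omega) (by norm_num)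
      le_log_5 (by norm_num) (by norm_num) (by norm_num) hv
    have h7 := lineTerm_ge (n₀ := 5) (n := n) (N := 7) (q := 10123/1000) (by omega) (by norm_num)
      le_log_7 (by norm_num) (by norm_num) (by norm_num) hv
    have h9 := lineTerm_ge (n₀ := 5) (n := n) (N := 9) (q := 1387/200) (by omega) (by norm_num)
      le_log_9 (by norm_num) (by norm_num) (by norm_num) hv
    have h12 := lineTerm_ge (n₀ := 5) (n := n) (N := 12) (q := 3591/1000) (by omega) (by norm_num)
      le_log_12 (by norm_num) (by norm_num) (by norm_num) hv
    norm_num [headWeight] at *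
    linarith
  · refine ⟨{7, 9, 12}, by decide, by simp; omega, ?_⟩
    have h7 := lineTerm_ge (n₀ := 6) (n := n) (N := 7) (q := 16083/1000) (by omega) (by norm_num)
      le_log_7 (by norm_num) (by norm_num) (by norm_num) hv
    have h9 := lineTerm_ge (n₀ := 6) (n := n) (N := 9) (q := 10217/1000) (by omega) (by norm_num)
      le_log_9 (by norm_num) (by norm_num) (by norm_num) hv
    have h12 := lineTerm_ge (n₀ := 6) (n := n) (N := 12) (q := 223/40) (by omega) (by norm_num)
      le_log_12 (by norm_num) (by norm_num) (by norm_num) hv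
    norm_num [headWeight] at *
    linarith
  · refine ⟨{9, 12, 15}, by decide, by simp; omega, ?_⟩
    have h9 := lineTerm_ge (n₀ := 8) (n := n) (N := 9) (q := 2217/100) (by omega) (by norm_num)
      le_log_9 (by norm_num) (by norm_num) (by norm_num) hv
    have h12 := lineTerm_ge (n₀ := 8) (n := n) (N := 12) (q := 1518/125) (by omega) (by norm_num)
      le_log_12 (by norm_num) (by norm_num) (by norm_num) hv
    have h15 := lineTerm_ge (n₀ := 8) (n := n) (N := 15) (q := 7707/1000) (by omega) (by norm_num)
      le_log_15 (by norm_num) (by norm_num) (by norm_num) hv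
    norm_num [headWeight] at *
    linarith
  · refine ⟨{12, 15, 18}, by decide, by simp; omega, ?_⟩
    have h12 := lineTerm_ge (n₀ := 10) (n := n) (N := 12) (q := 2267/100) (by omega) (by norm_num)
      le_log_12 (by norm_num) (by norm_num) (by norm_num) hv
    have h15 := lineTerm_ge (n₀ := 10) (n := n) (N := 15) (q := 1718/125) (by omega) (by norm_num)
      le_log_15 (by norm_num) (by norm_num) (by norm_num) hv
    have h18 := lineTerm_ge (n₀ := 10) (n := n) (N := 18) (q := 8747/1000) (by omega) (by norm_num)
      le_log_18 (by norm_num) (by norm_num) (by norm_num) hv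
    norm_num [headWeight] at *
    linarith
  · refine ⟨{15, 18, 23}, by decide, by simp; omega, ?_⟩
    have h15 := lineTerm_ge (n₀ := 13) (n := n) (N := 15) (q := 3771/125) (by omega) (by norm_num)
      le_log_15 (by norm_num) (by norm_num) (by norm_num) hv
    have h18 := lineTerm_ge (n₀ := 13) (n := n) (N := 18) (q := 3793/200) (by omega) (by norm_num)
      le_log_18 (by norm_num) (by norm_num) (by norm_num) hv
    have h23 := lineTerm_ge (n₀ := 13) (n := n) (N := 23) (q := 168/25) (by omega) (by norm_num)
      le_log_23 (by norm_num) (by norm_num) (by norm_num) hv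
    norm_num [headWeight] at *
    linarith
  · refine ⟨{18, 23}, by decide, by simp; omega, ?_⟩
    have h18 := lineTerm_ge (n₀ := 16) (n := n) (N := 18) (q := 37399/1000) (by omega) (by norm_num)
      le_log_18 (by norm_num) (by norm_num) (by norm_num) hv
    have h23 := lineTerm_ge (n₀ := 16) (n := n) (N := 23) (q := 3789/200) (by omega) (by norm_num)
      le_log_23 (by norm_num) (by norm_num) (by norm_num) hv
    norm_num [headWeight] at *
    linarith
  · refine ⟨{23}, by decide, by simp; omega, ?_⟩
    have h23 := lineTerm_ge (n₀ := 19) (n := n) (N := 23) (q := 16727/500) (by omega) (by norm_num)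
      le_log_23 (by norm_num) (by norm_num) (by norm_num) hv
    norm_num [headWeight] at *
    linarith

theorem iterLog_pos {n : ℕ} (hn : 2 ≤ n) : 0 < iterLog n := by
  refine Real.log_pos ?_
  have : 0 < Real.log n := Real.log_pos (by exact_mod_cast hn)
  linarith

theorem sum_Ico_le_sub {f g : ℕ → ℝ} {m n : ℕ} (hmn : m ≤ n)
    (h : ∀ k, m ≤ k → k < n → f k ≤ g (k + 1) - g k) :
    ∑ k ∈ Finset.Ico m n, f k ≤ g n - g m := by
  rw [← Finset.sum_Ico_sub g hmn]
  exact Finset.sum_le_sum fun k hk => h k (Finset.mem_Ico.1 hk).1 (Finset.mem_Ico.1 hk).2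

/-- The midpoint rule for the convex function `1/x` on an interval of length one centred at `N`;
`1/N` is the first term of a positive series for the right-hand side. -/
theorem inv_le_log_sub_log {N : ℕ} (hN : 1 ≤ N) :
    1 / (N : ℝ) ≤ Real.log ((N + 1 : ℕ) - 1 / 2) - Real.log (N - 1 / 2) := by
  have hN' : (1 : ℝ) ≤ N := by exact_mod_cast hN
  have ha : (0 : ℝ) < N - 1 / 2 := by linarith
  have h := Real.hasSum_log_one_add_inv ha
  have h0 := h.summable.sum_le_tsum {0} (fun i _ => by positivity)
  rw [h.tsum_eq] at h0
  rw [← Real.log_div (by push_cast; linarith) ha.ne']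
  have e : ((N + 1 : ℕ) - 1 / 2 : ℝ) / (N - 1 / 2) = 1 + (N - 1 / 2 : ℝ)⁻¹ := by
    rw [div_eq_iff ha.ne', add_mul, inv_mul_cancel₀ ha.ne']
    push_cast
    ring
  rw [e]
  refine le_trans (le_of_eq ?_) h0
  simp
  field_simp
  ring

/-- Weights of the lines through large sample sizes. -/
noncomputable def tailWeight (N : ℕ) : ℝ :=
  17 / 10 * (Real.exp (-(5 / 4 * iterLog (N - 1))) - Real.exp (-(5 / 4 * iterLog N)))

/-- The weights are increments of a power of `1 + log N`, so their sums telescope. Differentiating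
`(1 + log N) ^ (-5/4)` gives the lower bound, with `17/10 * 5/4 = 17/8`. The exponent `9/4 = 3 *
3/4` is the one that cancels the boundary in `lineTerm` when `n / N = 3/4`. -/
theorem tailWeight_ge {N : ℕ} (hN : 2 ≤ N) :
    17 / 8 * (1 / N) * Real.exp (-(9 / 4 * iterLog N)) ≤ tailWeight N := by
  obtain ⟨k, rfl⟩ : ∃ k, N = k + 1 := ⟨N - 1, by omega⟩
  have hk : 1 ≤ k := by omega
  have hk' : (1 : ℝ) ≤ k := by exact_mod_cast hk
  have ht : 0 < 1 + Real.log (k + 1 : ℕ) := by linarith [Real.log_natCast_nonneg (k + 1)]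
  have hs : 0 < 1 + Real.log k := by linarith [Real.log_natCast_nonneg k]
  have hinv : Real.exp (-iterLog (k + 1)) = 1 / (1 + Real.log (k + 1 : ℕ)) := by
    rw [Real.exp_neg, iterLog, Real.exp_log ht, one_div]
  have hdiff : 1 / ((k + 1 : ℕ) : ℝ) ≤ Real.log (k + 1 : ℕ) - Real.log k := by
    have := Real.one_sub_inv_le_log_of_pos (x := (k + 1 : ℕ) / (k : ℝ)) (by positivity)
    rw [Real.log_div (by positivity) (by positivity)] at this
    refine le_trans (le_of_eq ?_) this
    push_cast
    field_simp
    ring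
  have hlog : 1 / ((k + 1 : ℕ) : ℝ) * Real.exp (-iterLog (k + 1))
      ≤ iterLog (k + 1) - iterLog k := by
    have := Real.one_sub_inv_le_log_of_pos (x := (1 + Real.log (k + 1 : ℕ)) / (1 + Real.log k))
      (by positivity)
    rw [Real.log_div ht.ne' hs.ne'] at this
    refine le_trans ?_ this
    rw [hinv]
    have e : 1 - ((1 + Real.log (k + 1 : ℕ)) / (1 + Real.log k))⁻¹
        = (Real.log (k + 1 : ℕ) - Real.log k) * (1 / (1 + Real.log (k + 1 : ℕ))) := by
      field_simp
      ring
    rw [e]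
    gcongr
  have hexp := Real.add_one_le_exp (5 / 4 * (iterLog (k + 1) - iterLog k))
  have e1 : Real.exp (-(5 / 4 * iterLog k)) = Real.exp (-(5 / 4 * iterLog (k + 1))) *
      Real.exp (5 / 4 * (iterLog (k + 1) - iterLog k)) := by
    rw [← Real.exp_add]
    ring_nf
  have e2 : Real.exp (-(9 / 4 * iterLog (k + 1))) = Real.exp (-(5 / 4 * iterLog (k + 1))) *
      Real.exp (-iterLog (k + 1)) := by
    rw [← Real.exp_add]
    ring_nf
  rw [tailWeight, Nat.add_sub_cancel, e1, e2]
  have hp := Real.exp_pos (-(5 / 4 * iterLog (k + 1)))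
  set E := Real.exp (-(5 / 4 * iterLog (k + 1)))
  have : E * (1 / ((k + 1 : ℕ) : ℝ) * Real.exp (-iterLog (k + 1)) * (5 / 4)) ≤
      E * (Real.exp (5 / 4 * (iterLog (k + 1) - iterLog k)) - 1) :=
    mul_le_mul_of_nonneg_left (by linarith) hp.le
  linarith

theorem log_twentyfour_ge : (143 / 45 : ℝ) ≤ Real.log 24 := mod_cast
  div_le_log_of_pow_le (p := 143) (q := 45) (by norm_num) (by norm_num)
    Real.exp_one_lt_d9 (by norm_num)

theorem log_three_halves_le : Real.log (3 / 2) ≤ 43 / 106 := mod_cast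
  log_le_div_of_pow_le (p := 43) (q := 106) (x := 3 / 2) (by norm_num) (by norm_num) (by norm_num)
    Real.exp_one_gt_d9 (by norm_num)

/-- After the cancellation, the exponential is linearized. Replacing `iterLog N` by `iterLog n`
loses only when `n / N < 3/4`, and then at most `3 * (3/4 - 2/3) * 49/500 = 49/2000`, whence
`1951/2000`. -/
theorem tailTerm_ge {n N : ℕ} (hn : 24 ≤ n) (hnN : n ≤ N) (hN : 2 * N ≤ 3 * n) (v : ℝ) :
    17 / 8 * (1 / N) * (1951 / 2000 + ((n : ℝ) / N - 3 / 4) * (3 * iterLog n + v))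
      ≤ tailWeight N * lineTerm n v N := by
  have hN0 : (0 : ℝ) < N := by have : 0 < N := by omega
                               exact_mod_cast this
  have hn0 : (0 : ℝ) < n := by have : 0 < n := by omega
                               exact_mod_cast this
  have hlt : 0 ≤ lineTerm n v N := by unfold lineTerm; positivity
  refine le_trans ?_ (mul_le_mul_of_nonneg_right (tailWeight_ge (by omega)) hlt)
  have e : 17 / 8 * (1 / (N : ℝ)) * Real.exp (-(9 / 4 * iterLog N)) * lineTerm n v N
      = 17 / 8 * (1 / N) * Real.exp (((n : ℝ) / N - 3 / 4) * (3 * iterLog N + v)) := by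
    rw [lineTerm, mul_assoc, ← Real.exp_add, ← Real.exp_add]
    congr 2
    field_simp
    ring
  rw [e]
  refine mul_le_mul_of_nonneg_left ?_ (by positivity)
  refine le_trans ?_ (Real.add_one_le_exp _)
  have hmono := iterLog_mono (by omega) hnN
  rcases le_total (3 / 4) ((n : ℝ) / N) with h | h
  · nlinarith
  · have hr : (2 / 3 : ℝ) ≤ n / N := by
      rw [div_le_div_iff₀ (by norm_num) hN0]
      exact_mod_cast (by omega : 2 * N ≤ n * 3)
    have hadd := iterLog_le_add (m := n) (by omega) hnN
    have hlogn : (143 / 45 : ℝ) ≤ Real.log n :=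
      log_twentyfour_ge.trans (Real.log_le_log (by norm_num) (by exact_mod_cast hn))
    have hlog : Real.log (N / n) ≤ 43 / 106 := by
      refine (Real.log_le_log (by positivity) ?_).trans log_three_halves_le
      rw [div_le_div_iff₀ hn0 (by norm_num)]
      exact_mod_cast (by omega : N * 2 ≤ 3 * n)
    have hq : Real.log (N / n) / (1 + Real.log n) ≤ 49 / 500 := by
      rw [div_le_iff₀ (by linarith)]
      linarith
    nlinarith

/-- Over `n ≤ N < 3n/2` the sums of `1/N` and `n/N²` approximate `log (3/2)` and `1/3`. The
coefficient of the boundary value is positive because `1/3 > 3/4 * log (3/2)`. -/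
theorem exists_tail_lines {n : ℕ} (hn : 24 ≤ n) {v : ℝ} (hv : 0 ≤ v) :
    1 ≤ ∑ N ∈ Finset.Ico n ((3 * n - 1) / 2 + 1), tailWeight N * lineTerm n v N := by
  have hn' : (24 : ℝ) ≤ n := by exact_mod_cast hn
  set M := (3 * n - 1) / 2 + 1 with hM
  have hM1 : 2 * M ≤ 3 * n + 1 := by omega
  have hM2 : 3 * n ≤ 2 * M := by omega
  have hnM : n ≤ M := by omega
  have hM1' : 2 * (M : ℝ) ≤ 3 * n + 1 := by exact_mod_cast hM1
  have hM2' : 3 * (n : ℝ) ≤ 2 * M := by exact_mod_cast hM2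
  refine le_trans ?_ (Finset.sum_le_sum fun N hN => tailTerm_ge hn (Finset.mem_Ico.1 hN).1
    (by have := (Finset.mem_Ico.1 hN).2; omega) v)
  -- An upper bound is the useful one: the factor `1951/2000 - 3/4 * B` of this sum is negative
  -- since `B ≥ 30/7`.
  have hH : ∑ N ∈ Finset.Ico n M, 1 / (N : ℝ) ≤ 427 / 1000 := by
    refine (sum_Ico_le_sub (g := fun k => Real.log (k - 1 / 2)) hnM
      fun k hk _ => inv_le_log_sub_log (by omega)).trans ?_
    have h1 : Real.log (M - 1 / 2) ≤ Real.log (3 / 2) + Real.log n := by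
      rw [← Real.log_mul (by norm_num) (by linarith)]
      exact Real.log_le_log (by linarith) (by linarith)
    have h2 : Real.log n - Real.log (n - 1 / 2) ≤ 1 / 47 := by
      rw [← Real.log_div (by linarith) (by linarith)]
      have hpos : (0 : ℝ) < n - 1 / 2 := by linarith
      refine (Real.log_le_sub_one_of_pos (by positivity)).trans ?_
      rw [sub_le_iff_le_add, div_le_iff₀ hpos]
      linarith
    have := log_three_halves_le
    norm_num at *
    linarith
  have hA : 1 / (3 * n : ℝ) ≤ ∑ N ∈ Finset.Ico n M, 1 / (N : ℝ) ^ 2 := by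
    have := sum_Ico_le_sub (f := fun k => -(1 / (k : ℝ) ^ 2)) (g := fun k => 1 / (k : ℝ)) hnM
      fun k hk _ => ?_
    · rw [Finset.sum_neg_distrib] at this
      have hle : 1 / (M : ℝ) ≤ 2 / (3 * n) := by
        rw [div_le_div_iff₀ (by linarith) (by linarith)]
        linarith
      have : 1 / (n : ℝ) - 2 / (3 * n) = 1 / (3 * n) := by field_simp; norm_num
      linarith
    · have hk' : (24 : ℝ) ≤ k := by exact_mod_cast hn.trans hk
      have hk0 : (0 : ℝ) < k := by linarith
      rw [neg_le_sub_iff_le_add, ← sub_le_iff_le_add']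
      push_cast
      rw [div_sub_div _ _ (by positivity) (by positivity), div_le_div_iff₀ (by positivity)
        (by positivity)]
      ring_nf
      nlinarith
  have hiter : (10 / 7 : ℝ) ≤ iterLog n := by
    have hlogn : (143 / 45 : ℝ) ≤ Real.log n :=
      log_twentyfour_ge.trans (Real.log_le_log (by norm_num) (by exact_mod_cast hn))
    refine le_trans ?_ (Real.log_le_log (x := 188 / 45) (by norm_num) (by linarith))
    exact mod_cast div_le_log_of_pow_le (p := 10) (q := 7) (x := 188 / 45) (by norm_num)
      (by norm_num) Real.exp_one_lt_d9 (by norm_num)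
  set B := 3 * iterLog n + v with hB
  have hsum : ∑ N ∈ Finset.Ico n M, 17 / 8 * (1 / (N : ℝ)) *
      (1951 / 2000 + ((n : ℝ) / N - 3 / 4) * B)
      = 17 / 8 * ((1951 / 2000 - 3 / 4 * B) * ∑ N ∈ Finset.Ico n M, 1 / (N : ℝ)
        + B * (n * ∑ N ∈ Finset.Ico n M, 1 / (N : ℝ) ^ 2)) := by
    rw [Finset.mul_sum, Finset.mul_sum, Finset.mul_sum, ← Finset.sum_add_distrib, Finset.mul_sum]
    refine Finset.sum_congr rfl fun N hN => ?_
    have : (0 : ℝ) < N := by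
      have : 0 < N := by have := (Finset.mem_Ico.1 hN).1; omega
      exact_mod_cast this
    field_simp
    ring
  rw [hsum]
  have hA' : (1 / 3 : ℝ) ≤ n * ∑ N ∈ Finset.Ico n M, 1 / (N : ℝ) ^ 2 := by
    have := mul_le_mul_of_nonneg_left hA (by linarith : (0 : ℝ) ≤ n)
    refine le_trans (le_of_eq ?_) this
    field_simp
  have hBge : 30 / 7 ≤ B := by linarith
  set H := ∑ N ∈ Finset.Ico n M, 1 / (N : ℝ)
  have h1 := mul_le_mul_of_nonneg_left hA' (by linarith : 0 ≤ B)
  have h2 := mul_le_mul_of_nonneg_left hH (by linarith : 0 ≤ 3 / 4 * B - 1951 / 2000)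
  linarith

/-- Weights of the lines for all sample sizes. -/
noncomputable def lineWeight (N : ℕ) : ℝ := if N < 24 then headWeight N else tailWeight N

theorem headWeight_nonneg (N : ℕ) : 0 ≤ headWeight N := by
  unfold headWeight
  split_ifs <;> norm_num

theorem lineWeight_nonneg {N : ℕ} (hN : 2 ≤ N) : 0 ≤ lineWeight N := by
  unfold lineWeight
  split_ifs with h
  · exact headWeight_nonneg N
  · exact le_trans (by positivity) (tailWeight_ge hN)

/-- The head weights add up to `0.3563`; the tail weights telescope to at most `17/10 * exp (-(5/4 *
iterLog 23))`, less than `0.293`. -/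
theorem sum_lineWeight_le (T : ℕ) :
    ∑ N ∈ Finset.Ico 2 (2 * T + 24), lineWeight N ≤ 13 / 20 := by
  rw [← Finset.sum_Ico_consecutive lineWeight (by norm_num : 2 ≤ 24) (by omega)]
  have h1 : ∑ N ∈ Finset.Ico 2 24, lineWeight N = 3563 / 10000 := by
    norm_num [Finset.sum_Ico_succ_top, lineWeight, headWeight]
  have h2 : ∑ N ∈ Finset.Ico 24 (2 * T + 24), lineWeight N ≤ 17 / 10 * (172 / 1000) := by
    have := sum_Ico_le_sub (f := lineWeight)
      (g := fun N => -(17 / 10 * Real.exp (-(5 / 4 * iterLog (N - 1))))) (m := 24)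
      (n := 2 * T + 24) (by omega) (fun k hk _ => by
        rw [lineWeight, if_neg (by omega), tailWeight, Nat.add_sub_cancel]
        linarith)
    refine this.trans ?_
    have hpos := Real.exp_pos (-(5 / 4 * iterLog (2 * T + 24 - 1)))
    have h23 : Real.exp (-(5 / 4 * iterLog (24 - 1))) ≤ 172 / 1000 := by
      have hit : (17 / 12 : ℝ) ≤ iterLog 23 := by
        refine le_trans ?_ (Real.log_le_log (x := 153 / 37) (by norm_num) ?_)
        · exact mod_cast div_le_log_of_pow_le (p := 17) (q := 12) (x := 153 / 37) (by norm_num)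
            (by norm_num) Real.exp_one_lt_d9 (by norm_num)
        · have := le_log_23
          norm_num
          linarith
      have hlog : Real.log (1000 / 172) ≤ (85 / 48 : ℝ) := mod_cast
        log_le_div_of_pow_le (p := 85) (q := 48) (x := 1000 / 172) (by norm_num) (by norm_num)
          (by norm_num) Real.exp_one_gt_d9 (by norm_num)
      rw [← Real.le_log_iff_exp_le (by norm_num)]
      have : Real.log (1000 / 172) = - Real.log (172 / 1000) := by
        rw [← Real.log_inv]
        norm_num
      norm_num at *
      linarith
    linarith
  linarith

/-! ### Maximal inequalities with an iterated logarithm boundary -/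

namespace IsCumulantBound

variable {μ : Measure ℝ} {D : Finset ℝ} {ψ : ℝ → ℝ}

/-- A maximal inequality over all sample sizes `n ≥ 2`, with an iterated logarithm boundary. -/
theorem measure_exists_two_le (h : IsCumulantBound μ D ψ) [IsProbabilityMeasure μ] (T : ℕ)
    {v : ℝ} (hv : 0 ≤ v) :
    (Measure.pi fun _ : Fin T => μ) {u | ∃ n ≤ T, 2 ≤ n ∧ 3 * iterLog n + v ≤ h.stat n u}
      ≤ ENNReal.ofReal (13 / 20 * Real.exp (-(3 / 4 * v))) := by
  refine (h.measure_exists_le_stat_le T (Finset.Ico 2 (2 * T + 24))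
    (fun N => (3 * iterLog N + v) / N) (fun N => lineWeight N * Real.exp (-(3 / 4 * v)))
    (fun N hN => ?_) (fun N hN => ?_) {n | 2 ≤ n} (fun n => 3 * iterLog n + v)
    (fun n hn hnT => ⟨by have : 2 ≤ n := hn
                         omega, ?_⟩)).trans ?_
  · have hN2 := (Finset.mem_Ico.1 hN).1
    have hN0 : (0 : ℝ) < N := by have : 0 < N := by omega
                                 exact_mod_cast this
    have := iterLog_pos hN2
    positivity
  · exact mul_nonneg (lineWeight_nonneg (Finset.mem_Ico.1 hN).1) (Real.exp_nonneg _)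
  · have hn2 : 2 ≤ n := hn
    -- Since `iterLog n / n` decreases from `n = 2` on, the line from the origin to the boundary at
    -- `N` stays below the boundary at all `2 ≤ n ≤ N`.
    have hbelow : ∀ N, n ≤ N → n * ((3 * iterLog N + v) / N) ≤ 3 * iterLog n + v := by
      intro N hnN
      have hn0 : (0 : ℝ) < n := by have : 0 < n := by omega
                                   exact_mod_cast this
      have hN0 : (0 : ℝ) < N := by have : 0 < N := by omega
                                   exact_mod_cast this
      have h1 := iterLog_div_anti hn2 hnN
      rw [div_le_div_iff₀ hN0 hn0] at h1
      have h2 : (n : ℝ) ≤ N := by exact_mod_cast hnN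
      rw [← mul_div_assoc, div_le_iff₀ hN0]
      nlinarith
    have hterm : ∀ N, lineWeight N * Real.exp (-(3 / 4 * v)) *
        Real.exp (n * ((3 * iterLog N + v) / N)) = lineWeight N * lineTerm n v N := by
      intro N
      rw [lineTerm, mul_assoc]
    simp only [hterm]
    rcases le_or_gt n 23 with h23 | h23
    · obtain ⟨J, hJ, hJn, hone⟩ := exists_head_lines hn2 h23 hv
      refine ⟨J, hJ.trans (Finset.Ico_subset_Ico_right (by omega)), fun N hN => hbelow N (hJn N hN),
        hone.trans_eq (Finset.sum_congr rfl fun N hN => ?_)⟩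
      rw [lineWeight, if_pos (Finset.mem_Ico.1 (hJ hN)).2]
    · refine ⟨Finset.Ico n ((3 * n - 1) / 2 + 1), fun N hN => ?_,
        fun N hN => hbelow N (Finset.mem_Ico.1 hN).1,
        (exists_tail_lines h23 hv).trans_eq (Finset.sum_congr rfl fun N hN => ?_)⟩
      · have := Finset.mem_Ico.1 hN
        exact Finset.mem_Ico.2 ⟨by omega, by omega⟩
      · have := Finset.mem_Ico.1 hN
        rw [lineWeight, if_neg (by omega)]
  · rw [← Finset.sum_mul]
    exact ENNReal.ofReal_le_ofReal
      (mul_le_mul_of_nonneg_right (sum_lineWeight_le T) (Real.exp_nonneg _))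

/-- The Chernoff bound at one sample size. -/
theorem measure_le_stat_le (h : IsCumulantBound μ D ψ) [IsProbabilityMeasure μ] {T n : ℕ}
    (hn : 1 ≤ n) (hnT : n ≤ T) {v : ℝ} (hv : 0 ≤ v) :
    (Measure.pi fun _ : Fin T => μ) {u | v ≤ h.stat n u} ≤ ENNReal.ofReal (Real.exp (-v)) := by
  rcases hv.eq_or_lt with rfl | hv'
  · simpa using prob_le_one
  have hn0 : (0 : ℝ) < n := by exact_mod_cast hn
  have := h.measure_exists_le_stat_le T {0} (fun _ : ℕ => v / n) (fun _ => Real.exp (-v))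
    (fun _ _ => by positivity) (fun _ _ => Real.exp_nonneg _) {n} (fun _ => v)
    (fun m hm _ => by
      obtain rfl : m = n := hm
      refine ⟨hn, {0}, le_rfl, fun _ _ => ?_, ?_⟩
      · rw [mul_div_cancel₀ _ hn0.ne']
      · simp [mul_div_cancel₀ _ hn0.ne', ← Real.exp_add])
  refine (measure_mono fun u hu => ?_).trans (this.trans_eq (by simp))
  exact ⟨n, hnT, rfl, hu⟩

/-- A maximal inequality over all sample sizes, with an iterated logarithm boundary. -/
theorem measure_exists_one_le (h : IsCumulantBound μ D ψ) [IsProbabilityMeasure μ] (T : ℕ)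
    {v : ℝ} (hv : 0 ≤ v) :
    (Measure.pi fun _ : Fin T => μ) {u | ∃ n ≤ T, 1 ≤ n ∧ 3 * iterLog n + v ≤ h.stat n u}
      ≤ ENNReal.ofReal (33 / 20 * Real.exp (-(3 / 4 * v))) := by
  rcases Nat.eq_zero_or_pos T with rfl | hT
  · refine (measure_mono_null (t := ∅) ?_ measure_empty).trans_le zero_le
    rintro u ⟨n, hn, hn1, -⟩
    omega
  -- Size one is treated apart because `iterLog 1 = 0` breaks the monotonicity of `iterLog n / n`.
  -- It costs `exp (-v)`, and `33/20 = 1 + 13/20`.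
  refine (measure_mono (t := {u | v ≤ h.stat 1 u} ∪
    {u | ∃ n ≤ T, 2 ≤ n ∧ 3 * iterLog n + v ≤ h.stat n u}) ?_).trans
    ((measure_union_le _ _).trans ((add_le_add (h.measure_le_stat_le le_rfl hT hv)
      (h.measure_exists_two_le T hv)).trans ?_))
  · rintro u ⟨n, hn, hn1, hle⟩
    rcases hn1.eq_or_lt with rfl | hn2
    · left
      simpa using hle
    · exact Or.inr ⟨n, hn, hn2, hle⟩
  · rw [← ENNReal.ofReal_add (Real.exp_nonneg _) (by positivity)]
    refine ENNReal.ofReal_le_ofReal ?_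
    have : Real.exp (-v) ≤ Real.exp (-(3 / 4 * v)) := Real.exp_le_exp.2 (by linarith)
    linarith

end IsCumulantBound

/-- Telescoping, by comparison with the integral of `(1 + y h)⁻²`. -/
theorem sum_inv_sq_le {h : ℝ} (hh : 0 < h) (J : ℕ) :
    ∑ j ∈ Finset.range (J + 1), ((1 + j * h) ^ 2)⁻¹ ≤ 1 + 1 / h - 1 / (h * (1 + J * h)) := by
  induction J with
  | zero => simp
  | succ J ih =>
    rw [Finset.sum_range_succ]
    have hJ : (0 : ℝ) ≤ J := Nat.cast_nonneg J
    have h1 : 0 < 1 + J * h := by positivity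
    have h2 : 0 < 1 + (J + 1 : ℕ) * h := by positivity
    have : ((1 + (J + 1 : ℕ) * h) ^ 2)⁻¹ ≤
        1 / (h * (1 + J * h)) - 1 / (h * (1 + (J + 1 : ℕ) * h)) := by
      rw [div_sub_div _ _ (by positivity) (by positivity), inv_eq_one_div,
        div_le_div_iff₀ (by positivity) (by positivity)]
      have e : 1 * (h * (1 + (J + 1 : ℕ) * h)) - h * (1 + J * h) * 1 = h ^ 2 := by
        push_cast
        ring
      rw [e]
      have : 1 + J * h ≤ 1 + (J + 1 : ℕ) * h := by push_cast; nlinarith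
      have h3 : 0 < h ^ 2 * (1 + (J + 1 : ℕ) * h) := by positivity
      nlinarith
    linarith

namespace IsCumulantBound

variable {μ : Measure ℝ} {D : Finset ℝ} {ψ : ℝ → ℝ}

/-- A maximal inequality over all sample sizes, by peeling into geometric slices. -/
theorem measure_exists_one_le_peeling (h : IsCumulantBound μ D ψ) [IsProbabilityMeasure μ]
    (T : ℕ) {x v : ℝ} (hx : 2 ≤ x) (hv : 0 < v) :
    (Measure.pi fun _ : Fin T => μ) {u | ∃ n ≤ T, 1 ≤ n ∧ 3 * iterLog n + v ≤ h.stat n u}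
      ≤ ENNReal.ofReal ((x + 2) * Real.exp (-(x / (x + 1) * v))) := by
  -- The ratio of the slices `[z ^ j, z ^ (j + 1))`. It multiplies the exponent by `1 / z = x / (x +
  -- 1)`, while the sum over slices costs `1 + 1 / log z ≤ x + 2`.
  set z : ℝ := (x + 1) / x with hz
  have hx0 : 0 < x := by linarith
  have hz1 : 1 < z := by rw [hz, lt_div_iff₀ hx0]; linarith
  have hz0 : 0 < z := by linarith
  have hzinv : x / (x + 1) = 1 / z := by rw [hz, one_div_div]
  have hlz : 0 < Real.log z := Real.log_pos hz1
  have hlz' : 1 / (x + 1) ≤ Real.log z := by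
    have := Real.one_sub_inv_le_log_of_pos hz0
    refine le_trans (le_of_eq ?_) this
    rw [hz, inv_div]
    field_simp
    ring
  obtain ⟨J, hJ⟩ := pow_unbounded_of_one_lt (T : ℝ) hz1
  have hB : ∀ j : ℕ, 0 ≤ Real.log (1 + j * Real.log z) := fun j =>
    Real.log_nonneg (by have : 0 ≤ j * Real.log z := by positivity
                        linarith)
  refine (h.measure_exists_le_stat_le T (Finset.range (J + 1))
    (fun j => (3 * Real.log (1 + j * Real.log z) + v) / z ^ (j + 1))
    (fun j => Real.exp (-((3 * Real.log (1 + j * Real.log z) + v) / z)))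
    (fun j _ => by have := hB j; positivity)
    (fun j _ => Real.exp_nonneg _) {n | 1 ≤ n} (fun n => 3 * iterLog n + v)
    (fun n hn hnT => ⟨hn, ?_⟩)).trans (ENNReal.ofReal_le_ofReal ?_)
  · have hn1 : 1 ≤ n := hn
    have hn' : (1 : ℝ) ≤ n := by exact_mod_cast hn1
    obtain ⟨j, hj1, hj2⟩ := exists_nat_pow_near hn' hz1
    have hjJ : j < J + 1 := by
      have : z ^ j < z ^ J := (hj1.trans (by exact_mod_cast hnT)).trans_lt hJ
      have := (pow_lt_pow_iff_right₀ hz1).1 this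
      omega
    have hpow : 0 < z ^ (j + 1) := by positivity
    refine ⟨{j}, by simpa using hjJ, fun i hi => ?_, ?_⟩
    · rw [Finset.mem_singleton.1 hi, ← mul_div_assoc, div_le_iff₀ hpow]
      have hlog : Real.log (1 + j * Real.log z) ≤ iterLog n := by
        refine Real.log_le_log (by have : 0 ≤ j * Real.log z := by positivity
                                   linarith) ?_
        rw [← Real.log_pow]
        linarith [Real.log_le_log (by positivity) hj1]
      have h0 := hB j
      have hnn := iterLog_nonneg n
      rw [mul_comm]
      exact mul_le_mul (by linarith) hj2.le (by linarith) (by linarith)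
    · rw [Finset.sum_singleton, ← Real.exp_add]
      refine Real.one_le_exp ?_
      have h0 := hB j
      have : z ^ j * ((3 * Real.log (1 + j * Real.log z) + v) / z ^ (j + 1))
          = (3 * Real.log (1 + j * Real.log z) + v) / z := by
        rw [pow_succ]
        field_simp
      have h3 := mul_le_mul_of_nonneg_right hj1 (by positivity :
        0 ≤ (3 * Real.log (1 + j * Real.log z) + v) / z ^ (j + 1))
      linarith
  · have hterm : ∀ j ∈ Finset.range (J + 1),
        Real.exp (-((3 * Real.log (1 + j * Real.log z) + v) / z))
        ≤ ((1 + j * Real.log z) ^ 2)⁻¹ * Real.exp (-(1 / z * v)) := by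
      intro j _
      have hpos : 0 < 1 + j * Real.log z := by
        have : 0 ≤ j * Real.log z := by positivity
        linarith
      have e : ((1 + j * Real.log z) ^ 2)⁻¹ = Real.exp (-(2 * Real.log (1 + j * Real.log z))) := by
        rw [Real.exp_neg, ← Real.log_rpow hpos, Real.exp_log (by positivity)]
        norm_num
      rw [e, ← Real.exp_add]
      refine Real.exp_le_exp.2 ?_
      -- This is where `x ≥ 2` enters: the factor `3` of the boundary, divided by `z`, is still at
      -- least `2`, so the slices have summable weights `(1 + j log z)⁻²`.
      have h23 : 2 * z ≤ 3 := by
        rw [hz, ← mul_div_assoc, div_le_iff₀ hx0]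
        linarith
      have h0 := hB j
      have : 2 * Real.log (1 + j * Real.log z) ≤ 3 * Real.log (1 + j * Real.log z) / z := by
        rw [le_div_iff₀ hz0]
        nlinarith
      rw [add_div]
      have e2 : 1 / z * v = v / z := by ring
      linarith
    rw [hzinv]
    refine (Finset.sum_le_sum hterm).trans ?_
    rw [← Finset.sum_mul]
    refine mul_le_mul_of_nonneg_right ((sum_inv_sq_le hlz J).trans ?_) (Real.exp_nonneg _)
    have h1 : 1 / Real.log z ≤ x + 1 := by
      rw [div_le_iff₀ hlz]
      rw [div_le_iff₀ (by linarith)] at hlz'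
      linarith
    have h2 : 0 ≤ 1 / (Real.log z * (1 + J * Real.log z)) := by positivity
    linarith

/-- The largest excess of the statistics over the boundary, over the sample sizes `n ≥ k`. -/
noncomputable def excess (h : IsCumulantBound μ D ψ) {T : ℕ} (k : ℕ) (u : Fin T → ℝ) : ℝ :=
  max 0 ((Finset.range (T + 1)).sup' ⟨0, by simp⟩
    fun n => if k ≤ n then h.stat n u - 3 * iterLog n else 0)

theorem measurable_excess (h : IsCumulantBound μ D ψ) {T : ℕ} (k : ℕ) :
    Measurable (h.excess (T := T) k) := by
  have hne : (Finset.range (T + 1)).Nonempty := ⟨0, by simp⟩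
  have := Finset.measurable_sup' (f := fun n (u : Fin T → ℝ) =>
    if k ≤ n then h.stat n u - 3 * iterLog n else 0) hne (fun n _ => by
      split_ifs
      · fun_prop
      · fun_prop)
  have e : (h.excess (T := T) k) = fun u => max 0 ((Finset.range (T + 1)).sup' hne
      (fun n (u : Fin T → ℝ) => if k ≤ n then h.stat n u - 3 * iterLog n else 0) u) := by
    funext u
    rw [Finset.sup'_apply]
    rfl
  rw [e]
  exact measurable_const.max this

theorem excess_nonneg (h : IsCumulantBound μ D ψ) {T : ℕ} (k : ℕ) (u : Fin T → ℝ) :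
    0 ≤ h.excess k u := le_max_left _ _

theorem stat_le_excess (h : IsCumulantBound μ D ψ) {T : ℕ} {k n : ℕ} (hk : k ≤ n) (hn : n ≤ T)
    (u : Fin T → ℝ) : h.stat n u ≤ 3 * iterLog n + h.excess k u := by
  have := Finset.le_sup' (f := fun n => if k ≤ n then h.stat n u - 3 * iterLog n else 0)
    (Finset.mem_range.2 (Nat.lt_succ_of_le hn))
  rw [if_pos hk] at this
  have h2 := this.trans (le_max_right 0 _)
  unfold excess
  linarith

theorem setOf_le_excess_subset (h : IsCumulantBound μ D ψ) {T : ℕ} (k : ℕ) {v : ℝ} (hv : 0 < v) :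
    {u : Fin T → ℝ | v ≤ h.excess k u}
      ⊆ {u | ∃ n ≤ T, k ≤ n ∧ 3 * iterLog n + v ≤ h.stat n u} := by
  intro u hu
  have hu' : v ≤ h.excess k u := hu
  rw [excess, le_max_iff, or_iff_right (by linarith)] at hu'
  obtain ⟨n, hn, hle⟩ := (Finset.le_sup'_iff _).1 hu'
  split_ifs at hle with hk
  · exact ⟨n, by have := Finset.mem_range.1 hn; omega, hk, by linarith⟩
  · linarith

end IsCumulantBound

/-! ### Numerical estimates for the threshold -/

/-- `L + 8 * log (1 + L)`. -/
noncomputable def baseLevel (L : ℝ) : ℝ := L + 8 * Real.log (1 + L)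

/-- The part of the threshold that depends on the number of samples. -/
noncomputable def sampleLevel (t : ℕ) : ℝ := 6 * Real.log (Real.log ((t : ℝ) / 2) + 1)

theorem sampleLevel_mono {s t : ℕ} (hs : 2 ≤ s) (hst : s ≤ t) : sampleLevel s ≤ sampleLevel t := by
  have hs' : (2 : ℝ) ≤ s := by exact_mod_cast hs
  have hst' : (s : ℝ) ≤ t := by exact_mod_cast hst
  have h0 : 0 ≤ Real.log ((s : ℝ) / 2) := Real.log_nonneg (by linarith)
  have h1 : Real.log ((s : ℝ) / 2) ≤ Real.log ((t : ℝ) / 2) :=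
    Real.log_le_log (by linarith) (by linarith)
  have h2 := Real.log_le_log (x := Real.log ((s : ℝ) / 2) + 1) (by linarith)
    (add_le_add_left h1 1)
  unfold sampleLevel
  linarith

theorem sampleLevel_nonneg {t : ℕ} (ht : 2 ≤ t) : 0 ≤ sampleLevel t := by
  have ht' : (2 : ℝ) ≤ t := by exact_mod_cast ht
  have h0 : 0 ≤ Real.log ((t : ℝ) / 2) := Real.log_nonneg (by linarith)
  have := Real.log_nonneg (x := Real.log ((t : ℝ) / 2) + 1) (by linarith)
  unfold sampleLevel
  linarith

/-- The inequality of arithmetic and geometric means, used twice: for `n`, `m` and then for `1 + log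
n`, `1 + log m`. It explains the factor `6` and the argument `t / 2` in the threshold. -/
theorem iterLog_add_le {n m : ℕ} (hn : 1 ≤ n) (hm : 1 ≤ m) :
    3 * iterLog n + 3 * iterLog m ≤ sampleLevel (n + m) := by
  have hn' : (0 : ℝ) < n := by exact_mod_cast hn
  have hm' : (0 : ℝ) < m := by exact_mod_cast hm
  have ha : 0 < 1 + Real.log n := by linarith [Real.log_natCast_nonneg n]
  have hb : 0 < 1 + Real.log m := by linarith [Real.log_natCast_nonneg m]
  have h1 : Real.log n + Real.log m ≤ 2 * Real.log ((n + m : ℕ) / 2) := by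
    rw [← Real.log_mul hn'.ne' hm'.ne', ← Real.log_rpow (by positivity)]
    refine Real.log_le_log (by positivity) ?_
    push_cast
    norm_num
    nlinarith [sq_nonneg ((n : ℝ) - m)]
  have h2 : Real.log (1 + Real.log n) + Real.log (1 + Real.log m)
      ≤ 2 * Real.log (Real.log ((n + m : ℕ) / 2) + 1) := by
    have hpos : 0 < Real.log ((n + m : ℕ) / 2) + 1 := by linarith
    rw [← Real.log_mul ha.ne' hb.ne', ← Real.log_rpow hpos]
    refine Real.log_le_log (by positivity) ?_
    norm_num
    norm_num at h1 hpos
    set s := Real.log (((n : ℝ) + m) / 2) + 1 with hs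
    have h3 : (1 + Real.log n) + (1 + Real.log m) ≤ 2 * s := by linarith
    nlinarith [sq_nonneg ((1 + Real.log n) - (1 + Real.log m))]
  unfold iterLog sampleLevel
  linarith

/-- The derivative of `(a + b z) exp (-z)` is `(b - a - b z) exp (-z) ≤ 0`. -/
theorem affine_mul_exp_neg_anti {a b y z : ℝ} (hb : 0 ≤ b) (hba : b ≤ a) (hy : 0 ≤ y)
    (hyz : y ≤ z) : (a + b * z) * Real.exp (-z) ≤ (a + b * y) * Real.exp (-y) := by
  have e : Real.exp (-y) = Real.exp (z - y) * Real.exp (-z) := by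
    rw [← Real.exp_add]
    ring_nf
  rw [e, ← mul_assoc]
  refine mul_le_mul_of_nonneg_right ?_ (Real.exp_nonneg _)
  have h1 := Real.add_one_le_exp (z - y)
  have hby : 0 ≤ b * y := by positivity
  have h2 := mul_le_mul_of_nonneg_left h1 (by linarith : 0 ≤ a + b * y)
  nlinarith

/-- A lower bound of `exp (x / 4)` for `x = baseLevel l`. -/
noncomputable def levelLower (l : ℝ) : ℝ := (1 + l / 4 + l ^ 2 / 32) * (1 + l) ^ 2

/-- An upper bound of `baseLevel l`. -/
noncomputable def levelUpper (l : ℝ) : ℝ := l + 4 * (l * (2 + l) / (1 + l))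

theorem one_le_levelLower {l : ℝ} (hl : 0 ≤ l) : 1 ≤ levelLower l := by
  unfold levelLower
  nlinarith [sq_nonneg l, mul_nonneg hl (sq_nonneg l)]

theorem baseLevel_mono {l L : ℝ} (hl : 0 ≤ l) (h : l ≤ L) : baseLevel l ≤ baseLevel L := by
  have := Real.log_le_log (x := 1 + l) (by linarith) (by linarith : 1 + l ≤ 1 + L)
  unfold baseLevel
  linarith

theorem le_baseLevel {L : ℝ} (hL : 0 ≤ L) : L ≤ baseLevel L := by
  have := Real.log_nonneg (by linarith : 1 ≤ 1 + L)
  unfold baseLevel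
  linarith

/-- Quadratic Taylor bound of `exp (l / 4)`. The quarter is chosen because the exponents `1` and
`3/4` of the tails then become the integer powers `4` and `3` of a rational function. -/
theorem four_log_levelLower_le {l : ℝ} (hl : 0 ≤ l) :
    4 * Real.log (levelLower l) ≤ baseLevel l := by
  have h1 : Real.log (1 + l / 4 + l ^ 2 / 32) ≤ l / 4 := by
    rw [Real.log_le_iff_le_exp (by positivity)]
    have := Real.quadratic_le_exp_of_nonneg (by positivity : 0 ≤ l / 4)
    nlinarith
  rw [levelLower, Real.log_mul (by positivity) (by positivity), Real.log_pow]
  unfold baseLevel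
  push_cast
  linarith

/-- From `y ≤ sinh y` at `y = log (1 + l)`, where `sinh` is rational in `l`. -/
theorem baseLevel_le_levelUpper {l : ℝ} (hl : 0 ≤ l) : baseLevel l ≤ levelUpper l := by
  have h := Real.self_le_sinh_iff.2 (Real.log_nonneg (by linarith : 1 ≤ 1 + l))
  rw [Real.sinh_eq, Real.exp_neg, Real.exp_log (by linarith)] at h
  have e : l * (2 + l) / (1 + l) = (1 + l) - (1 + l)⁻¹ := by
    field_simp
    ring
  rw [baseLevel, levelUpper, e]
  linarith

/-- A bound at `L` for decreasing functions of the level, by a rational function of `l ≤ L`. -/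
theorem affine_mul_exp_neg_level_le {a b c d l L : ℝ} (hb : 0 ≤ b) (hba : b ≤ a) (hc : 0 ≤ c)
    (hd : 0 ≤ d) (hl : 0 ≤ l) (hL : l ≤ L) :
    (a + b * (c * baseLevel L + d)) * Real.exp (-(c * baseLevel L + d))
      ≤ (a + b * (c * levelUpper l + d)) *
        (Real.exp (-(c * (4 * Real.log (levelLower l)))) * Real.exp (-d)) := by
  have h1 := one_le_levelLower hl
  have h2 := four_log_levelLower_le hl
  have h3 := baseLevel_le_levelUpper hl
  have h4 := baseLevel_mono hl hL
  have h0 : 0 ≤ Real.log (levelLower l) := Real.log_nonneg h1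
  have h5 : c * (4 * Real.log (levelLower l)) ≤ c * baseLevel L :=
    mul_le_mul_of_nonneg_left (by linarith) hc
  have h6 : c * (4 * Real.log (levelLower l)) ≤ c * levelUpper l :=
    mul_le_mul_of_nonneg_left (by linarith) hc
  refine (affine_mul_exp_neg_anti (y := c * (4 * Real.log (levelLower l)) + d) hb hba
    (by positivity) (by linarith)).trans ?_
  rw [neg_add, Real.exp_add]
  refine mul_le_mul_of_nonneg_right ?_ (by positivity)
  nlinarith

theorem exp_neg_nat_mul_log {y : ℝ} (hy : 0 < y) (k : ℕ) :
    Real.exp (-(k * Real.log y)) = 1 / y ^ k := by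
  rw [Real.exp_neg, ← Real.log_pow, Real.exp_log (by positivity), one_div]

theorem gamma_level_le {l L : ℝ} (hl : 0 ≤ l) (hL : l ≤ L) :
    (1 + baseLevel L) * Real.exp (-baseLevel L) ≤ (1 + levelUpper l) / levelLower l ^ 4 := by
  have h := affine_mul_exp_neg_level_le (a := 1) (b := 1) (c := 1) (d := 0) zero_le_one le_rfl
    zero_le_one le_rfl hl hL
  have e := exp_neg_nat_mul_log (zero_lt_one.trans_le (one_le_levelLower hl)) 4
  norm_num at h e
  rw [e] at h
  rwa [div_eq_mul_inv]

/-- The summand `log (769/100)` is a lower bound of `sampleLevel 3`: the extra level available at a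
pair of sizes `1` and at least `2`. -/
theorem gamma_level_add_le {l L : ℝ} (hl : 0 ≤ l) (hL : l ≤ L) :
    (1 + (baseLevel L + Real.log (769 / 100))) * Real.exp (-(baseLevel L + Real.log (769 / 100)))
      ≤ (1 + (levelUpper l + 2041 / 1000)) / (levelLower l ^ 4 * (769 / 100)) := by
  have hlog : Real.log (769 / 100) ≤ (2041 / 1000 : ℝ) := mod_cast
    (log_le_div_of_pow_le (p := 51) (q := 25) (x := 769 / 100) (by norm_num) (by norm_num)
      (by norm_num) Real.exp_one_gt_d9 (by norm_num)).trans (by norm_num)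
  have h := affine_mul_exp_neg_level_le (a := 1) (b := 1) (c := 1) (d := Real.log (769 / 100))
    zero_le_one le_rfl zero_le_one (Real.log_nonneg (by norm_num)) hl hL
  have e := exp_neg_nat_mul_log (zero_lt_one.trans_le (one_le_levelLower hl)) 4
  have e2 : Real.exp (-Real.log (769 / 100)) = 100 / 769 := by
    rw [Real.exp_neg, Real.exp_log (by norm_num)]
    norm_num
  simp only [one_mul, e2] at h
  rw [show ((4 : ℕ) : ℝ) = 4 by norm_num] at e
  rw [e] at h
  refine h.trans ?_
  have hp : 0 < levelLower l ^ 4 := by have := one_le_levelLower hl; positivity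
  rw [show (1 + (levelUpper l + 2041 / 1000)) / (levelLower l ^ 4 * (769 / 100))
    = (1 + (levelUpper l + 2041 / 1000)) * (1 / levelLower l ^ 4 * (100 / 769)) by
      field_simp]
  refine mul_le_mul_of_nonneg_right (by linarith) (by positivity)

theorem conv_level_le {l L : ℝ} (hl : 0 ≤ l) (hL : l ≤ L) :
    13 / 20 * Real.exp (-(3 / 4 * baseLevel L)) * (2 - 13 / 20 + 13 / 20 * (3 / 4 * baseLevel L))
      ≤ 13 / 20 * (27 / 20 + 39 / 80 * levelUpper l) / levelLower l ^ 3 := by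
  have h := affine_mul_exp_neg_level_le (a := 27 / 20) (b := 13 / 20) (c := 3 / 4) (d := 0)
    (by norm_num) (by norm_num) (by norm_num) le_rfl hl hL
  have e := exp_neg_nat_mul_log (zero_lt_one.trans_le (one_le_levelLower hl)) 3
  rw [show 3 / 4 * (4 * Real.log (levelLower l)) = (3 : ℕ) * Real.log (levelLower l) by
    push_cast; ring, e] at h
  simp only [add_zero, neg_zero, Real.exp_zero, mul_one] at h
  have e3 : 13 / 20 * (27 / 20 + 39 / 80 * levelUpper l) / levelLower l ^ 3
    = 13 / 20 * ((27 / 20 + 13 / 20 * (3 / 4 * levelUpper l)) * (1 / levelLower l ^ 3)) := by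
      ring
  rw [e3]
  linarith

theorem wide_level_le {l L : ℝ} (hl : 0 ≤ l) (hL : l ≤ L) :
    (33 / 20) ^ 2 * Real.exp (-(3 / 4 * baseLevel L)) * (1 + 3 / 4 * baseLevel L)
      ≤ (33 / 20) ^ 2 * (1 + 3 / 4 * levelUpper l) / levelLower l ^ 3 := by
  have h := affine_mul_exp_neg_level_le (a := 1) (b := 1) (c := 3 / 4) (d := 0)
    (by norm_num) (by norm_num) (by norm_num) le_rfl hl hL
  have e := exp_neg_nat_mul_log (zero_lt_one.trans_le (one_le_levelLower hl)) 3
  rw [show 3 / 4 * (4 * Real.log (levelLower l)) = (3 : ℕ) * Real.log (levelLower l) by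
    push_cast; ring, e] at h
  simp only [add_zero, neg_zero, Real.exp_zero, mul_one, one_mul] at h
  have e3 : (33 / 20) ^ 2 * (1 + 3 / 4 * levelUpper l) / levelLower l ^ 3
    = (33 / 20) ^ 2 * ((1 + 3 / 4 * levelUpper l) * (1 / levelLower l ^ 3)) := by
      ring
  rw [e3]
  linarith

theorem exp_neg_ge {l L : ℝ} (hL0 : 0 ≤ L) (hL : L ≤ l) (hl : l ≤ 1) :
    1 - (l - l ^ 2 / 2 + l ^ 3 / 6 + 5 * l ^ 4 / 96) ≤ Real.exp (-L) := by
  have h := Real.exp_bound (x := -l) (by rw [abs_neg, abs_of_nonneg (by linarith)]; exact hl)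
    (n := 4) (by norm_num)
  rw [abs_neg, abs_of_nonneg (by linarith : 0 ≤ l)] at h
  norm_num [Finset.sum_range_succ, Nat.factorial] at h
  have h2 := (abs_le.1 h).1
  have : Real.exp (-l) ≤ Real.exp (-L) := Real.exp_le_exp.2 (by linarith)
  nlinarith

/-- The estimate for small levels: the failure probabilities of four positively associated
events multiply up to at least `1 - exp (-L)`. -/
theorem small_level_estimate {L : ℝ} (hL : 0 < L) (hL' : L ≤ 69 / 100) :
    ∃ p q r : ℝ, (501 / 1000 ≤ p ∨ (1 + baseLevel L) * Real.exp (-baseLevel L) ≤ p) ∧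
      (1 + (baseLevel L + Real.log (769 / 100))) *
        Real.exp (-(baseLevel L + Real.log (769 / 100))) ≤ q ∧
      13 / 20 * Real.exp (-(3 / 4 * baseLevel L)) *
        (2 - 13 / 20 + 13 / 20 * (3 / 4 * baseLevel L)) ≤ r ∧
      p ≤ 1 ∧ q ≤ 1 ∧ r ≤ 1 ∧
      1 - (1 - p) * ((1 - q) * ((1 - q) * (1 - r))) ≤ Real.exp (-L) := by
  -- The crossing bounds decrease in the level and are evaluated at the left end `l`; the target
  -- `exp (-L)` is bounded from below at the right end `l'`. Each interval thus becomes one rational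
  -- inequality.
  have main : ∀ l l' : ℝ, 0 ≤ l → l' ≤ 1 → ∀ p : ℝ,
      (501 / 1000 ≤ p ∨ (1 + levelUpper l) / levelLower l ^ 4 ≤ p) → p ≤ 1 →
      (1 + (levelUpper l + 2041 / 1000)) / (levelLower l ^ 4 * (769 / 100)) ≤ 1 →
      13 / 20 * (27 / 20 + 39 / 80 * levelUpper l) / levelLower l ^ 3 ≤ 1 →
      l' - l' ^ 2 / 2 + l' ^ 3 / 6 + 5 * l' ^ 4 / 96 ≤ (1 - p) *
      ((1 - (1 + (levelUpper l + 2041 / 1000)) / (levelLower l ^ 4 * (769 / 100))) *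
      ((1 - (1 + (levelUpper l + 2041 / 1000)) / (levelLower l ^ 4 * (769 / 100))) *
      (1 - 13 / 20 * (27 / 20 + 39 / 80 * levelUpper l) / levelLower l ^ 3))) →
      l ≤ L → L ≤ l' →
      ∃ p q r : ℝ, (501 / 1000 ≤ p ∨ (1 + baseLevel L) * Real.exp (-baseLevel L) ≤ p) ∧
      (1 + (baseLevel L + Real.log (769 / 100))) *
        Real.exp (-(baseLevel L + Real.log (769 / 100))) ≤ q ∧
      13 / 20 * Real.exp (-(3 / 4 * baseLevel L)) *
        (2 - 13 / 20 + 13 / 20 * (3 / 4 * baseLevel L)) ≤ r ∧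
      p ≤ 1 ∧ q ≤ 1 ∧ r ≤ 1 ∧
      1 - (1 - p) * ((1 - q) * ((1 - q) * (1 - r))) ≤ Real.exp (-L) := by
    intro l l' hl hl' p hp hp1 hq hr hnum h1 h2
    refine ⟨p, _, _, hp.imp id (gamma_level_le hl h1).trans, gamma_level_add_le hl h1,
      conv_level_le hl h1, hp1, hq, hr, ?_⟩
    have := exp_neg_ge hL.le h2 hl'
    linarith
  -- The bound `(1 + x) exp (-x)` of the first event tends to `1` as the level `x` tends to `0`, so
  -- the constant `501/1000` serves up to `L = 0.236`; the last two intervals use the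
  -- level-dependent bound.
  have hcases : L ≤ 22 / 1000 ∨ (22 / 1000 ≤ L ∧ L ≤ 41 / 1000) ∨ (41 / 1000 ≤ L ∧ L ≤ 60 / 1000)
      ∨ (60 / 1000 ≤ L ∧ L ≤ 81 / 1000) ∨ (81 / 1000 ≤ L ∧ L ≤ 106 / 1000)
      ∨ (106 / 1000 ≤ L ∧ L ≤ 138 / 1000) ∨ (138 / 1000 ≤ L ∧ L ≤ 180 / 1000)
      ∨ (180 / 1000 ≤ L ∧ L ≤ 236 / 1000) ∨ (236 / 1000 ≤ L ∧ L ≤ 362 / 1000)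
      ∨ 362 / 1000 ≤ L := by
    by_contra hcon
    push Not at hcon
    obtain ⟨h0, h1, h2, h3, h4, h5, h6, h7, h8, h9⟩ := hcon
    linarith [h8 (h7 (h6 (h5 (h4 (h3 (h2 (h1 h0.le).le).le).le).le).le).le).le]
  rcases hcases with h | h | h | h | h | h | h | h | h | h
  · exact main 0 (22 / 1000) (by norm_num) (by norm_num) (501 / 1000) (Or.inl le_rfl)
      (by norm_num) (by norm_num [levelUpper, levelLower]) (by norm_num [levelUpper, levelLower])
      (by norm_num [levelUpper, levelLower]) hL.le h
  · exact main (22 / 1000) (41 / 1000) (by norm_num) (by norm_num) (501 / 1000) (Or.inl le_rfl)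
      (by norm_num) (by norm_num [levelUpper, levelLower]) (by norm_num [levelUpper, levelLower])
      (by norm_num [levelUpper, levelLower]) h.1 h.2
  · exact main (41 / 1000) (60 / 1000) (by norm_num) (by norm_num) (501 / 1000) (Or.inl le_rfl)
      (by norm_num) (by norm_num [levelUpper, levelLower]) (by norm_num [levelUpper, levelLower])
      (by norm_num [levelUpper, levelLower]) h.1 h.2
  · exact main (60 / 1000) (81 / 1000) (by norm_num) (by norm_num) (501 / 1000) (Or.inl le_rfl)
      (by norm_num) (by norm_num [levelUpper, levelLower]) (by norm_num [levelUpper, levelLower])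
      (by norm_num [levelUpper, levelLower]) h.1 h.2
  · exact main (81 / 1000) (106 / 1000) (by norm_num) (by norm_num) (501 / 1000) (Or.inl le_rfl)
      (by norm_num) (by norm_num [levelUpper, levelLower]) (by norm_num [levelUpper, levelLower])
      (by norm_num [levelUpper, levelLower]) h.1 h.2
  · exact main (106 / 1000) (138 / 1000) (by norm_num) (by norm_num) (501 / 1000) (Or.inl le_rfl)
      (by norm_num) (by norm_num [levelUpper, levelLower]) (by norm_num [levelUpper, levelLower])
      (by norm_num [levelUpper, levelLower]) h.1 h.2
  · exact main (138 / 1000) (180 / 1000) (by norm_num) (by norm_num) (501 / 1000) (Or.inl le_rfl)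
      (by norm_num) (by norm_num [levelUpper, levelLower]) (by norm_num [levelUpper, levelLower])
      (by norm_num [levelUpper, levelLower]) h.1 h.2
  · exact main (180 / 1000) (236 / 1000) (by norm_num) (by norm_num) (501 / 1000) (Or.inl le_rfl)
      (by norm_num) (by norm_num [levelUpper, levelLower]) (by norm_num [levelUpper, levelLower])
      (by norm_num [levelUpper, levelLower]) h.1 h.2
  · exact main (236 / 1000) (362 / 1000) (by norm_num) (by norm_num) _ (Or.inr le_rfl)
      (by norm_num [levelUpper, levelLower]) (by norm_num [levelUpper, levelLower])
      (by norm_num [levelUpper, levelLower]) (by norm_num [levelUpper, levelLower]) h.1 h.2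
  · exact main (362 / 1000) (69 / 100) (by norm_num) (by norm_num) _ (Or.inr le_rfl)
      (by norm_num [levelUpper, levelLower]) (by norm_num [levelUpper, levelLower])
      (by norm_num [levelUpper, levelLower]) (by norm_num [levelUpper, levelLower]) h hL'

theorem medium_level_estimate {L : ℝ} (hL : 69 / 100 ≤ L) (hL' : L ≤ 2) :
    (33 / 20) ^ 2 * Real.exp (-(3 / 4 * baseLevel L)) * (1 + 3 / 4 * baseLevel L)
      ≤ Real.exp (-L) := by
  rcases le_total L (9 / 10) with h9 | h9
  · refine (wide_level_le (l := 69 / 100) (by norm_num) hL).trans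
      (le_trans ?_ (exp_neg_ge (by linarith) h9 (by norm_num)))
    norm_num [levelUpper, levelLower]
  rcases le_total L 1 with h | h
  · refine (wide_level_le (l := 9 / 10) (by norm_num) h9).trans
      (le_trans ?_ (exp_neg_ge (by linarith) h le_rfl))
    norm_num [levelUpper, levelLower]
  · refine (wide_level_le (l := 1) (by norm_num) h).trans
      (le_trans (b := (367 / 1000) ^ 2) (by norm_num [levelUpper, levelLower]) ?_)
    have h3 := Real.exp_one_lt_d9
    have h1 : (367 / 1000 : ℝ) ≤ Real.exp (-1) := by
      rw [Real.exp_neg, ← inv_div]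
      exact inv_anti₀ (Real.exp_pos _) (by linarith)
    have h2 : Real.exp (-2) ≤ Real.exp (-L) := Real.exp_le_exp.2 (by linarith)
    refine le_trans ?_ h2
    rw [show (-2 : ℝ) = -1 + -1 by norm_num, Real.exp_add]
    nlinarith

/-- As `x² / (x + 1) ≥ x - 1`, the choice of the peeling parameter equal to the level costs only a
factor `e`. The term `8 log (1 + L)` of the level supplies `(1 + L)⁻⁸`, which absorbs the remaining
cubic polynomial in `x ≤ 11/3 * (1 + L)`. -/
theorem large_level_estimate {L : ℝ} (hL : 2 ≤ L) :
    (baseLevel L + 2) ^ 2 *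
      Real.exp (-(baseLevel L / (baseLevel L + 1) * baseLevel L)) *
      (1 + baseLevel L / (baseLevel L + 1) * baseLevel L) ≤ Real.exp (-L) := by
  set x := baseLevel L with hx
  have hxL : L ≤ x := le_baseLevel (by linarith)
  have hy : x - 1 ≤ x / (x + 1) * x := by
    rw [div_mul_eq_mul_div, le_div_iff₀ (by linarith)]
    nlinarith
  have h1 := affine_mul_exp_neg_anti (a := 1) (b := 1) zero_le_one le_rfl
    (by linarith : 0 ≤ x - 1) hy
  have h2 : Real.exp (-(x - 1)) = Real.exp 1 * (Real.exp (-L) * ((1 + L) ^ 8)⁻¹) := by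
    have : ((1 + L) ^ 8)⁻¹ = Real.exp (-(8 * Real.log (1 + L))) := by
      rw [Real.exp_neg, ← Real.log_rpow (by linarith), Real.exp_log (by positivity)]
      norm_num
    rw [this, ← Real.exp_add, ← Real.exp_add, hx, baseLevel]
    ring_nf
  rw [h2] at h1
  have hlog3 : Real.log 3 ≤ 11 / 10 := by
    have := log_le_div_of_pow_le (p := 11) (q := 10) (x := 3) (by norm_num)
      (by norm_num) (by norm_num) Real.exp_one_gt_d9 (by norm_num)
    exact_mod_cast this
  have hlog : Real.log (1 + L) ≤ 11 / 10 + (L - 2) / 3 := by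
    have := Real.log_le_sub_one_of_pos (by linarith : 0 < (1 + L) / 3)
    rw [Real.log_div (by linarith) (by norm_num)] at this
    linarith
  have hxq : x ≤ 11 / 3 * (1 + L) := by
    rw [hx, baseLevel]
    linarith
  set q := 1 + L with hq
  have hq3 : 3 ≤ q := by linarith
  have hkey : (x + 2) ^ 2 * (x * Real.exp 1) ≤ q ^ 8 := by
    have he := Real.exp_one_lt_d9
    have hx2 : x + 2 ≤ 13 / 3 * q := by linarith
    have hx0 : 0 ≤ x := by linarith
    calc (x + 2) ^ 2 * (x * Real.exp 1) ≤ (13 / 3 * q) ^ 2 * (11 / 3 * q * (2.7182818286)) := by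
          gcongr
      _ = (13 / 3) ^ 2 * (11 / 3) * 2.7182818286 * q ^ 3 := by ring
      _ ≤ q ^ 5 * q ^ 3 := by
          refine mul_le_mul_of_nonneg_right ?_ (by positivity)
          calc (13 / 3) ^ 2 * (11 / 3) * 2.7182818286 ≤ (3 : ℝ) ^ 5 := by norm_num
            _ ≤ q ^ 5 := by gcongr
      _ = q ^ 8 := by ring
  have hq8 : 0 < q ^ 8 := by positivity
  calc (x + 2) ^ 2 * Real.exp (-(x / (x + 1) * x)) * (1 + x / (x + 1) * x)
      = (x + 2) ^ 2 * ((1 + 1 * (x / (x + 1) * x)) * Real.exp (-(x / (x + 1) * x))) := by ring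
    _ ≤ (x + 2) ^ 2 * ((1 + 1 * (x - 1)) * (Real.exp 1 * (Real.exp (-L) * (q ^ 8)⁻¹))) :=
        mul_le_mul_of_nonneg_left h1 (by positivity)
    _ = ((x + 2) ^ 2 * (x * Real.exp 1)) * (q ^ 8)⁻¹ * Real.exp (-L) := by ring
    _ ≤ q ^ 8 * (q ^ 8)⁻¹ * Real.exp (-L) := by gcongr
    _ = Real.exp (-L) := by rw [mul_inv_cancel₀ hq8.ne', one_mul]

/-! ### Two independent stacks -/

/-- The complements are lower sets, hence positively correlated, so both events fail with
probability at least `(1 - p) * (1 - q)`. This beats `p + q`, and is useful even when `p + q > 1`.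
-/
theorem IsAssociated.measure_union_le {α : Type*} [Preorder α] [MeasurableSpace α] {κ : Measure α}
    [IsProbabilityMeasure κ] (hκ : IsAssociated κ) {E F : Set α} (hE : MeasurableSet E)
    (hF : MeasurableSet F) (hEu : IsUpperSet E) (hFu : IsUpperSet F) {p q : ℝ}
    (hp : κ E ≤ ENNReal.ofReal p) (hq : κ F ≤ ENNReal.ofReal q) (hp1 : p ≤ 1) (hq1 : q ≤ 1)
    (hp0 : 0 ≤ p) (hq0 : 0 ≤ q) :
    κ (E ∪ F) ≤ ENNReal.ofReal (1 - (1 - p) * (1 - q)) := by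
  have h := hκ.measure_mul_le hE.compl hF.compl hEu.compl hFu.compl
  have hr := ENNReal.toReal_mono (measure_ne_top _ _) h
  rw [ENNReal.toReal_mul] at hr
  change κ.real Eᶜ * κ.real Fᶜ ≤ κ.real (Eᶜ ∩ Fᶜ) at hr
  rw [← Set.compl_union, probReal_compl_eq_one_sub hE, probReal_compl_eq_one_sub hF,
    probReal_compl_eq_one_sub (hE.union hF)] at hr
  have hp' : κ.real E ≤ p := ENNReal.toReal_le_of_le_ofReal hp0 hp
  have hq' : κ.real F ≤ q := ENNReal.toReal_le_of_le_ofReal hq0 hq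
  refine (ENNReal.le_ofReal_iff_toReal_le (measure_ne_top _ _) (by nlinarith)).2 ?_
  change κ.real (E ∪ F) ≤ _
  nlinarith [mul_le_mul (by linarith : 1 - p ≤ 1 - κ.real E) (by linarith : 1 - q ≤ 1 - κ.real F)
    (by linarith) (by linarith)]

section TwoStacks

variable {μ ν : Measure ℝ} {D D' : Finset ℝ} {ψ ψ' : ℝ → ℝ}

/-- The event that the sum of the statistics of two stacks, at sample sizes `n` and `m`, reaches
the threshold of level `x`. -/
def crossing (hμ : IsCumulantBound μ D ψ) (hν : IsCumulantBound ν D' ψ') (T : ℕ) (x : ℝ)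
    (n m : ℕ) : Set ((Fin T → ℝ) × (Fin T → ℝ)) :=
  {p | n ≤ T ∧ m ≤ T ∧ x + sampleLevel (n + m) ≤ hμ.stat n p.1 + hν.stat m p.2}

variable (hμ : IsCumulantBound μ D ψ) (hν : IsCumulantBound ν D' ψ') (T : ℕ)

theorem measurableSet_crossing (x : ℝ) (n m : ℕ) : MeasurableSet (crossing hμ hν T x n m) := by
  have h1 : Measurable fun p : (Fin T → ℝ) × (Fin T → ℝ) => hμ.stat n p.1 :=
    (hμ.measurable_stat n).comp measurable_fst
  have h2 : Measurable fun p : (Fin T → ℝ) × (Fin T → ℝ) => hν.stat m p.2 :=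
    (hν.measurable_stat m).comp measurable_snd
  unfold crossing
  simp only [Set.ofPred_and]
  exact (MeasurableSet.const _).inter ((MeasurableSet.const _).inter
    (measurableSet_le measurable_const (h1.add h2)))

theorem isUpperSet_crossing (x : ℝ) (n m : ℕ) : IsUpperSet (crossing hμ hν T x n m) := by
  rintro p q hpq ⟨h1, h2, h3⟩
  exact ⟨h1, h2, h3.trans (add_le_add (hμ.stat_mono n hpq.1) (hν.stat_mono m hpq.2))⟩

/-- The sample-size term of the threshold splits into one boundary per stack. All pairs `(n, m)` are
thereby covered by a single event on a sum of two independent variables. -/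
theorem crossing_subset_excess {x : ℝ} {k n m : ℕ} (hk : 1 ≤ k) (hn : k ≤ n) (hm : k ≤ m) :
    crossing hμ hν T x n m ⊆ {p | x ≤ hμ.excess k p.1 + hν.excess k p.2} := by
  rintro p ⟨hnT, hmT, hle⟩
  have h1 := hμ.stat_le_excess hn hnT p.1
  have h2 := hν.stat_le_excess hm hmT p.2
  have h3 := iterLog_add_le (hk.trans hn) (hk.trans hm)
  change x ≤ _
  linarith

theorem excess_tail {k : ℕ} {s ρ v : ℝ} (hv : 0 < v)
    (h : (Measure.pi fun _ : Fin T => μ) {u | ∃ n ≤ T, k ≤ n ∧ 3 * iterLog n + v ≤ hμ.stat n u}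
      ≤ ENNReal.ofReal (s * Real.exp (-(ρ * v)))) :
    (Measure.pi fun _ : Fin T => μ) {u | v ≤ hμ.excess k u}
      ≤ ENNReal.ofReal (s * Real.exp (-(ρ * v))) :=
  (measure_mono (hμ.setOf_le_excess_subset k hv)).trans h

variable [IsProbabilityMeasure μ] [IsProbabilityMeasure ν]

/-- At fixed sizes each statistic has a standard exponential tail by Chernoff, and the sum has the
tail of a Gamma variable of shape `2`. -/
theorem measure_crossing_le {x s : ℝ} {n m : ℕ} (hn : 1 ≤ n) (hm : 1 ≤ m)
    (hs : s ≤ sampleLevel (n + m)) (hxs : 0 < x + s) :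
    ((Measure.pi fun _ : Fin T => μ).prod (Measure.pi fun _ : Fin T => ν))
      (crossing hμ hν T x n m) ≤ ENNReal.ofReal ((1 + (x + s)) * Real.exp (-(x + s))) := by
  by_cases hT : n ≤ T ∧ m ≤ T
  · have h := measure_prod_le_of_exp_tail (μ := Measure.pi fun _ : Fin T => μ)
      (ν := Measure.pi fun _ : Fin T => ν) (A := hμ.stat n) (B := hν.stat m) (ρ := 1) (s := 1)
      (hμ.measurable_stat n) (hν.measurable_stat m) (hμ.stat_nonneg n) zero_le_one le_rfl one_pos
      (fun v hv => by simpa using hμ.measure_le_stat_le hn hT.1 hv.le)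
      (fun v hv => by simpa using hν.measure_le_stat_le hm hT.2 hv.le) hxs
    refine (measure_mono ?_).trans (h.trans_eq ?_)
    · rintro p ⟨-, -, hp⟩
      exact (by linarith : x + s ≤ x + sampleLevel (n + m)).trans hp
    · congr 1
      ring_nf
  · refine (measure_mono_null (t := ∅) ?_ measure_empty).trans_le zero_le
    rintro p ⟨h1, h2, -⟩
    exact hT ⟨h1, h2⟩

/-- The threshold is crossed at some pair of sample sizes with probability at most `exp (-L)`. -/
theorem measure_exists_crossing_le {L : ℝ} (hL : 69 / 100 ≤ L) :
    ((Measure.pi fun _ : Fin T => μ).prod (Measure.pi fun _ : Fin T => ν))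
      {p | ∃ n m, 1 ≤ n ∧ 1 ≤ m ∧ p ∈ crossing hμ hν T (baseLevel L) n m}
      ≤ ENNReal.ofReal (Real.exp (-L)) := by
  have hx : 0 < baseLevel L := lt_of_lt_of_le (by linarith) (le_baseLevel (by linarith))
  refine (measure_mono (t := {p | baseLevel L ≤ hμ.excess 1 p.1 + hν.excess 1 p.2}) ?_).trans ?_
  · rintro p ⟨n, m, hn, hm, hp⟩
    exact crossing_subset_excess hμ hν T le_rfl hn hm hp
  -- Weighted lines have a small prefactor but the rate `3/4`. Peeling, with parameter equal to the
  -- level, has a rate close to `1` and a prefactor that is affordable at large levels.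
  rcases le_total L 2 with h2 | h2
  · refine (measure_prod_le_of_exp_tail_of_one_le (hμ.measurable_excess 1) (hν.measurable_excess 1)
      (s := 33 / 20) (ρ := 3 / 4) (by norm_num) (by norm_num)
      (fun v hv => excess_tail hμ T hv (hμ.measure_exists_one_le T hv.le))
      (fun v hv => excess_tail hν T hv (hν.measure_exists_one_le T hv.le)) hx.le).trans ?_
    exact ENNReal.ofReal_le_ofReal (medium_level_estimate hL h2)
  · have hx2 : 2 ≤ baseLevel L := h2.trans (le_baseLevel (by linarith))
    refine (measure_prod_le_of_exp_tail_of_one_le (hμ.measurable_excess 1) (hν.measurable_excess 1)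
      (s := baseLevel L + 2) (ρ := baseLevel L / (baseLevel L + 1)) (by linarith) (by positivity)
      (fun v hv => excess_tail hμ T hv (hμ.measure_exists_one_le_peeling T hx2 hv))
      (fun v hv => excess_tail hν T hv (hν.measure_exists_one_le_peeling T hx2 hv)) hx.le).trans ?_
    exact ENNReal.ofReal_le_ofReal (large_level_estimate h2)

theorem log_le_sampleLevel_three : Real.log (769 / 100) ≤ sampleLevel 3 := by
  have h1 : (15 / 37 : ℝ) ≤ Real.log (3 / 2) := mod_cast
    div_le_log_of_pow_le (p := 15) (q := 37) (x := 3 / 2) (by norm_num) (by norm_num)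
      Real.exp_one_lt_d9 (by norm_num)
  have h2 : Real.log (52 / 37) ≤ Real.log (Real.log (3 / 2) + 1) :=
    Real.log_le_log (by norm_num) (by linarith)
  have h3 : Real.log (769 / 100) ≤ Real.log ((52 / 37) ^ 6) :=
    Real.log_le_log (by norm_num) (by norm_num)
  rw [Real.log_pow] at h3
  unfold sampleLevel
  push_cast at h3 ⊢
  linarith

theorem log_le_sampleLevel_four : Real.log 23 ≤ sampleLevel 4 := by
  have h2 : Real.log (22 / 13) ≤ Real.log (Real.log (4 / 2) + 1) :=
    Real.log_le_log (by norm_num) (by norm_num; linarith [le_log_2])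
  have h3 : Real.log 23 ≤ Real.log ((22 / 13) ^ 6) :=
    Real.log_le_log (by norm_num) (by norm_num)
  rw [Real.log_pow] at h3
  unfold sampleLevel
  push_cast at h3 ⊢
  linarith

theorem measure_exists_two_crossing_le {x : ℝ} (hx : 0 < x) :
    ((Measure.pi fun _ : Fin T => μ).prod (Measure.pi fun _ : Fin T => ν))
      (⋃ n, ⋃ m, {_p | 2 ≤ n ∧ 2 ≤ m} ∩ crossing hμ hν T x n m)
      ≤ ENNReal.ofReal (13 / 20 * Real.exp (-(3 / 4 * x)) *
        (2 - 13 / 20 + 13 / 20 * (3 / 4 * x))) := by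
  have h := measure_prod_le_of_exp_tail (μ := Measure.pi fun _ : Fin T => μ)
    (ν := Measure.pi fun _ : Fin T => ν) (hμ.measurable_excess 2) (hν.measurable_excess 2)
    (hμ.excess_nonneg 2) (s := 13 / 20) (ρ := 3 / 4) (by norm_num) (by norm_num) (by norm_num)
    (fun v hv => excess_tail hμ T hv (hμ.measure_exists_two_le T hv.le))
    (fun v hv => excess_tail hν T hv (hν.measure_exists_two_le T hv.le)) hx
  refine (measure_mono ?_).trans h
  refine Set.iUnion_subset fun n => Set.iUnion_subset fun m => ?_
  rintro p ⟨⟨hn, hm⟩, hp⟩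
  exact crossing_subset_excess hμ hν T (by norm_num) hn hm hp

/-- The union bound for small levels, with three exceptional events. -/
theorem measure_union_crossing_le {L : ℝ} (hL : 0 < L) (hL' : L ≤ 69 / 100)
    {S : Set ((Fin T → ℝ) × (Fin T → ℝ))} (hS : MeasurableSet S) (hSu : IsUpperSet S)
    (hS1 : ((Measure.pi fun _ : Fin T => μ).prod (Measure.pi fun _ : Fin T => ν)) S
      ≤ ENNReal.ofReal (501 / 1000))
    (hS2 : ((Measure.pi fun _ : Fin T => μ).prod (Measure.pi fun _ : Fin T => ν)) S
      ≤ ENNReal.ofReal ((1 + baseLevel L) * Real.exp (-baseLevel L)))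
    {k : ℕ} (hk : 2 ≤ k) :
    ((Measure.pi fun _ : Fin T => μ).prod (Measure.pi fun _ : Fin T => ν))
      (S ∪ (crossing hμ hν T (baseLevel L) 1 k ∪ (crossing hμ hν T (baseLevel L) k 1 ∪
        ⋃ n, ⋃ m, {_p | 2 ≤ n ∧ 2 ≤ m} ∩ crossing hμ hν T (baseLevel L) n m)))
      ≤ ENNReal.ofReal (Real.exp (-L)) := by
  obtain ⟨p, q, r, hp, hq, hr, hp1, hq1, hr1, hle⟩ := small_level_estimate hL hL'
  have hx : 0 < baseLevel L := hL.trans_le (le_baseLevel hL.le)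
  have hlog : 0 ≤ Real.log (769 / 100) := Real.log_nonneg (by norm_num)
  have hass := (isAssociated_pi μ T).prod (isAssociated_pi ν T)
  have hp0 : 0 ≤ p := by
    rcases hp with h | h
    · linarith
    · exact le_trans (by positivity) h
  have hq0 : 0 ≤ q := le_trans (by positivity) hq
  have hr0 : 0 ≤ r := le_trans (by norm_num; positivity) hr
  have hlev : Real.log (769 / 100) ≤ sampleLevel (1 + k) :=
    log_le_sampleLevel_three.trans (sampleLevel_mono (by norm_num) (by omega))
  have hlev' : Real.log (769 / 100) ≤ sampleLevel (k + 1) := by rwa [add_comm k 1]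
  have m1 := measurableSet_crossing hμ hν T (baseLevel L) 1 k
  have m2 := measurableSet_crossing hμ hν T (baseLevel L) k 1
  have m3 : MeasurableSet (⋃ n : ℕ, ⋃ m : ℕ, {_p : (Fin T → ℝ) × (Fin T → ℝ) | 2 ≤ n ∧ 2 ≤ m} ∩
      crossing hμ hν T (baseLevel L) n m) :=
    MeasurableSet.iUnion fun n => MeasurableSet.iUnion fun m =>
      (MeasurableSet.const _).inter (measurableSet_crossing hμ hν T _ n m)
  have u1 := isUpperSet_crossing hμ hν T (baseLevel L) 1 k
  have u2 := isUpperSet_crossing hμ hν T (baseLevel L) k 1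
  have u3 : IsUpperSet (⋃ n : ℕ, ⋃ m : ℕ, {_p : (Fin T → ℝ) × (Fin T → ℝ) | 2 ≤ n ∧ 2 ≤ m} ∩
      crossing hμ hν T (baseLevel L) n m) := by
    refine isUpperSet_iUnion fun n => isUpperSet_iUnion fun m => ?_
    rintro a b hab ⟨h1, h2⟩
    exact ⟨h1, isUpperSet_crossing hμ hν T _ n m hab h2⟩
  have b1 := (measure_crossing_le hμ hν T le_rfl (by omega : 1 ≤ k) hlev (x := baseLevel L)
    (by positivity)).trans (ENNReal.ofReal_le_ofReal hq)
  have b2 := (measure_crossing_le hμ hν T (by omega : 1 ≤ k) le_rfl hlev' (x := baseLevel L)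
    (by positivity)).trans (ENNReal.ofReal_le_ofReal hq)
  have b3 := (measure_exists_two_crossing_le hμ hν T hx).trans (ENNReal.ofReal_le_ofReal hr)
  have b0 := hp.elim (fun h => hS1.trans (ENNReal.ofReal_le_ofReal h))
    (fun h => hS2.trans (ENNReal.ofReal_le_ofReal h))
  have c1 := hass.measure_union_le m2 m3 u2 u3 b2 b3 hq1 hr1 hq0 hr0
  have c2 := hass.measure_union_le m1 (m2.union m3) u1 (u2.union u3) b1 c1 hq1
    (by nlinarith) hq0 (by nlinarith)
  have c3 := hass.measure_union_le hS (m1.union (m2.union m3)) hSu (u1.union (u2.union u3)) b0 c2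
    hp1 (by nlinarith [mul_nonneg (sub_nonneg.2 hq1) (mul_nonneg (sub_nonneg.2 hq1)
      (sub_nonneg.2 hr1))]) hp0 (by
      have h1 : (1 - q) * (1 - r) ≤ 1 := by nlinarith
      have h2 : 0 ≤ (1 - q) * (1 - r) := mul_nonneg (by linarith) (by linarith)
      nlinarith)
  refine c3.trans (ENNReal.ofReal_le_ofReal ?_)
  have e : (1 - p) * (1 - (1 - (1 - q) * (1 - (1 - (1 - q) * (1 - r)))))
    = (1 - p) * ((1 - q) * ((1 - q) * (1 - r))) := by ring
  linarith

/-- With offline data, `k = τ₁ + 1`. The two pairs containing `k + 1` play the role of `S`: their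
sizes add up to at least `4`, and `sampleLevel 4 ≥ log 23` makes even their union bound meet both
requirements on `S`. -/
theorem measure_union_crossing_le_of_two_le {L : ℝ} (hL : 0 < L) (hL' : L ≤ 69 / 100)
    {k : ℕ} (hk : 2 ≤ k) :
    ((Measure.pi fun _ : Fin T => μ).prod (Measure.pi fun _ : Fin T => ν))
      ((crossing hμ hν T (baseLevel L) 1 (k + 1) ∪ crossing hμ hν T (baseLevel L) (k + 1) 1) ∪
        (crossing hμ hν T (baseLevel L) 1 k ∪ (crossing hμ hν T (baseLevel L) k 1 ∪
        ⋃ n, ⋃ m, {_p | 2 ≤ n ∧ 2 ≤ m} ∩ crossing hμ hν T (baseLevel L) n m)))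
      ≤ ENNReal.ofReal (Real.exp (-L)) := by
  have hx : 0 < baseLevel L := hL.trans_le (le_baseLevel hL.le)
  have hlog : 0 ≤ Real.log 23 := Real.log_nonneg (by norm_num)
  have hlog' : Real.log 23 ≤ (22 / 7 : ℝ) := mod_cast
    log_le_div_of_pow_le (p := 22) (q := 7) (x := 23) (by norm_num) (by norm_num)
      (by norm_num) Real.exp_one_gt_d9 (by norm_num)
  have hlev : Real.log 23 ≤ sampleLevel (1 + (k + 1)) :=
    log_le_sampleLevel_four.trans (sampleLevel_mono (by norm_num) (by omega))
  have hlev' : Real.log 23 ≤ sampleLevel (k + 1 + 1) := by rwa [add_comm (k + 1) 1]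
  have b1 := measure_crossing_le hμ hν T le_rfl (by omega : 1 ≤ k + 1) hlev (x := baseLevel L)
    (by positivity)
  have b2 := measure_crossing_le hμ hν T (by omega : 1 ≤ k + 1) le_rfl hlev' (x := baseLevel L)
    (by positivity)
  have hexp : Real.exp (-(baseLevel L + Real.log 23)) = Real.exp (-baseLevel L) / 23 := by
    rw [neg_add, Real.exp_add, Real.exp_neg (Real.log 23), Real.exp_log (by norm_num)]
    ring
  have hU : ((Measure.pi fun _ : Fin T => μ).prod (Measure.pi fun _ : Fin T => ν))
      (crossing hμ hν T (baseLevel L) 1 (k + 1) ∪ crossing hμ hν T (baseLevel L) (k + 1) 1)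
      ≤ ENNReal.ofReal (2 / 23 * ((1 + (baseLevel L + Real.log 23)) *
        Real.exp (-baseLevel L))) := by
    refine (MeasureTheory.measure_union_le _ _).trans ((add_le_add b1 b2).trans_eq ?_)
    rw [← ENNReal.ofReal_add (by positivity) (by positivity), hexp]
    congr 1
    ring
  refine measure_union_crossing_le hμ hν T hL hL'
    ((measurableSet_crossing hμ hν T _ _ _).union (measurableSet_crossing hμ hν T _ _ _))
    ((isUpperSet_crossing hμ hν T _ _ _).union (isUpperSet_crossing hμ hν T _ _ _))
    (hU.trans (ENNReal.ofReal_le_ofReal ?_)) (hU.trans (ENNReal.ofReal_le_ofReal ?_)) hk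
  · have h := affine_mul_exp_neg_anti (a := 1 + Real.log 23) (b := 1) zero_le_one (by linarith)
      le_rfl hx.le
    simp only [neg_zero, Real.exp_zero] at h
    have e : 1 + (baseLevel L + Real.log 23) = 1 + Real.log 23 + 1 * baseLevel L := by ring
    rw [e]
    linarith
  · rw [← mul_assoc]
    refine mul_le_mul_of_nonneg_right ?_ (Real.exp_nonneg _)
    linarith

end TwoStacks

/-! ### Facts on exponential families -/

namespace ExpFamily

variable (F : ExpFamily)

theorem measurable_density (θ : ℝ) :
    Measurable fun x : ℝ => ENNReal.ofReal (Real.exp (θ * x - F.b θ)) := by fun_prop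

theorem dist_eq_withDensity (θ θ' : ℝ) :
    F.dist θ' = (F.dist θ).withDensity
      (fun x => ENNReal.ofReal (Real.exp ((θ' - θ) * x - (F.b θ' - F.b θ)))) := by
  unfold dist
  rw [← withDensity_mul _ (F.measurable_density θ) (by fun_prop)]
  congr 1
  funext x
  rw [Pi.mul_apply, ← ENNReal.ofReal_mul (Real.exp_nonneg _), ← Real.exp_add]
  ring_nf

theorem lintegral_exp_dist {θ θ' : ℝ} (h' : θ' ∈ F.Θ) :
    ∫⁻ x, ENNReal.ofReal (Real.exp ((θ' - θ) * x - (F.b θ' - F.b θ))) ∂(F.dist θ) = 1 := by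
  have := F.isProbabilityMeasure_dist h'
  rw [← setLIntegral_univ, ← withDensity_apply _ .univ, ← F.dist_eq_withDensity, measure_univ]

/-- Nonnegativity of the Kullback-Leibler divergence, that is, the tangent inequality for `b`. -/
theorem mul_mean_le {θ θ' : ℝ} (h : θ ∈ F.Θ) (h' : θ' ∈ F.Θ) :
    (θ' - θ) * F.mean θ ≤ F.b θ' - F.b θ := by
  have := F.isProbabilityMeasure_dist h
  have := F.isProbabilityMeasure_dist h'
  have hnn := InformationTheory.integral_llr_add_sub_measure_univ_nonneg (F.llr_dist h h').1
    (F.integral_llr_dist h h').1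
  rw [(F.integral_llr_dist h h').2] at hnn
  simp only [probReal_univ, add_sub_cancel_right] at hnn
  linarith

theorem lt_of_mean_lt {θ θ' : ℝ} (h : θ ∈ F.Θ) (h' : θ' ∈ F.Θ) (hlt : F.mean θ < F.mean θ') :
    θ < θ' := by
  by_contra hle
  push Not at hle
  have h1 := F.mul_mean_le h h'
  have h2 := F.mul_mean_le h' h
  rcases hle.eq_or_lt with rfl | hl
  · exact lt_irrefl _ hlt
  · nlinarith

theorem convexOn_b : ConvexOn ℝ F.Θ F.b := F.strictConvexOn_logPartition.convexOn

theorem continuousOn_b : ContinuousOn F.b F.Θ := F.convexOn_b.continuousOn F.isOpen_param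

/-- The log-likelihood ratio per observation of `θ` against `θ₀`, at an average `m`. -/
noncomputable def llrAvg (θ₀ m θ : ℝ) : ℝ := (θ - θ₀) * m - (F.b θ - F.b θ₀)

theorem kl_le_ofReal {m θ c : ℝ} (θ₀ : ℝ)
    (h : ∀ θ' ∈ F.Θ, F.llrAvg θ₀ m θ' - F.llrAvg θ₀ m θ ≤ c) : F.kl m θ ≤ ENNReal.ofReal c := by
  refine iSup₂_le fun θ' h' => ENNReal.ofReal_le_ofReal ?_
  have := h θ' h'
  unfold llrAvg at this
  linarith

theorem glr_le_ofReal {n p m q θ s t : ℝ} (θ₀ : ℝ) (hn : 0 ≤ n) (hm : 0 ≤ m) (hθ : θ ∈ F.Θ)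
    (hs : ∀ θ' ∈ F.Θ, F.llrAvg θ₀ p θ' - F.llrAvg θ₀ p θ ≤ s)
    (ht : ∀ θ' ∈ F.Θ, F.llrAvg θ₀ q θ' - F.llrAvg θ₀ q θ ≤ t) :
    F.glr n p m q ≤ ENNReal.ofReal (n * s + m * t) := by
  have hs0 : 0 ≤ s := by simpa using hs θ hθ
  have ht0 : 0 ≤ t := by simpa using ht θ hθ
  refine (iInf₂_le θ hθ).trans ?_
  rw [ENNReal.ofReal_add (by positivity) (by positivity), ENNReal.ofReal_mul hn,
    ENNReal.ofReal_mul hm]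
  gcongr
  · exact F.kl_le_ofReal θ₀ hs
  · exact F.kl_le_ofReal θ₀ ht

theorem concaveOn_llrAvg (θ₀ m : ℝ) : ConcaveOn ℝ F.Θ (F.llrAvg θ₀ m) := by
  refine ⟨F.convexOn_b.1, fun x hx y hy a b ha hb hab => ?_⟩
  have := F.convexOn_b.2 hx hy ha hb hab
  simp only [smul_eq_mul, llrAvg] at this ⊢
  obtain rfl : b = 1 - a := by linarith
  nlinarith

/-- A concave function that is `0` at `y` and positive on one side of `y` is nonpositive on the
other side. -/
theorem llrAvg_nonpos_of_pos {θ₀ m x y : ℝ} (hθ₀ : θ₀ ∈ F.Θ) (hx : x ∈ F.Θ) (hy : y ∈ F.Θ)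
    (hxy : 0 ≤ (x - θ₀) * (θ₀ - y)) (hpos : 0 < F.llrAvg θ₀ m x) : F.llrAvg θ₀ m y ≤ 0 := by
  by_contra hcon
  push Not at hcon
  have h0 : F.llrAvg θ₀ m θ₀ = 0 := by simp [llrAvg]
  have hseg : θ₀ ∈ segment ℝ x y := by
    rw [segment_eq_uIcc, Set.mem_uIcc]
    rcases le_or_gt x θ₀ with h | h
    · rcases h.eq_or_lt with rfl | h
      · linarith
      · left
        exact ⟨h.le, by nlinarith⟩
    · right
      exact ⟨by nlinarith, h.le⟩
  have := (F.concaveOn_llrAvg θ₀ m).min_le_of_mem_segment hx hy hseg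
  rw [h0] at this
  rcases min_le_iff.1 this with h | h <;> linarith

theorem exists_near_max {θ₀ m s η : ℝ} {A : Set ℝ} (hA : A.Nonempty) (hη : 0 < η)
    (hs : ∀ θ ∈ A, F.llrAvg θ₀ m θ ≤ s) :
    ∃ θ ∈ A, ∀ θ' ∈ A, F.llrAvg θ₀ m θ' ≤ F.llrAvg θ₀ m θ + η := by
  have hbdd : BddAbove (F.llrAvg θ₀ m '' A) := ⟨s, by rintro _ ⟨θ, h, rfl⟩; exact hs θ h⟩
  obtain ⟨_, ⟨θ, hθ, rfl⟩, hlt⟩ := exists_lt_of_lt_csSup (hA.image (F.llrAvg θ₀ m))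
    (sub_lt_self _ hη)
  refine ⟨θ, hθ, fun θ' h' => ?_⟩
  have := le_csSup hbdd ⟨θ', h', rfl⟩
  linarith

/-- If the likelihood at `q` grows to the right of `θ₀`, its near maximizer there works: it is
nearly optimal for `q`, and at `p ≥ q` its log-likelihood ratio is still nonnegative, so the loss at
`p` is at most `s`. If the likelihood at `p` grows to the left, the argument is mirrored. Otherwise
`θ₀` itself works. The slack `η` is needed because maxima need not be attained. -/
theorem exists_common_param {θ₀ p q s t η : ℝ} (hθ₀ : θ₀ ∈ F.Θ) (hpq : q ≤ p) (hη : 0 < η)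
    (hs : ∀ θ ∈ F.Θ, θ₀ ≤ θ → F.llrAvg θ₀ p θ ≤ s)
    (ht : ∀ θ ∈ F.Θ, θ ≤ θ₀ → F.llrAvg θ₀ q θ ≤ t) :
    ∃ θ ∈ F.Θ, (∀ θ' ∈ F.Θ, F.llrAvg θ₀ p θ' - F.llrAvg θ₀ p θ ≤ s + η) ∧
      (∀ θ' ∈ F.Θ, F.llrAvg θ₀ q θ' - F.llrAvg θ₀ q θ ≤ t + η) := by
  have h0 : ∀ m, F.llrAvg θ₀ m θ₀ = 0 := fun m => by simp [llrAvg]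
  have hs0 : 0 ≤ s := by simpa [h0] using hs θ₀ hθ₀ le_rfl
  have ht0 : 0 ≤ t := by simpa [h0] using ht θ₀ hθ₀ le_rfl
  have hge : ∀ θ, θ₀ ≤ θ → F.llrAvg θ₀ q θ ≤ F.llrAvg θ₀ p θ := fun θ h => by
    have := mul_le_mul_of_nonneg_left hpq (sub_nonneg.2 h)
    unfold llrAvg
    linarith
  have hle : ∀ θ, θ ≤ θ₀ → F.llrAvg θ₀ p θ ≤ F.llrAvg θ₀ q θ := fun θ h => by
    have := mul_le_mul_of_nonneg_left hpq (sub_nonneg.2 h)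
    unfold llrAvg
    linarith
  by_cases h1 : ∃ θ₁ ∈ F.Θ, θ₀ ≤ θ₁ ∧ 0 < F.llrAvg θ₀ q θ₁
  · obtain ⟨θ₁, hθ₁, hθ₁₀, hpos⟩ := h1
    obtain ⟨θ, ⟨hθ, hθ'⟩, hmax⟩ := F.exists_near_max (θ₀ := θ₀) (m := q) (s := s)
      (A := F.Θ ∩ Set.Ici θ₀) ⟨θ₀, hθ₀, le_refl θ₀⟩ (lt_min hη hpos)
      (fun θ h => (hge θ h.2).trans (hs θ h.1 h.2))
    have hθ0 : 0 ≤ F.llrAvg θ₀ q θ := by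
      linarith [hmax θ₁ ⟨hθ₁, hθ₁₀⟩, min_le_right η (F.llrAvg θ₀ q θ₁)]
    have hneg : ∀ θ' ∈ F.Θ, θ' ≤ θ₀ → F.llrAvg θ₀ q θ' ≤ 0 := fun θ' h' hle' =>
      F.llrAvg_nonpos_of_pos hθ₀ hθ₁ h' (mul_nonneg (by linarith) (by linarith)) hpos
    refine ⟨θ, hθ, fun θ' h' => ?_, fun θ' h' => ?_⟩
    · have := hge θ hθ'
      rcases le_total θ₀ θ' with h | h
      · linarith [hs θ' h' h]
      · linarith [hle θ' h, hneg θ' h' h]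
    · rcases le_total θ₀ θ' with h | h
      · linarith [hmax θ' ⟨h', h⟩, min_le_left η (F.llrAvg θ₀ q θ₁)]
      · linarith [hneg θ' h' h]
  by_cases h2 : ∃ θ₁ ∈ F.Θ, θ₁ ≤ θ₀ ∧ 0 < F.llrAvg θ₀ p θ₁
  · obtain ⟨θ₁, hθ₁, hθ₁₀, hpos⟩ := h2
    obtain ⟨θ, ⟨hθ, hθ'⟩, hmax⟩ := F.exists_near_max (θ₀ := θ₀) (m := p) (s := t)
      (A := F.Θ ∩ Set.Iic θ₀) ⟨θ₀, hθ₀, le_refl θ₀⟩ (lt_min hη hpos)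
      (fun θ h => (hle θ h.2).trans (ht θ h.1 h.2))
    have hθ0 : 0 ≤ F.llrAvg θ₀ p θ := by
      linarith [hmax θ₁ ⟨hθ₁, hθ₁₀⟩, min_le_right η (F.llrAvg θ₀ p θ₁)]
    have hneg : ∀ θ' ∈ F.Θ, θ₀ ≤ θ' → F.llrAvg θ₀ p θ' ≤ 0 := fun θ' h' hle' =>
      F.llrAvg_nonpos_of_pos hθ₀ hθ₁ h'
        (mul_nonneg_of_nonpos_of_nonpos (by linarith) (by linarith)) hpos
    refine ⟨θ, hθ, fun θ' h' => ?_, fun θ' h' => ?_⟩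
    · rcases le_total θ₀ θ' with h | h
      · linarith [hneg θ' h' h]
      · linarith [hmax θ' ⟨h', h⟩, min_le_left η (F.llrAvg θ₀ p θ₁)]
    · have := hle θ hθ'
      rcases le_total θ₀ θ' with h | h
      · linarith [hge θ' h, hneg θ' h' h]
      · linarith [ht θ' h' h]
  push Not at h1 h2
  refine ⟨θ₀, hθ₀, fun θ' h' => ?_, fun θ' h' => ?_⟩
  · rw [h0]
    rcases le_total θ₀ θ' with h | h
    · linarith [hs θ' h' h]
    · linarith [h2 θ' h' h]
  · rw [h0]
    rcases le_total θ₀ θ' with h | h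
    · linarith [h1 θ' h' h]
    · linarith [ht θ' h' h]

/-- Decouples the two samples: the infimum over a common parameter is bounded by two one-sided
likelihood ratios against the fixed `θ₀`. The order `q ≤ p` decides on which side of `θ₀` each one
has to be taken. -/
theorem glr_le_of_forall_le {n p m q θ₀ c : ℝ} (hn : 0 < n) (hm : 0 < m) (hθ₀ : θ₀ ∈ F.Θ)
    (hpq : q ≤ p)
    (h : ∀ θ ∈ F.Θ, θ₀ ≤ θ → ∀ θ' ∈ F.Θ, θ' ≤ θ₀ →
      n * F.llrAvg θ₀ p θ + m * F.llrAvg θ₀ q θ' ≤ c) :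
    F.glr n p m q ≤ ENNReal.ofReal c := by
  have h0 : ∀ m, F.llrAvg θ₀ m θ₀ = 0 := fun m => by simp [llrAvg]
  have hc0 : 0 ≤ c := by simpa [h0] using h θ₀ hθ₀ le_rfl θ₀ hθ₀ le_rfl
  refine ENNReal.le_of_forall_pos_le_add fun ε hε _ => ?_
  have hη : 0 < (ε : ℝ) / (3 * (n + m)) := by positivity
  set η := (ε : ℝ) / (3 * (n + m)) with hηdef
  obtain ⟨θm, ⟨hθm, hθm'⟩, hmax⟩ := F.exists_near_max (θ₀ := θ₀) (m := p) (s := c / n)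
    (A := F.Θ ∩ Set.Ici θ₀) ⟨θ₀, hθ₀, le_refl θ₀⟩ hη (fun θ hθ => by
      have := h θ hθ.1 hθ.2 θ₀ hθ₀ le_rfl
      rw [h0] at this
      rw [le_div_iff₀ hn]
      linarith)
  obtain ⟨θk, ⟨hθk, hθk'⟩, hmax'⟩ := F.exists_near_max (θ₀ := θ₀) (m := q) (s := c / m)
    (A := F.Θ ∩ Set.Iic θ₀) ⟨θ₀, hθ₀, le_refl θ₀⟩ hη (fun θ hθ => by
      have := h θ₀ hθ₀ le_rfl θ hθ.1 hθ.2
      rw [h0] at this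
      rw [le_div_iff₀ hm]
      linarith)
  obtain ⟨θ, hθ, hp, hq⟩ := F.exists_common_param hθ₀ hpq hη
    (fun θ h1 h2 => hmax θ ⟨h1, h2⟩) (fun θ h1 h2 => hmax' θ ⟨h1, h2⟩)
  refine (F.glr_le_ofReal θ₀ hn.le hm.le hθ hp hq).trans ?_
  rw [← ENNReal.ofReal_coe_nnreal, ← ENNReal.ofReal_add hc0 ε.coe_nonneg]
  refine ENNReal.ofReal_le_ofReal ?_
  have h3 := h θm hθm hθm' θk hθk hθk'
  have h4 : (n + m) * η * 3 = ε := by rw [hηdef]; field_simp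
  have h5 : 0 ≤ (n + m) * η := by positivity
  nlinarith

/-- With equal averages, one near maximizer of the likelihood makes both divergences small, provided
that the likelihood is bounded. -/
theorem glr_self_eq_zero {n p m s : ℝ} (θ₀ : ℝ) (hn : 0 < n) (hm : 0 < m)
    (h : ∀ θ ∈ F.Θ, F.llrAvg θ₀ p θ ≤ s) : F.glr n p m p = 0 := by
  refine le_antisymm (ENNReal.le_of_forall_pos_le_add fun ε hε _ => ?_) zero_le
  have hη : 0 < (ε : ℝ) / (n + m) := by positivity
  obtain ⟨θ, hθ, hmax⟩ := F.exists_near_max F.nonempty_param hη h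
  refine (F.glr_le_ofReal θ₀ hn.le hm.le hθ (s := ε / (n + m)) (t := ε / (n + m))
    (fun θ' h' => by linarith [hmax θ' h']) (fun θ' h' => by linarith [hmax θ' h'])).trans ?_
  rw [zero_add, ← ENNReal.ofReal_coe_nnreal]
  refine ENNReal.ofReal_le_ofReal (le_of_eq ?_)
  field_simp

theorem continuousOn_llrAvg (θ₀ m : ℝ) : ContinuousOn (F.llrAvg θ₀ m) F.Θ := by
  have := F.continuousOn_b
  unfold llrAvg
  fun_prop

theorem exists_rat_lt_llrAvg {θ₀ m θ c : ℝ} (hθ : θ ∈ F.Θ) (hc : c < F.llrAvg θ₀ m θ)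
    {U : Set ℝ} (hU : IsOpen U) (hθU : θ ∈ U) :
    ∃ r : ℚ, (r : ℝ) ∈ F.Θ ∩ U ∧ c < F.llrAvg θ₀ m r := by
  have h1 : ∀ᶠ x in nhds θ, c < F.llrAvg θ₀ m x :=
    ((F.continuousOn_llrAvg θ₀ m).continuousAt (F.isOpen_param.mem_nhds hθ)).eventually_const_lt hc
  have h2 : ∀ᶠ x in nhds θ, x ∈ F.Θ ∩ U := (F.isOpen_param.inter hU).mem_nhds ⟨hθ, hθU⟩
  obtain ⟨r, hr1, hr2⟩ := (Rat.denseRange_cast (𝕜 := ℝ)).exists_mem_open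
    (s := interior {x | c < F.llrAvg θ₀ m x ∧ x ∈ F.Θ ∩ U}) isOpen_interior
    ⟨θ, mem_interior_iff_mem_nhds.2 (h1.and h2)⟩ |>.imp fun r hr => interior_subset hr
  exact ⟨r, hr2, hr1⟩

/-- For `θ < θ'`, an observation from `θ` exceeds one from `θ'` with probability at most `1/2`. -/
theorem measure_prod_lt_le {θ θ' : ℝ} (h : θ ∈ F.Θ) (h' : θ' ∈ F.Θ) (hlt : θ < θ') :
    ((F.dist θ).prod (F.dist θ')) {p | p.2 < p.1} ≤ ENNReal.ofReal (1 / 2) := by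
  have := F.isProbabilityMeasure_dist h
  have := F.isProbabilityMeasure_dist h'
  -- The density of `θ'` against `θ` is increasing. Under two copies of `θ`, exchanging the
  -- coordinates on `p.2 < p.1` increases the density of the second one, so the reverse strict order
  -- is at least as likely.
  set g : ℝ → ℝ≥0∞ := fun x => ENNReal.ofReal (Real.exp ((θ' - θ) * x - (F.b θ' - F.b θ))) with hg
  have hgm : Measurable g := by fun_prop
  have hmono : Monotone g := fun x y hxy => by
    refine ENNReal.ofReal_le_ofReal (Real.exp_le_exp.2 ?_)
    have := mul_le_mul_of_nonneg_left hxy (sub_nonneg.2 hlt.le)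
    linarith
  have hlt_meas : MeasurableSet {p : ℝ × ℝ | p.2 < p.1} :=
    measurableSet_lt measurable_snd measurable_fst
  have hgt_meas : MeasurableSet {p : ℝ × ℝ | p.1 < p.2} :=
    measurableSet_lt measurable_fst measurable_snd
  have hval : ∀ s : Set (ℝ × ℝ), MeasurableSet s → ((F.dist θ).prod (F.dist θ')) s
      = ∫⁻ p, s.indicator 1 p * g p.2 ∂((F.dist θ).prod (F.dist θ)) := by
    intro s hs
    rw [F.dist_eq_withDensity θ θ', prod_withDensity_right₀ (by fun_prop),
      withDensity_apply _ hs, ← lintegral_indicator hs]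
    refine lintegral_congr fun p => ?_
    by_cases hp : p ∈ s <;> simp [hp, hg]
  have h1 : ((F.dist θ).prod (F.dist θ')) {p | p.2 < p.1}
      ≤ ((F.dist θ).prod (F.dist θ')) {p | p.1 < p.2} := by
    rw [hval _ hlt_meas, hval _ hgt_meas,
      ← lintegral_prod_swap (fun p => {p : ℝ × ℝ | p.1 < p.2}.indicator 1 p * g p.2)]
    refine lintegral_mono fun p => ?_
    by_cases hp : p.2 < p.1
    · simp [hp, hmono hp.le]
    · simp [hp]
  have h2 : ((F.dist θ).prod (F.dist θ')) {p | p.2 < p.1}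
      + ((F.dist θ).prod (F.dist θ')) {p | p.1 < p.2} ≤ 1 := by
    have hd : Disjoint {p : ℝ × ℝ | p.2 < p.1} {p : ℝ × ℝ | p.1 < p.2} :=
      Set.disjoint_left.2 fun p hp hp' => lt_asymm (show p.2 < p.1 from hp) hp'
    rw [← measure_union hd hgt_meas]
    exact prob_le_one
  have h3 : 2 * ((F.dist θ).prod (F.dist θ')) {p | p.2 < p.1} ≤ 1 := by
    rw [two_mul]
    exact (add_le_add le_rfl h1).trans h2
  rw [show ENNReal.ofReal (1 / 2) = 2⁻¹ by
    rw [one_div, ENNReal.ofReal_inv_of_pos (by norm_num)]; norm_num]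
  rwa [ENNReal.le_inv_iff_mul_le, mul_comm]

end ExpFamily

/-! ### Coupling with independent stacks of rewards -/

/-- Write `x` at position `k` of a stack. -/
def putAt {T : ℕ} (k : ℕ) (x : ℝ) (u : Fin T → ℝ) : Fin T → ℝ :=
  fun j => if (j : ℕ) = k then x else u j

/-- The first `n` entries of `r`, followed by the remaining entries of `u`. -/
def splice {T : ℕ} (n : ℕ) (r u : Fin T → ℝ) : Fin T → ℝ :=
  fun j => if (j : ℕ) < n then r j else u j

/-- The key to the coupling: recording a new reward has the same effect as overwriting one entry of
the completing stack. -/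
theorem splice_succ_putAt {T : ℕ} (n : ℕ) (x : ℝ) (r u : Fin T → ℝ) :
    splice (n + 1) (putAt n x r) u = splice n r (putAt n x u) := by
  funext j
  simp only [splice, putAt]
  split_ifs <;> first | rfl | omega

theorem measurable_putAt {T : ℕ} {α : Type*} [MeasurableSpace α] {n : α → ℕ} {x : α → ℝ}
    {u : α → Fin T → ℝ} (hn : Measurable n) (hx : Measurable x) (hu : Measurable u) :
    Measurable fun a => putAt (n a) (x a) (u a) := by
  refine measurable_pi_iff.2 fun j => Measurable.ite ?_ hx ((measurable_pi_apply j).comp hu)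
  exact hn (measurableSet_eq (a := (j : ℕ)) |>.congr (by ext; simp [eq_comm]) :
    MeasurableSet {k : ℕ | (j : ℕ) = k})

theorem measurable_splice {T : ℕ} {α : Type*} [MeasurableSpace α] {n : α → ℕ}
    {r u : α → Fin T → ℝ} (hn : Measurable n) (hr : Measurable r) (hu : Measurable u) :
    Measurable fun a => splice (n a) (r a) (u a) := by
  refine measurable_pi_iff.2 fun j => Measurable.ite ?_ ((measurable_pi_apply j).comp hr)
    ((measurable_pi_apply j).comp hu)
  exact hn (MeasurableSet.of_discrete : MeasurableSet {k : ℕ | (j : ℕ) < k})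

/-- Overwriting one coordinate by an independent draw of the same law preserves an i.i.d. stack. For
`k ≥ T` nothing is overwritten. -/
theorem lintegral_putAt {T : ℕ} (μ : Measure ℝ) [IsProbabilityMeasure μ] (k : ℕ)
    {f : (Fin T → ℝ) → ℝ≥0∞} (hf : Measurable f) :
    ∫⁻ x, ∫⁻ u, f (putAt k x u) ∂(Measure.pi fun _ : Fin T => μ) ∂μ
      = ∫⁻ u, f u ∂(Measure.pi fun _ : Fin T => μ) := by
  induction T generalizing k with
  | zero =>
    have : ∀ x (u : Fin 0 → ℝ), putAt k x u = u := fun x u => Subsingleton.elim _ _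
    simp [this]
  | succ T ih =>
    have hput : ∀ x, Measurable fun u : Fin (T + 1) → ℝ => f (putAt k x u) := fun x =>
      hf.comp (measurable_putAt measurable_const measurable_const measurable_id)
    have hc := measurable_finCons (T := T)
    rw [lintegral_pi_succ μ hf]
    simp_rw [fun x => lintegral_pi_succ μ (hput x)]
    cases k with
    | zero =>
      have h : ∀ x y (u : Fin T → ℝ), putAt 0 x (Fin.cons y u : Fin (T + 1) → ℝ)
          = Fin.cons x u := by
        intro x y u
        funext j
        refine Fin.cases ?_ (fun j => ?_) j <;> simp [putAt]
      simp [h]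
    | succ k =>
      have h : ∀ x y (u : Fin T → ℝ), putAt (k + 1) x (Fin.cons y u : Fin (T + 1) → ℝ)
          = Fin.cons y (putAt k x u) := by
        intro x y u
        funext j
        refine Fin.cases ?_ (fun j => ?_) j <;> simp [putAt]
      simp only [h]
      rw [lintegral_lintegral_swap]
      · refine lintegral_congr fun y => ?_
        exact ih k (f := fun u => f (Fin.cons y u)) (hf.comp (hc.comp measurable_prodMk_left))
      · refine Measurable.aemeasurable ?_
        refine Measurable.lintegral_prod_right' (f := fun q : (ℝ × ℝ) × (Fin T → ℝ) =>
          f (Fin.cons q.1.2 (putAt k q.1.1 q.2))) ?_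
        exact hf.comp (hc.comp ((measurable_snd.comp measurable_fst).prodMk
          (measurable_putAt measurable_const (measurable_fst.comp measurable_fst)
            measurable_snd)))

/-! ### Recorded rewards and their completion -/

section Records

variable {K : ℕ}

theorem pulls_self (arm : ℕ → Fin K) (a : Fin K) (m : ℕ) : pulls arm a m m = 0 := by
  simp [pulls]

theorem pulls_succ (arm : ℕ → Fin K) (a : Fin K) {m t : ℕ} (h : m ≤ t) :
    pulls arm a m (t + 1) = pulls arm a m t + if arm t = a then 1 else 0 := by
  unfold pulls
  rw [← Finset.insert_Ico_right_eq_Ico_add_one h, Finset.filter_insert]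
  split_ifs with hc
  · rw [Finset.card_insert_of_notMem (by simp)]
  · simp

theorem pulls_mono (arm : ℕ → Fin K) (a : Fin K) (m : ℕ) {s t : ℕ} (h : s ≤ t) :
    pulls arm a m s ≤ pulls arm a m t :=
  Finset.card_le_card (Finset.filter_subset_filter _ (Finset.Ico_subset_Ico_right h))

theorem pulls_le (arm : ℕ → Fin K) (a : Fin K) (m t : ℕ) : pulls arm a m t ≤ t - m :=
  (Finset.card_filter_le _ _).trans_eq (Nat.card_Ico m t)

theorem pulls_add (arm : ℕ → Fin K) (a : Fin K) {l m n : ℕ} (h : l ≤ m) (h' : m ≤ n) :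
    pulls arm a l m + pulls arm a m n = pulls arm a l n := by
  induction n, h' using Nat.le_induction with
  | base => simp [pulls_self]
  | succ n hn ih => rw [pulls_succ _ _ hn, pulls_succ _ _ (h.trans hn), ← ih, add_assoc]

/-- The rewards of arm `a` during the first `t` samples, in order. -/
def record (T : ℕ) (arm : ℕ → Fin K) (reward : ℕ → ℝ) (a : Fin K) : ℕ → Fin T → ℝ
  | 0 => 0
  | t + 1 => if arm t = a then putAt (pulls arm a 0 t) (reward t) (record T arm reward a t)
      else record T arm reward a t

theorem record_apply_of_le {T : ℕ} (arm : ℕ → Fin K) (reward : ℕ → ℝ) (a : Fin K) {s t : ℕ}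
    (hst : s ≤ t) {j : Fin T} (hj : (j : ℕ) < pulls arm a 0 s) :
    record T arm reward a t j = record T arm reward a s j := by
  induction t, hst using Nat.le_induction with
  | base => rfl
  | succ t hst ih =>
    rw [record]
    split_ifs with h
    · rw [putAt, if_neg, ih]
      have := pulls_mono arm a 0 hst
      omega
    · exact ih

theorem prefixSum_congr {T : ℕ} {n : ℕ} {u v : Fin T → ℝ}
    (h : ∀ j : Fin T, (j : ℕ) < n → u j = v j) :
    prefixSum n u = prefixSum n v := by
  refine Finset.sum_congr rfl fun j _ => ?_
  split_ifs with hj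
  · exact h j hj
  · rfl

theorem prefixSum_succ {T : ℕ} {n : ℕ} (hn : n < T) (u : Fin T → ℝ) :
    prefixSum (n + 1) u = prefixSum n u + u ⟨n, hn⟩ := by
  have : u ⟨n, hn⟩ = ∑ j : Fin T, if j = ⟨n, hn⟩ then u j else 0 := by simp
  rw [this, prefixSum, prefixSum, ← Finset.sum_add_distrib]
  refine Finset.sum_congr rfl fun j _ => ?_
  simp only [Fin.ext_iff]
  split_ifs <;> first | omega | simp

theorem prefixSum_record {T : ℕ} (arm : ℕ → Fin K) (reward : ℕ → ℝ) (a : Fin K) {t : ℕ}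
    (ht : t ≤ T) : prefixSum (pulls arm a 0 t) (record T arm reward a t)
      = ∑ l ∈ (Finset.range t).filter (fun l => arm l = a), reward l := by
  induction t with
  | zero => simp [pulls_self]
  | succ t ih =>
    have hlt : pulls arm a 0 t < T := (pulls_le arm a 0 t).trans_lt (by omega)
    rw [pulls_succ _ _ (Nat.zero_le t), Finset.range_add_one, Finset.filter_insert, record]
    split_ifs with h
    · rw [prefixSum_succ hlt, Finset.sum_insert (by simp), ← ih (by omega), add_comm]
      congr 1
      · simp [putAt]
      · refine prefixSum_congr fun j hj => ?_
        rw [putAt, if_neg (by omega)]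
    · rw [add_zero, ih (by omega)]

/-- The completion `u` only fills entries beyond the recorded ones, so the completed stack
reproduces the partial sums at all earlier times, whatever `u` is. -/
theorem prefixSum_splice_record {T : ℕ} (arm : ℕ → Fin K) (reward : ℕ → ℝ) (a : Fin K) {s t : ℕ}
    (hst : s ≤ t) (ht : t ≤ T) (u : Fin T → ℝ) :
    prefixSum (pulls arm a 0 s) (splice (pulls arm a 0 t) (record T arm reward a t) u)
      = ∑ l ∈ (Finset.range s).filter (fun l => arm l = a), reward l := by
  rw [← prefixSum_record arm reward a (hst.trans ht)]
  refine prefixSum_congr fun j hj => ?_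
  rw [splice, if_pos (hj.trans_le (pulls_mono arm a 0 hst)), record_apply_of_le arm reward a hst hj]

end Records

namespace IsBanditProcess

variable {Ω : Type*} [mΩ : MeasurableSpace Ω] {P : Measure Ω}
  {F : ExpFamily} {K : ℕ} {θ : Fin K → ℝ} {ℱ : Filtration ℕ mΩ} {A : ℕ → Ω → Fin K}
  {X : ℕ → Ω → ℝ}

theorem measurable_pulls (h : IsBanditProcess P F θ ℱ A X) (a : Fin K) (t : ℕ) :
    Measurable[ℱ t] fun ω => pulls (fun l => A l ω) a 0 t := by
  induction t with
  | zero => simp only [pulls_self]; exact measurable_const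
  | succ t ih =>
    simp only [pulls_succ _ _ (Nat.zero_le t)]
    refine Measurable.add (ih.mono (ℱ.mono t.le_succ) le_rfl) ?_
    exact Measurable.ite (((h.measurable_arm t).mono (ℱ.mono t.le_succ) le_rfl)
      (measurableSet_singleton a)) measurable_const measurable_const

theorem measurable_record (h : IsBanditProcess P F θ ℱ A X) (T : ℕ) (a : Fin K) (c : ℝ) (t : ℕ) :
    Measurable[ℱ t] fun ω => record T (fun l => A l ω) (fun l => c * X l ω) a t := by
  induction t with
  | zero => exact measurable_const
  | succ t ih =>
    have ih' := ih.mono (ℱ.mono t.le_succ) le_rfl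
    simp only [record]
    refine Measurable.ite (((h.measurable_arm t).mono (ℱ.mono t.le_succ) le_rfl)
      (measurableSet_singleton a)) ?_ ih'
    exact @measurable_putAt T Ω (ℱ (t + 1)) _ _ _
      ((h.measurable_pulls a t).mono (ℱ.mono t.le_succ) le_rfl)
      ((h.measurable_reward t).const_mul c) ih'

variable [IsProbabilityMeasure P]

/-- The next reward of arm `a` is independent of the past. -/
theorem lintegral_next (h : IsBanditProcess P F θ ℱ A X) (hθ : ∀ a, θ a ∈ F.Θ) {S : Type*}
    [MeasurableSpace S] (n : ℕ) (a : Fin K) {σ : Ω → S} (hσ : Measurable[ℱ n] σ)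
    {f : S × ℝ → ℝ≥0∞} (hf : Measurable f) :
    ∫⁻ ω in {ω | A n ω = a}, f (σ ω, X n ω) ∂P
      = ∫⁻ ω in {ω | A n ω = a}, ∫⁻ x, f (σ ω, x) ∂(F.dist (θ a)) ∂P := by
  have := F.isProbabilityMeasure_dist (hθ a)
  have hσ' : Measurable σ := hσ.mono (ℱ.le n) le_rfl
  have hX : Measurable (X n) := (h.measurable_reward n).mono (ℱ.le _) le_rfl
  have hAn : MeasurableSet[ℱ n] {ω | A n ω = a} := h.measurable_arm n (measurableSet_singleton a)
  -- On the event that arm `a` is chosen, the conditional law of the reward is constant. Checking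
  -- rectangles shows that past and reward have a product law.
  have hprod : (P.restrict {ω | A n ω = a}).map (fun ω => (σ ω, X n ω))
      = ((P.restrict {ω | A n ω = a}).map σ).prod (F.dist (θ a)) := by
    symm
    refine Measure.prod_eq fun s t hs ht => ?_
    rw [Measure.map_apply (hσ'.prodMk hX) (hs.prod ht), Measure.map_apply hσ' hs]
    set E := {ω | A n ω = a} ∩ σ ⁻¹' s with hE
    have hEm : MeasurableSet[ℱ n] E := hAn.inter (hσ hs)
    have hEm' : MeasurableSet E := ℱ.le n _ hEm
    have e1 : P.restrict {ω | A n ω = a} ((fun ω => (σ ω, X n ω)) ⁻¹' s ×ˢ t)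
        = P (E ∩ X n ⁻¹' t) := by
      rw [Measure.restrict_apply ((hσ'.prodMk hX) (hs.prod ht))]
      congr 1
      ext ω
      simp [hE]
      tauto
    have e2 : P.restrict {ω | A n ω = a} (σ ⁻¹' s) = P E := by
      rw [Measure.restrict_apply (hσ' hs), Set.inter_comm]
    rw [e1, e2]
    have hi : Integrable ((X n ⁻¹' t).indicator fun _ => (1 : ℝ)) P :=
      (integrable_const 1).indicator (hX ht)
    have h1 := setIntegral_condExp (ℱ.le n) hi hEm
    have h2 : ∫ ω in E, (P[(X n ⁻¹' t).indicator (fun _ => (1 : ℝ)) | ℱ n]) ω ∂P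
        = ∫ ω in E, (F.dist (θ a)).real t ∂P := by
      refine setIntegral_congr_ae hEm' ?_
      filter_upwards [h.reward_law n t ht] with ω hω hωE
      rw [hω, show A n ω = a from hωE.1]
    rw [h2, setIntegral_const, setIntegral_indicator (hX ht), setIntegral_const, smul_eq_mul,
      smul_eq_mul, mul_one] at h1
    have h3 := congrArg ENNReal.ofReal h1
    rw [ENNReal.ofReal_mul measureReal_nonneg, ofReal_measureReal, ofReal_measureReal,
      ofReal_measureReal] at h3
    exact h3.symm
  have h1 : ∫⁻ ω in {ω | A n ω = a}, f (σ ω, X n ω) ∂P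
      = ∫⁻ p, f p ∂((P.restrict {ω | A n ω = a}).map (fun ω => (σ ω, X n ω))) :=
    (lintegral_map hf (hσ'.prodMk hX)).symm
  rw [h1, hprod, lintegral_prod _ hf.aemeasurable,
    lintegral_map hf.lintegral_prod_right' hσ']

end IsBanditProcess

theorem lintegral_prod_putAt_fst {T : ℕ} (μ ν : Measure ℝ) [IsProbabilityMeasure μ]
    [IsProbabilityMeasure ν] (k : ℕ) {g : (Fin T → ℝ) × (Fin T → ℝ) → ℝ≥0∞} (hg : Measurable g) :
    ∫⁻ x, ∫⁻ p, g (putAt k x p.1, p.2)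
        ∂((Measure.pi fun _ : Fin T => μ).prod (Measure.pi fun _ : Fin T => ν)) ∂μ
      = ∫⁻ p, g p ∂((Measure.pi fun _ : Fin T => μ).prod (Measure.pi fun _ : Fin T => ν)) := by
  have h1 : ∀ x, ∫⁻ p, g (putAt k x p.1, p.2)
      ∂((Measure.pi fun _ : Fin T => μ).prod (Measure.pi fun _ : Fin T => ν))
      = ∫⁻ u, ∫⁻ v, g (putAt k x u, v) ∂(Measure.pi fun _ : Fin T => ν)
        ∂(Measure.pi fun _ : Fin T => μ) := fun x => by
    refine lintegral_prod (fun p : (Fin T → ℝ) × (Fin T → ℝ) => g (putAt k x p.1, p.2)) ?_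
    exact (hg.comp ((measurable_putAt measurable_const measurable_const measurable_fst).prodMk
      measurable_snd)).aemeasurable
  simp_rw [h1]
  rw [lintegral_prod _ hg.aemeasurable]
  exact lintegral_putAt μ k hg.lintegral_prod_right'

theorem lintegral_prod_putAt_snd {T : ℕ} (μ ν : Measure ℝ) [IsProbabilityMeasure μ]
    [IsProbabilityMeasure ν] (k : ℕ) {g : (Fin T → ℝ) × (Fin T → ℝ) → ℝ≥0∞} (hg : Measurable g) :
    ∫⁻ x, ∫⁻ p, g (p.1, putAt k x p.2)
        ∂((Measure.pi fun _ : Fin T => μ).prod (Measure.pi fun _ : Fin T => ν)) ∂ν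
      = ∫⁻ p, g p ∂((Measure.pi fun _ : Fin T => μ).prod (Measure.pi fun _ : Fin T => ν)) := by
  have h := lintegral_prod_putAt_fst ν μ k (hg.comp measurable_swap)
  rw [← lintegral_prod_swap g]
  refine Eq.trans (lintegral_congr fun x => ?_) h
  exact (lintegral_prod_swap _).symm

namespace IsBanditProcess

variable {Ω : Type*} [mΩ : MeasurableSpace Ω] {P : Measure Ω}
  {F : ExpFamily} {K : ℕ} {θ : Fin K → ℝ} {ℱ : Filtration ℕ mΩ} {A : ℕ → Ω → Fin K}
  {X : ℕ → Ω → ℝ}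

theorem measurable_records (h : IsBanditProcess P F θ ℱ A X) (T : ℕ) (i j : Fin K) (c d : ℝ)
    (t : ℕ) : Measurable[ℱ t] fun ω =>
      ((pulls (fun l => A l ω) i 0 t, record T (fun l => A l ω) (fun l => c * X l ω) i t),
        (pulls (fun l => A l ω) j 0 t, record T (fun l => A l ω) (fun l => d * X l ω) j t)) :=
  ((h.measurable_pulls i t).prodMk (h.measurable_record T i c t)).prodMk
    ((h.measurable_pulls j t).prodMk (h.measurable_record T j d t))

variable [IsProbabilityMeasure P]

/-- Completing the recorded rewards of two arms by independent stacks of rewards produces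
independent stacks of rewards. -/
theorem lintegral_splice (h : IsBanditProcess P F θ ℱ A X) (hθ : ∀ a, θ a ∈ F.Θ) (T : ℕ)
    {i j : Fin K} (hij : i ≠ j) (c d : ℝ) {μ ν : Measure ℝ} [IsProbabilityMeasure μ]
    [IsProbabilityMeasure ν] (hμ : μ = (F.dist (θ i)).map (fun x => c * x))
    (hν : ν = (F.dist (θ j)).map (fun x => d * x))
    {f : (Fin T → ℝ) × (Fin T → ℝ) → ℝ≥0∞} (hf : Measurable f) (t : ℕ) :
    ∫⁻ ω, ∫⁻ p, f (splice (pulls (fun l => A l ω) i 0 t)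
          (record T (fun l => A l ω) (fun l => c * X l ω) i t) p.1,
        splice (pulls (fun l => A l ω) j 0 t)
          (record T (fun l => A l ω) (fun l => d * X l ω) j t) p.2)
        ∂((Measure.pi fun _ : Fin T => μ).prod (Measure.pi fun _ : Fin T => ν)) ∂P
      = ∫⁻ p, f p ∂((Measure.pi fun _ : Fin T => μ).prod (Measure.pi fun _ : Fin T => ν)) := by
  set κ := (Measure.pi fun _ : Fin T => μ).prod (Measure.pi fun _ : Fin T => ν) with hκ
  -- One step reveals a reward of at most one of the two arms. It becomes an overwritten entry of
  -- that completing stack, `lintegral_next` replaces it by a fresh draw, and overwriting by a fresh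
  -- draw leaves the law unchanged.
  induction t with
  | zero =>
    have : ∀ r u : Fin T → ℝ, splice 0 r u = u := fun r u => by funext k; simp [splice]
    simp [pulls_self, this]
  | succ t ih =>
    rw [← ih]
    set σ : Ω → (ℕ × (Fin T → ℝ)) × (ℕ × (Fin T → ℝ)) := fun ω =>
      ((pulls (fun l => A l ω) i 0 t, record T (fun l => A l ω) (fun l => c * X l ω) i t),
        (pulls (fun l => A l ω) j 0 t, record T (fun l => A l ω) (fun l => d * X l ω) j t)) with hσ
    have hσm : Measurable[ℱ t] σ := h.measurable_records T i j c d t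
    have hA : ∀ a, MeasurableSet {ω | A t ω = a} := fun a =>
      ℱ.le t _ (h.measurable_arm t (measurableSet_singleton a))
    have hsplit : ∀ g : Ω → ℝ≥0∞, ∫⁻ ω, g ω ∂P = ∑ a, ∫⁻ ω in {ω | A t ω = a}, g ω ∂P := by
      intro g
      have hu : ⋃ a, {ω | A t ω = a} = Set.univ := by ext ω; simp
      rw [← setLIntegral_univ, ← hu, lintegral_iUnion hA
        (fun a b hab => Set.disjoint_left.2 fun ω (h1 : A t ω = a) (h2 : A t ω = b) =>
          hab (h1.symm.trans h2)), tsum_fintype]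
    rw [hsplit, hsplit]
    refine Finset.sum_congr rfl fun a _ => ?_
    have hfs : Measurable fun q : (((ℕ × (Fin T → ℝ)) × (ℕ × (Fin T → ℝ))) × ℝ) ×
        ((Fin T → ℝ) × (Fin T → ℝ)) => f (splice q.1.1.1.1 q.1.1.1.2 (putAt q.1.1.1.1 (c * q.1.2)
          q.2.1), splice q.1.1.2.1 q.1.1.2.2 q.2.2) := by
      refine hf.comp (Measurable.prodMk ?_ ?_)
      · exact measurable_splice (by fun_prop) (by fun_prop)
          (measurable_putAt (by fun_prop) (by fun_prop) (by fun_prop))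
      · exact measurable_splice (by fun_prop) (by fun_prop) (by fun_prop)
    have hfs' : Measurable fun q : (((ℕ × (Fin T → ℝ)) × (ℕ × (Fin T → ℝ))) × ℝ) ×
        ((Fin T → ℝ) × (Fin T → ℝ)) => f (splice q.1.1.1.1 q.1.1.1.2 q.2.1,
          splice q.1.1.2.1 q.1.1.2.2 (putAt q.1.1.2.1 (d * q.1.2) q.2.2)) := by
      refine hf.comp (Measurable.prodMk ?_ ?_)
      · exact measurable_splice (by fun_prop) (by fun_prop) (by fun_prop)
      · exact measurable_splice (by fun_prop) (by fun_prop)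
          (measurable_putAt (by fun_prop) (by fun_prop) (by fun_prop))
    have hfp : ∀ s : (ℕ × (Fin T → ℝ)) × (ℕ × (Fin T → ℝ)),
        Measurable fun p : (Fin T → ℝ) × (Fin T → ℝ) =>
          f (splice s.1.1 s.1.2 p.1, splice s.2.1 s.2.2 p.2) := fun s =>
      hf.comp ((measurable_splice measurable_const measurable_const measurable_fst).prodMk
        (measurable_splice measurable_const measurable_const measurable_snd))
    by_cases hi : a = i
    · subst hi
      have e1 : ∫⁻ ω in {ω | A t ω = a}, ∫⁻ p, f (splice (pulls (fun l => A l ω) a 0 (t + 1))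
          (record T (fun l => A l ω) (fun l => c * X l ω) a (t + 1)) p.1,
          splice (pulls (fun l => A l ω) j 0 (t + 1))
          (record T (fun l => A l ω) (fun l => d * X l ω) j (t + 1)) p.2) ∂κ ∂P
          = ∫⁻ ω in {ω | A t ω = a}, (fun q => ∫⁻ p, f (splice q.1.1.1 q.1.1.2
            (putAt q.1.1.1 (c * q.2) p.1), splice q.1.2.1 q.1.2.2 p.2) ∂κ) (σ ω, X t ω) ∂P := by
        refine setLIntegral_congr_fun (hA a) fun ω hω => ?_
        have hω' : A t ω = a := hω
        simp only [record, pulls_succ _ _ (Nat.zero_le t), hω', if_true, if_neg hij, add_zero,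
          splice_succ_putAt, hσ]
      rw [e1, h.lintegral_next hθ t a hσm hfs.lintegral_prod_right']
      refine lintegral_congr fun ω => ?_
      have h2 := lintegral_prod_putAt_fst μ ν (σ ω).1.1 (hfp (σ ω))
      rw [← hκ] at h2
      refine Eq.trans ?_ h2
      have hm : Measurable fun x => ∫⁻ p, f (splice (σ ω).1.1 (σ ω).1.2
          (putAt (σ ω).1.1 x p.1), splice (σ ω).2.1 (σ ω).2.2 p.2) ∂κ := by
        refine Measurable.lintegral_prod_right' (f := fun q : ℝ × ((Fin T → ℝ) × (Fin T → ℝ)) =>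
          f (splice (σ ω).1.1 (σ ω).1.2 (putAt (σ ω).1.1 q.1 q.2.1),
            splice (σ ω).2.1 (σ ω).2.2 q.2.2)) (hf.comp (Measurable.prodMk ?_ ?_))
        · exact measurable_splice (by fun_prop) (by fun_prop)
            (measurable_putAt (by fun_prop) (by fun_prop) (by fun_prop))
        · exact measurable_splice (by fun_prop) (by fun_prop) (by fun_prop)
      conv_rhs => rw [hμ]
      exact (lintegral_map hm (by fun_prop)).symm
    by_cases hj : a = j
    · subst hj
      have e1 : ∫⁻ ω in {ω | A t ω = a}, ∫⁻ p, f (splice (pulls (fun l => A l ω) i 0 (t + 1))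
          (record T (fun l => A l ω) (fun l => c * X l ω) i (t + 1)) p.1,
          splice (pulls (fun l => A l ω) a 0 (t + 1))
          (record T (fun l => A l ω) (fun l => d * X l ω) a (t + 1)) p.2) ∂κ ∂P
          = ∫⁻ ω in {ω | A t ω = a}, (fun q => ∫⁻ p, f (splice q.1.1.1 q.1.1.2 p.1,
            splice q.1.2.1 q.1.2.2 (putAt q.1.2.1 (d * q.2) p.2)) ∂κ) (σ ω, X t ω) ∂P := by
        refine setLIntegral_congr_fun (hA a) fun ω hω => ?_
        have hω' : A t ω = a := hω
        simp only [record, pulls_succ _ _ (Nat.zero_le t), hω', if_true, if_neg hi, add_zero,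
          splice_succ_putAt, hσ]
      rw [e1, h.lintegral_next hθ t a hσm hfs'.lintegral_prod_right']
      refine lintegral_congr fun ω => ?_
      have h2 := lintegral_prod_putAt_snd μ ν (σ ω).2.1 (hfp (σ ω))
      rw [← hκ] at h2
      refine Eq.trans ?_ h2
      have hm : Measurable fun x => ∫⁻ p, f (splice (σ ω).1.1 (σ ω).1.2 p.1,
          splice (σ ω).2.1 (σ ω).2.2 (putAt (σ ω).2.1 x p.2)) ∂κ := by
        refine Measurable.lintegral_prod_right' (f := fun q : ℝ × ((Fin T → ℝ) × (Fin T → ℝ)) =>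
          f (splice (σ ω).1.1 (σ ω).1.2 q.2.1,
            splice (σ ω).2.1 (σ ω).2.2 (putAt (σ ω).2.1 q.1 q.2.2)))
            (hf.comp (Measurable.prodMk ?_ ?_))
        · exact measurable_splice (by fun_prop) (by fun_prop) (by fun_prop)
        · exact measurable_splice (by fun_prop) (by fun_prop)
            (measurable_putAt (by fun_prop) (by fun_prop) (by fun_prop))
      conv_rhs => rw [hν]
      exact (lintegral_map hm (by fun_prop)).symm
    · refine setLIntegral_congr_fun (hA a) fun ω hω => ?_
      have hω' : A t ω = a := hω
      simp only [record, pulls_succ _ _ (Nat.zero_le t), hω', if_neg hi, if_neg hj, add_zero]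

/-- A bound on the probability of an event that forces the completed stacks to lie in `E`. -/
theorem measure_le_of_splice_mem (h : IsBanditProcess P F θ ℱ A X) (hθ : ∀ a, θ a ∈ F.Θ) (T : ℕ)
    {i j : Fin K} (hij : i ≠ j) (c d : ℝ) {μ ν : Measure ℝ} [IsProbabilityMeasure μ]
    [IsProbabilityMeasure ν] (hμ : μ = (F.dist (θ i)).map (fun x => c * x))
    (hν : ν = (F.dist (θ j)).map (fun x => d * x))
    {E : Set ((Fin T → ℝ) × (Fin T → ℝ))} (hE : MeasurableSet E) (t : ℕ) {G : Set Ω}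
    (hG : ∀ᵐ ω ∂P, ω ∈ G → ∀ p : (Fin T → ℝ) × (Fin T → ℝ),
      (splice (pulls (fun l => A l ω) i 0 t)
          (record T (fun l => A l ω) (fun l => c * X l ω) i t) p.1,
        splice (pulls (fun l => A l ω) j 0 t)
          (record T (fun l => A l ω) (fun l => d * X l ω) j t) p.2) ∈ E) :
    P G ≤ ((Measure.pi fun _ : Fin T => μ).prod (Measure.pi fun _ : Fin T => ν)) E := by
  rw [← lintegral_indicator_one hE, ← h.lintegral_splice hθ T hij c d hμ hν
    (measurable_one.indicator hE) t]
  have hsub : G ≤ᵐ[P] {ω | ∀ p : (Fin T → ℝ) × (Fin T → ℝ),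
      (splice (pulls (fun l => A l ω) i 0 t)
          (record T (fun l => A l ω) (fun l => c * X l ω) i t) p.1,
        splice (pulls (fun l => A l ω) j 0 t)
          (record T (fun l => A l ω) (fun l => d * X l ω) j t) p.2) ∈ E} := hG
  -- The bound by an integral needs no measurability of `G`. This matters because the output `istar`
  -- is an arbitrary function of `ω`.
  refine (measure_mono_ae hsub).trans (meas_le_lintegral₀ ?_ fun ω hω => ?_)
  · refine Measurable.aemeasurable ?_
    refine Measurable.comp (g := fun s : (ℕ × (Fin T → ℝ)) × (ℕ × (Fin T → ℝ)) =>
      ∫⁻ p, E.indicator 1 (splice s.1.1 s.1.2 p.1, splice s.2.1 s.2.2 p.2)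
        ∂((Measure.pi fun _ : Fin T => μ).prod (Measure.pi fun _ : Fin T => ν))) ?_
      ((h.measurable_records T i j c d t).mono (ℱ.le t) le_rfl)
    refine Measurable.lintegral_prod_right' (f := fun q : ((ℕ × (Fin T → ℝ)) × (ℕ × (Fin T → ℝ))) ×
      ((Fin T → ℝ) × (Fin T → ℝ)) => E.indicator (1 : (Fin T → ℝ) × (Fin T → ℝ) → ℝ≥0∞)
        (splice q.1.1.1 q.1.1.2 q.2.1, splice q.1.2.1 q.1.2.2 q.2.2))
      ((measurable_one.indicator hE).comp (Measurable.prodMk ?_ ?_))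
    · exact measurable_splice (by fun_prop) (by fun_prop) (by fun_prop)
    · exact measurable_splice (by fun_prop) (by fun_prop) (by fun_prop)
  · have hω' : ∀ p : (Fin T → ℝ) × (Fin T → ℝ), _ := hω
    simp only [Set.indicator_of_mem (hω' _), Pi.one_apply, lintegral_one, measure_univ, le_refl]

end IsBanditProcess

/-! ### From the GLR statistic to exponential statistics with rational parameters -/

namespace ExpFamily

variable (F : ExpFamily)

open scoped Classical in
/-- The first exponents in an enumeration of the differences `c * (r - θ₀) ≥ 0` with rational
parameters `r` of the family, together with `0`. -/
noncomputable def exponents (e : ℕ → ℚ) (θ₀ c : ℝ) (j : ℕ) : Finset ℝ :=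
  insert 0 (((Finset.range j).image fun k => c * ((e k : ℝ) - θ₀)).filter
    fun l => 0 ≤ l ∧ θ₀ + c * l ∈ F.Θ)

variable {F} in
theorem mem_exponents {e : ℕ → ℚ} {θ₀ c l : ℝ} {j : ℕ} : l ∈ F.exponents e θ₀ c j ↔
    l = 0 ∨ (∃ k, k < j ∧ c * ((e k : ℝ) - θ₀) = l) ∧ 0 ≤ l ∧ θ₀ + c * l ∈ F.Θ := by
  simp [exponents]

/-- The cumulant generating function of `c * X` under the parameter `θ₀`. -/
noncomputable def cumulant (θ₀ c l : ℝ) : ℝ := F.b (θ₀ + c * l) - F.b θ₀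

/-- The reference `θ₀` need not be the true parameter `θ`: it suffices that its cumulant function
dominates the true one on the exponents in use. The sign `c` selects the side of `θ₀`. -/
theorem isCumulantBound {θ θ₀ c : ℝ} (hθ : θ ∈ F.Θ) (e : ℕ → ℚ)
    (hle : ∀ l, 0 ≤ l → θ₀ + c * l ∈ F.Θ →
      θ + c * l ∈ F.Θ ∧ F.b (θ + c * l) - F.b θ ≤ F.cumulant θ₀ c l) (j : ℕ) :
    IsCumulantBound ((F.dist θ).map fun x => c * x) (F.exponents e θ₀ c j)
      (F.cumulant θ₀ c) where
  nonneg l hl := by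
    rw [mem_exponents] at hl
    rcases hl with rfl | ⟨_, h, _⟩
    · exact le_rfl
    · exact h
  zero_mem := Finset.mem_insert_self _ _
  map_zero := by simp [cumulant]
  lintegral_le l hl := by
    have := F.isProbabilityMeasure_dist hθ
    rw [lintegral_map (by fun_prop) (by fun_prop)]
    rw [mem_exponents] at hl
    rcases hl with rfl | ⟨_, h0, hmem⟩
    · simp [cumulant]
    · obtain ⟨h1, h2⟩ := hle l h0 hmem
      rw [← F.lintegral_exp_dist (θ := θ) h1]
      refine lintegral_mono fun x => ENNReal.ofReal_le_ofReal (Real.exp_le_exp.2 ?_)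
      have : l * (c * x) = (θ + c * l - θ) * x := by ring
      linarith

/-- Increments of a convex function over steps of length `l` increase. Here `θ + l` and `θ₀` are
convex combinations of `θ` and `θ₀ + l` with exchanged weights, and the two convexity inequalities
are added. -/
theorem cumulant_le_of_le {θ θ₀ : ℝ} (hθ : θ ∈ F.Θ) (hlt : θ < θ₀) {l : ℝ}
    (hl : 0 ≤ l) (hmem : θ₀ + 1 * l ∈ F.Θ) :
    θ + 1 * l ∈ F.Θ ∧ F.b (θ + 1 * l) - F.b θ ≤ F.cumulant θ₀ 1 l := by
  rw [one_mul] at *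
  refine ⟨F.ordConnected_param.out hθ hmem ⟨by linarith, by linarith⟩, ?_⟩
  have hd : 0 < θ₀ + l - θ := by linarith
  set α := l / (θ₀ + l - θ) with hα
  have hα0 : 0 ≤ α := by positivity
  have hα1 : α ≤ 1 := by rw [hα, div_le_one hd]; linarith
  have hαl : α * (θ₀ + l - θ) = l := by rw [hα]; field_simp
  have h1 := F.convexOn_b.2 hθ hmem (sub_nonneg.2 hα1) hα0 (by ring)
  have h2 := F.convexOn_b.2 hθ hmem hα0 (sub_nonneg.2 hα1) (by ring)
  simp only [smul_eq_mul] at h1 h2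
  rw [show (1 - α) * θ + α * (θ₀ + l) = θ + l by linarith] at h1
  rw [show α * θ + (1 - α) * (θ₀ + l) = θ₀ by linarith] at h2
  rw [cumulant, one_mul]
  linarith

theorem exists_exponent {e : ℕ → ℚ} (he : Function.Surjective e) {θ₀ θ c m a : ℝ}
    (hc : c * c = 1) (hθ : θ ∈ F.Θ) (hle : 0 ≤ c * (θ - θ₀)) (ha : a < F.llrAvg θ₀ m θ) :
    ∃ l, (∃ j₀, ∀ j, j₀ ≤ j → l ∈ F.exponents e θ₀ c j) ∧ a < l * (c * m) - F.cumulant θ₀ c l := by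
  rcases hle.eq_or_lt with h0 | hlt
  · have hθ0 : θ = θ₀ := by
      have : c * (c * (θ - θ₀)) = 0 := by rw [← h0, mul_zero]
      rw [← mul_assoc, hc, one_mul] at this
      linarith
    subst hθ0
    refine ⟨0, ⟨0, fun j _ => Finset.mem_insert_self _ _⟩, ?_⟩
    simpa [llrAvg, cumulant] using ha
  · obtain ⟨r, ⟨hr1, hr2⟩, hr3⟩ := F.exists_rat_lt_llrAvg hθ ha
      (U := {x | 0 < c * (x - θ₀)}) (isOpen_lt (by fun_prop) (by fun_prop)) hlt
    have hcr : c * (c * ((r : ℝ) - θ₀)) = r - θ₀ := by rw [← mul_assoc, hc, one_mul]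
    obtain ⟨k, rfl⟩ := he r
    refine ⟨c * ((e k : ℝ) - θ₀), ⟨k + 1, fun j hj => ?_⟩, ?_⟩
    · refine mem_exponents.2 (Or.inr ⟨⟨k, by omega, rfl⟩, le_of_lt hr2, ?_⟩)
      rw [hcr, add_sub_cancel]
      exact hr1
    · have e1 : c * ((e k : ℝ) - θ₀) * (c * m) = c * (c * ((e k : ℝ) - θ₀)) * m := by ring
      rw [e1, cumulant, hcr, add_sub_cancel]
      exact hr3

/-- If the generalized likelihood ratio statistic is large, then so is a sum of statistics of the
two samples against one and the same parameter. -/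
theorem exists_exponents_of_lt_glr {e : ℕ → ℚ} (he : Function.Surjective e) {n p m q θ₀ a : ℝ}
    (hn : 0 < n) (hm : 0 < m) (hθ₀ : θ₀ ∈ F.Θ) (hpq : q ≤ p)
    (h : ENNReal.ofReal a < F.glr n p m q) :
    ∃ l l', (∃ j₀, ∀ j, j₀ ≤ j → l ∈ F.exponents e θ₀ 1 j ∧ l' ∈ F.exponents e θ₀ (-1) j) ∧
      a < (l * (n * p) - n * F.cumulant θ₀ 1 l) +
          (l' * (-(m * q)) - m * F.cumulant θ₀ (-1) l') := by
  obtain ⟨θ, hθ, hθle, θ', hθ', hθle', hlt⟩ : ∃ θ ∈ F.Θ, θ₀ ≤ θ ∧ ∃ θ' ∈ F.Θ, θ' ≤ θ₀ ∧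
      a < n * F.llrAvg θ₀ p θ + m * F.llrAvg θ₀ q θ' := by
    by_contra hcon
    push Not at hcon
    exact absurd (F.glr_le_of_forall_le hn hm hθ₀ hpq hcon) (not_le.2 h)
  set η := (n * F.llrAvg θ₀ p θ + m * F.llrAvg θ₀ q θ' - a) / (n + m) with hη
  have hη0 : 0 < η := div_pos (by linarith) (by linarith)
  have hηm : η * (n + m) = n * F.llrAvg θ₀ p θ + m * F.llrAvg θ₀ q θ' - a := by
    rw [hη]; field_simp
  obtain ⟨l, ⟨j, hj⟩, hl⟩ := F.exists_exponent he (c := 1) (by norm_num) hθ (by linarith)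
    (sub_lt_self (F.llrAvg θ₀ p θ) hη0)
  obtain ⟨l', ⟨j', hj'⟩, hl'⟩ := F.exists_exponent he (c := -1) (by norm_num) hθ' (by linarith)
    (sub_lt_self (F.llrAvg θ₀ q θ') hη0)
  refine ⟨l, l', ⟨max j j', fun i hi => ⟨hj i (le_trans (le_max_left _ _) hi),
    hj' i (le_trans (le_max_right _ _) hi)⟩⟩, ?_⟩
  have h1 := mul_lt_mul_of_pos_left hl hn
  have h2 := mul_lt_mul_of_pos_left hl' hm
  linarith

/-- At equal averages a nonzero GLR is only possible if the likelihood is unbounded, and then some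
one-sided statistic exceeds every level `B`. -/
theorem exists_exponent_of_glr_self {e : ℕ → ℚ} (he : Function.Surjective e) {n m p θ₀ : ℝ}
    (hn : 0 < n) (hm : 0 < m) (h : F.glr n p m p ≠ 0) (B : ℝ) :
    (∃ l, (∃ j₀, ∀ j, j₀ ≤ j → l ∈ F.exponents e θ₀ 1 j) ∧ B < l * (1 * p) - F.cumulant θ₀ 1 l) ∨
    (∃ l, (∃ j₀, ∀ j, j₀ ≤ j → l ∈ F.exponents e θ₀ (-1) j) ∧
      B < l * (-1 * p) - F.cumulant θ₀ (-1) l) := by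
  obtain ⟨θ, hθ, hlt⟩ : ∃ θ ∈ F.Θ, B < F.llrAvg θ₀ p θ := by
    by_contra hcon
    push Not at hcon
    exact h (F.glr_self_eq_zero θ₀ hn hm hcon)
  rcases le_total θ₀ θ with hle | hle
  · exact Or.inl (F.exists_exponent he (by norm_num) hθ (by linarith) hlt)
  · exact Or.inr (F.exists_exponent he (by norm_num) hθ (by linarith) hlt)

end ExpFamily

theorem isProbabilityMeasure_map_mul (F : ExpFamily) {θ : ℝ} (hθ : θ ∈ F.Θ) (c : ℝ) :
    IsProbabilityMeasure ((F.dist θ).map fun x => c * x) := by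
  have := F.isProbabilityMeasure_dist hθ
  exact Measure.isProbabilityMeasure_map (by fun_prop)

/-- The stack obtained by completing the record of `c` times the rewards of arm `a` by `u`. -/
noncomputable def completed {K : ℕ} (T : ℕ) (arm : ℕ → Fin K) (reward : ℕ → ℝ) (a : Fin K) (c : ℝ)
    (u : Fin T → ℝ) : Fin T → ℝ :=
  splice (pulls arm a 0 T) (record T arm (fun l => c * reward l) a T) u

theorem prefixSum_completed {K T : ℕ} (arm : ℕ → Fin K) (reward : ℕ → ℝ) (a : Fin K) (c : ℝ)
    {s : ℕ} (hs : s ≤ T) (hpos : 0 < pulls arm a 0 s) (u : Fin T → ℝ) :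
    prefixSum (pulls arm a 0 s) (completed T arm reward a c u)
      = c * (pulls arm a 0 s * empMean arm reward a s) := by
  have : (pulls arm a 0 s : ℝ) ≠ 0 := by exact_mod_cast hpos.ne'
  rw [completed, prefixSum_splice_record arm _ a hs le_rfl, empMean, mul_div_cancel₀ _ this,
    Finset.mul_sum]

/-- A limit form of the coupling: events of the samples that eventually force the completed
stacks into `E T`, for all large horizons `T`. -/
theorem IsBanditProcess.measure_le_of_eventually {Ω : Type*} [mΩ : MeasurableSpace Ω]
    {P : Measure Ω} [IsProbabilityMeasure P] {F : ExpFamily} {K : ℕ} {θ : Fin K → ℝ}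
    {ℱ : Filtration ℕ mΩ} {A : ℕ → Ω → Fin K} {X : ℕ → Ω → ℝ}
    (h : IsBanditProcess P F θ ℱ A X) (hθ : ∀ a, θ a ∈ F.Θ) {i j : Fin K} (hij : i ≠ j) (c d : ℝ)
    {μ ν : Measure ℝ} [IsProbabilityMeasure μ] [IsProbabilityMeasure ν]
    (hμ : μ = (F.dist (θ i)).map (fun x => c * x)) (hν : ν = (F.dist (θ j)).map (fun x => d * x))
    {E : ∀ T : ℕ, Set ((Fin T → ℝ) × (Fin T → ℝ))} (hE : ∀ T, MeasurableSet (E T)) {B : ℝ≥0∞}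
    (hB : ∀ T, 1 ≤ T →
      ((Measure.pi fun _ : Fin T => μ).prod (Measure.pi fun _ : Fin T => ν)) (E T) ≤ B)
    {G : Set Ω} (hG : ∀ᵐ ω ∂P, ω ∈ G → ∃ T₀, ∀ T, T₀ ≤ T → ∀ p : (Fin T → ℝ) × (Fin T → ℝ),
      (completed T (fun l => A l ω) (fun l => X l ω) i c p.1,
        completed T (fun l => A l ω) (fun l => X l ω) j d p.2) ∈ E T) : P G ≤ B := by
  set H : ℕ → Set Ω := fun T₀ => {ω | ∀ T, T₀ ≤ T → ∀ p : (Fin T → ℝ) × (Fin T → ℝ),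
      (completed T (fun l => A l ω) (fun l => X l ω) i c p.1,
        completed T (fun l => A l ω) (fun l => X l ω) j d p.2) ∈ E T} with hH
  have hmono : Monotone H := fun a b hab ω hω T hT => hω T (hab.trans hT)
  have hsub : G ≤ᵐ[P] ⋃ T, H T := by
    filter_upwards [hG] with ω hω hωG
    exact Set.mem_iUnion.2 (hω hωG)
  refine (measure_mono_ae hsub).trans ?_
  -- Continuity from below along an increasing sequence; the sets `H T₀` need not be measurable.
  rw [hmono.measure_iUnion]
  refine iSup_le fun T₀ => ?_
  refine (h.measure_le_of_splice_mem hθ (max T₀ 1) hij c d hμ hν (hE (max T₀ 1)) (max T₀ 1)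
    (ae_of_all _ fun ω hω => ?_)).trans (hB (max T₀ 1) (le_max_right _ _))
  exact fun p => hω (max T₀ 1) (le_max_left _ _) p

/-! ### The probability of a wrong output -/

theorem sum_pulls {K : ℕ} (arm : ℕ → Fin K) (m n : ℕ) : ∑ a, pulls arm a m n = n - m := by
  rw [← Nat.card_Ico]
  exact (Finset.card_eq_sum_card_fiberwise fun l _ => Finset.mem_coe.2
    (Finset.mem_univ (arm l))).symm

theorem pulls_add_pulls_le {K : ℕ} (arm : ℕ → Fin K) {i j : Fin K} (hij : i ≠ j) (m n : ℕ) :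
    pulls arm i m n + pulls arm j m n ≤ n - m := by
  rw [← sum_pulls arm m n, ← Finset.sum_pair (f := fun a => pulls arm a m n) hij]
  exact Finset.sum_le_univ_sum_of_nonneg fun _ => Nat.zero_le _

theorem pulls_add_pulls_eq (arm : ℕ → Fin 2) {i j : Fin 2} (hij : i ≠ j) (m n : ℕ) :
    pulls arm i m n + pulls arm j m n = n - m := by
  rw [← sum_pulls arm m n, ← Finset.sum_pair (f := fun a => pulls arm a m n) hij]
  refine Finset.sum_congr ?_ fun _ _ => rfl
  ext a
  simp only [Finset.mem_insert, Finset.mem_singleton, Finset.mem_univ, iff_true]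
  omega

theorem threshold_eq (K : ℕ) (δ : ℝ) (t : ℕ) :
    threshold K δ t = baseLevel (Real.log (((K : ℝ) - 1) / δ)) + sampleLevel t := by
  unfold threshold baseLevel sampleLevel
  ring

theorem baseLevel_strictMono {l L : ℝ} (hl : 0 ≤ l) (h : l < L) : baseLevel l < baseLevel L := by
  have := Real.log_le_log (x := 1 + l) (y := 1 + L) (by linarith) (by linarith)
  unfold baseLevel
  linarith

/-- With two arms, the exploration steps that follow the initialization balance the samples. -/
theorem IsBatchTrackAndStopRun.two_le_pulls {F : ExpFamily} {τ₁ : ℕ} {δ ε : ℝ} {arm : ℕ → Fin 2}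
    {reward : ℕ → ℝ} {istar : ℕ → Fin 2}
    (h : IsBatchTrackAndStopRun F τ₁ δ ε arm reward istar)
    (hns : ∀ s, 2 ≤ s → s ≤ 3 → ¬ StopTest F τ₁ δ arm reward s (istar s))
        {i j : Fin 2} (hij : i ≠ j) :
    2 ≤ pulls arm i τ₁ (τ₁ + 4) := by
  obtain ⟨-, hinit, count, w, what, -, hw, hloop⟩ := h
  -- For `t = 2, 3` the quotient `t / 2 = 1` is a perfect square, so both steps explore and keep
  -- equal weights. With three samples split as `2 + 1`, the fourth pull then goes to the less
  -- sampled arm.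
  obtain ⟨h2, -, -⟩ := hloop 2 le_rfl fun s hs hs' => hns s hs (by omega)
  obtain ⟨h3, -, harm⟩ := hloop 3 (by norm_num) fun s hs hs' => hns s hs (by omega)
  have w3 : ∀ a, w 3 a = 1 / 2 := fun a => by
    have := (h2 ⟨1, by norm_num⟩).1 a
    rw [hw a] at this
    rw [this]
    norm_num
  have w4 : ∀ a, w 4 a = 1 / 2 := fun a => by
    have := (h3 ⟨1, by norm_num⟩).1 a
    rw [w3 a] at this
    rw [this]
    norm_num
  have hp := pulls_succ arm i (m := τ₁) (t := τ₁ + 3) (by omega)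
  have hi : 1 ≤ pulls arm i τ₁ (τ₁ + 3) := (hinit i).symm.le.trans (pulls_mono arm i τ₁ (by omega))
  have hsum := pulls_add_pulls_eq arm hij τ₁ (τ₁ + 3)
  have hp' : pulls arm i τ₁ (τ₁ + 4)
      = pulls arm i τ₁ (τ₁ + 3) + if arm (τ₁ + 3) = i then 1 else 0 := hp
  by_cases ha : arm (τ₁ + 3) = i
  · rw [hp', if_pos ha]
    omega
  · by_contra hcon
    have hi1 : pulls arm i τ₁ (τ₁ + 3) = 1 := by
      rw [hp', if_neg ha] at hcon
      omega
    have hj2 : pulls arm j τ₁ (τ₁ + 3) = 2 := by omega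
    have haj : arm (τ₁ + 3) = j := by omega
    have := harm i
    rw [haj, w4, w4, hi1, hj2] at this
    norm_num at this

/-! ### Wrong outputs as crossings of the completed stacks -/

namespace ExpFamily

variable (F : ExpFamily)

theorem isCumulantBound_left {θ₁ θ₀ : ℝ} (h₁ : θ₁ ∈ F.Θ) (hlt : θ₁ < θ₀) (e : ℕ → ℚ) (T : ℕ) :
    IsCumulantBound ((F.dist θ₁).map fun x => 1 * x) (F.exponents e θ₀ 1 T) (F.cumulant θ₀ 1) :=
  F.isCumulantBound h₁ e (fun _ hl hm => F.cumulant_le_of_le h₁ hlt hl hm) T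

theorem isCumulantBound_right {θ₀ : ℝ} (h₀ : θ₀ ∈ F.Θ) (e : ℕ → ℚ) (T : ℕ) :
    IsCumulantBound ((F.dist θ₀).map fun x => -1 * x) (F.exponents e θ₀ (-1) T)
      (F.cumulant θ₀ (-1)) :=
  F.isCumulantBound h₀ e (fun _ _ hm => ⟨hm, le_rfl⟩) T

variable {K : ℕ} {arm : ℕ → Fin K} {reward : ℕ → ℝ} {i j : Fin K} {s : ℕ} {θ₁ θ₀ : ℝ} {e : ℕ → ℚ}

theorem mem_crossing_of_lt_glr (he : Function.Surjective e) (h₁ : θ₁ ∈ F.Θ) (h₀ : θ₀ ∈ F.Θ)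
    (hlt : θ₁ < θ₀) (hi : 0 < pulls arm i 0 s) (hj : 0 < pulls arm j 0 s)
    (hle : empMean arm reward j s ≤ empMean arm reward i s) {x : ℝ}
    (h : ENNReal.ofReal (x + sampleLevel (pulls arm i 0 s + pulls arm j 0 s)) <
      F.glr (pulls arm i 0 s) (empMean arm reward i s) (pulls arm j 0 s) (empMean arm reward j s)) :
    ∃ T₀, ∀ T, T₀ ≤ T → ∀ p : (Fin T → ℝ) × (Fin T → ℝ),
      (completed T arm reward i 1 p.1, completed T arm reward j (-1) p.2) ∈
        crossing (F.isCumulantBound_left h₁ hlt e T) (F.isCumulantBound_right h₀ e T) T x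
          (pulls arm i 0 s) (pulls arm j 0 s) := by
  obtain ⟨l, l', ⟨T₁, hT₁⟩, hll⟩ := F.exists_exponents_of_lt_glr he (by exact_mod_cast hi)
    (by exact_mod_cast hj) h₀ hle h
  refine ⟨max T₁ s, fun T hT p => ?_⟩
  have hs : s ≤ T := le_trans (le_max_right _ _) hT
  obtain ⟨hl, hl'⟩ := hT₁ T (le_trans (le_max_left _ _) hT)
  refine ⟨(pulls_le arm i 0 s).trans hs, (pulls_le arm j 0 s).trans hs, hll.le.trans ?_⟩
  refine add_le_add ((IsCumulantBound.le_stat_iff _).2 ⟨l, hl, ?_⟩)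
    ((IsCumulantBound.le_stat_iff _).2 ⟨l', hl', ?_⟩)
  · rw [prefixSum_completed arm reward i 1 hs hi]
    exact le_of_eq (by ring)
  · rw [prefixSum_completed arm reward j (-1) hs hj]
    exact le_of_eq (by ring)

/-- The event that, after one sample of each of the two arms, the first arm looks better and the
level `x` is reached. -/
def firstCrossing {μ ν : Measure ℝ} {D D' : Finset ℝ} {ψ ψ' : ℝ → ℝ} (hμ : IsCumulantBound μ D ψ)
    (hν : IsCumulantBound ν D' ψ') (T : ℕ) (x : ℝ) : Set ((Fin T → ℝ) × (Fin T → ℝ)) :=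
  ({p | 0 < prefixSum 1 p.1 + prefixSum 1 p.2} ∪
    ({p | 8 ≤ hμ.stat 1 p.1} ∪ {p | 8 ≤ hν.stat 1 p.2})) ∩ crossing hμ hν T x 1 1

theorem measurableSet_firstCrossing {μ ν : Measure ℝ} {D D' : Finset ℝ} {ψ ψ' : ℝ → ℝ}
    (hμ : IsCumulantBound μ D ψ) (hν : IsCumulantBound ν D' ψ') (T : ℕ) (x : ℝ) :
    MeasurableSet (firstCrossing hμ hν T x) := by
  have h1 : Measurable fun p : (Fin T → ℝ) × (Fin T → ℝ) => hμ.stat 1 p.1 :=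
    (hμ.measurable_stat 1).comp measurable_fst
  have h2 : Measurable fun p : (Fin T → ℝ) × (Fin T → ℝ) => hν.stat 1 p.2 :=
    (hν.measurable_stat 1).comp measurable_snd
  refine MeasurableSet.inter ?_ (measurableSet_crossing hμ hν T x 1 1)
  exact (measurableSet_lt measurable_const (by fun_prop)).union
    ((measurableSet_le measurable_const h1).union (measurableSet_le measurable_const h2))

theorem isUpperSet_firstCrossing {μ ν : Measure ℝ} {D D' : Finset ℝ} {ψ ψ' : ℝ → ℝ}
    (hμ : IsCumulantBound μ D ψ) (hν : IsCumulantBound ν D' ψ') (T : ℕ) (x : ℝ) :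
    IsUpperSet (firstCrossing hμ hν T x) := by
  refine IsUpperSet.inter (IsUpperSet.union ?_ (IsUpperSet.union ?_ ?_))
    (isUpperSet_crossing hμ hν T x 1 1)
  · exact fun p q hpq hp => lt_of_lt_of_le hp
      (add_le_add (prefixSum_mono 1 hpq.1) (prefixSum_mono 1 hpq.2))
  · exact fun p q hpq hp => le_trans (show (8 : ℝ) ≤ _ from hp) (hμ.stat_mono 1 hpq.1)
  · exact fun p q hpq hp => le_trans (show (8 : ℝ) ≤ _ from hp) (hν.stat_mono 1 hpq.2)

theorem prefixSum_one {T : ℕ} (hT : 0 < T) (u : Fin T → ℝ) : prefixSum 1 u = u ⟨0, hT⟩ := by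
  rw [prefixSum, Finset.sum_eq_single ⟨0, hT⟩]
  · simp
  · intro b _ hb
    rw [if_neg]
    intro h
    exact hb (Fin.ext (by simpa using h))
  · simp

/-- One observation of the worse arm strictly beats one of the better arm with probability at most
`1/2`. The two events that cover ties cost `exp (-8) ≤ 1/2000` each. -/
theorem measure_firstCrossing_le (h₁ : θ₁ ∈ F.Θ) (h₀ : θ₀ ∈ F.Θ) (hlt : θ₁ < θ₀) {T : ℕ}
    (hT : 1 ≤ T) (x : ℝ) :
    ((Measure.pi fun _ : Fin T => (F.dist θ₁).map fun x => 1 * x).prod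
      (Measure.pi fun _ : Fin T => (F.dist θ₀).map fun x => -1 * x))
      (firstCrossing (F.isCumulantBound_left h₁ hlt e T) (F.isCumulantBound_right h₀ e T) T x)
      ≤ ENNReal.ofReal (501 / 1000) := by
  have := F.isProbabilityMeasure_dist h₁
  have := F.isProbabilityMeasure_dist h₀
  have i1 := isProbabilityMeasure_map_mul F h₁ 1
  have i0 := isProbabilityMeasure_map_mul F h₀ (-1)
  have hexp : Real.exp (-8) ≤ 1 / 2000 := by
    rw [Real.exp_neg, one_div]
    refine inv_anti₀ (by norm_num) ?_
    have := Real.exp_one_gt_d9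
    calc (2000 : ℝ) ≤ 2.7 ^ 8 := by norm_num
      _ ≤ Real.exp 1 ^ 8 := pow_le_pow_left₀ (by norm_num) (by linarith) 8
      _ = Real.exp 8 := by rw [← Real.exp_nat_mul]; norm_num
  set μ := (F.dist θ₁).map fun x => 1 * x with hμ
  set ν := (F.dist θ₀).map fun x => -1 * x with hν
  have e1 : ((Measure.pi fun _ : Fin T => μ).prod (Measure.pi fun _ : Fin T => ν))
      {p | 0 < prefixSum 1 p.1 + prefixSum 1 p.2} ≤ ENNReal.ofReal (1 / 2) := by
    have hmp := (measurePreserving_eval (fun _ : Fin T => μ) ⟨0, hT⟩).prod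
      (measurePreserving_eval (fun _ : Fin T => ν) ⟨0, hT⟩)
    have hset : {p : (Fin T → ℝ) × (Fin T → ℝ) | 0 < prefixSum 1 p.1 + prefixSum 1 p.2}
        = Prod.map (Function.eval ⟨0, hT⟩) (Function.eval ⟨0, hT⟩) ⁻¹'
            {p : ℝ × ℝ | 0 < p.1 + p.2} := by
      ext p
      simp only [Set.mem_preimage, Set.mem_ofPred_eq, prefixSum_one hT, Prod.map_fst, Prod.map_snd,
        Function.eval]
    have hms : MeasurableSet {p : ℝ × ℝ | 0 < p.1 + p.2} :=
      measurableSet_lt measurable_const (by fun_prop)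
    rw [hset, hmp.measure_preimage hms.nullMeasurableSet, hμ, hν,
      Measure.map_prod_map _ _ (by fun_prop) (by fun_prop), Measure.map_apply (by fun_prop) hms]
    refine (measure_mono fun p hp => ?_).trans (F.measure_prod_lt_le h₁ h₀ hlt)
    simp only [Set.mem_preimage, Set.mem_ofPred_eq, Prod.map_fst, Prod.map_snd] at hp ⊢
    linarith
  have e2 : ((Measure.pi fun _ : Fin T => μ).prod (Measure.pi fun _ : Fin T => ν))
      {p | 8 ≤ (F.isCumulantBound_left h₁ hlt e T).stat 1 p.1} ≤ ENNReal.ofReal (1 / 2000) := by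
    refine (measurePreserving_fst.measure_preimage (measurableSet_le measurable_const
      (IsCumulantBound.measurable_stat _ 1)).nullMeasurableSet).trans_le ?_
    exact ((F.isCumulantBound_left h₁ hlt e T).measure_le_stat_le le_rfl hT (by norm_num)).trans
      (ENNReal.ofReal_le_ofReal hexp)
  have e3 : ((Measure.pi fun _ : Fin T => μ).prod (Measure.pi fun _ : Fin T => ν))
      {p | 8 ≤ (F.isCumulantBound_right h₀ e T).stat 1 p.2} ≤ ENNReal.ofReal (1 / 2000) := by
    refine (measurePreserving_snd.measure_preimage (measurableSet_le measurable_const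
      (IsCumulantBound.measurable_stat _ 1)).nullMeasurableSet).trans_le ?_
    exact ((F.isCumulantBound_right h₀ e T).measure_le_stat_le le_rfl hT (by norm_num)).trans
      (ENNReal.ofReal_le_ofReal hexp)
  refine (measure_mono Set.inter_subset_left).trans ((measure_union_le _ _).trans
    ((add_le_add e1 ((measure_union_le _ _).trans (add_le_add e2 e3))).trans_eq ?_))
  rw [← ENNReal.ofReal_add (by norm_num) (by norm_num),
    ← ENNReal.ofReal_add (by norm_num) (by norm_num)]
  norm_num

theorem mem_firstCrossing_of_lt_glr (he : Function.Surjective e) (h₁ : θ₁ ∈ F.Θ) (h₀ : θ₀ ∈ F.Θ)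
    (hlt : θ₁ < θ₀) (hi : pulls arm i 0 s = 1) (hj : pulls arm j 0 s = 1)
    (hle : empMean arm reward j s ≤ empMean arm reward i s) {x : ℝ}
    (h : ENNReal.ofReal (x + sampleLevel (pulls arm i 0 s + pulls arm j 0 s)) <
      F.glr (pulls arm i 0 s) (empMean arm reward i s) (pulls arm j 0 s) (empMean arm reward j s)) :
    ∃ T₀, ∀ T, T₀ ≤ T → ∀ p : (Fin T → ℝ) × (Fin T → ℝ),
      (completed T arm reward i 1 p.1, completed T arm reward j (-1) p.2) ∈
        firstCrossing (F.isCumulantBound_left h₁ hlt e T) (F.isCumulantBound_right h₀ e T) T x := by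
  obtain ⟨T₀, hT₀⟩ := F.mem_crossing_of_lt_glr he h₁ h₀ hlt (by omega) (by omega) hle h
  simp only [hi, hj] at hT₀
  have hsi : ∀ T, s ≤ T → ∀ u, prefixSum 1 (completed T arm reward i 1 u)
      = 1 * empMean arm reward i s := fun T hT u => by
    have := prefixSum_completed arm reward i 1 hT (by omega) u
    rwa [hi, Nat.cast_one, one_mul] at this
  have hsj : ∀ T, s ≤ T → ∀ u, prefixSum 1 (completed T arm reward j (-1) u)
      = -1 * empMean arm reward j s := fun T hT u => by
    have := prefixSum_completed arm reward j (-1) hT (by omega) u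
    rwa [hj, Nat.cast_one, one_mul] at this
  rcases hle.lt_or_eq with hlt' | heq
  · refine ⟨max T₀ s, fun T hT p => ⟨Or.inl ?_, hT₀ T (le_trans (le_max_left _ _) hT) p⟩⟩
    have hs : s ≤ T := le_trans (le_max_right _ _) hT
    change 0 < prefixSum 1 _ + prefixSum 1 _
    rw [hsi T hs, hsj T hs]
    linarith
  -- A tie of the two single observations. A positive GLR then means an unbounded likelihood, which
  -- pushes one of the statistics above `8`.
  · rw [hi, hj, heq] at h
    rcases F.exists_exponent_of_glr_self he (by norm_num) (by norm_num) ((zero_le).trans_lt h).ne' 8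
      (θ₀ := θ₀) with ⟨l, ⟨T₁, hT₁⟩, hl⟩ | ⟨l, ⟨T₁, hT₁⟩, hl⟩
    · refine ⟨max T₀ (max T₁ s), fun T hT p =>
        ⟨Or.inr (Or.inl ?_), hT₀ T (le_trans (le_max_left _ _) hT) p⟩⟩
      have hT' := le_trans (le_max_right _ _) hT
      refine (IsCumulantBound.le_stat_iff _).2 ⟨l, hT₁ T (le_trans (le_max_left _ _) hT'), ?_⟩
      rw [hsi T (le_trans (le_max_right _ _) hT'), Nat.cast_one, one_mul (F.cumulant _ _ _)]
      exact hl.le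
    · refine ⟨max T₀ (max T₁ s), fun T hT p =>
        ⟨Or.inr (Or.inr ?_), hT₀ T (le_trans (le_max_left _ _) hT) p⟩⟩
      have hT' := le_trans (le_max_right _ _) hT
      refine (IsCumulantBound.le_stat_iff _).2 ⟨l, hT₁ T (le_trans (le_max_left _ _) hT'), ?_⟩
      rw [hsj T (le_trans (le_max_right _ _) hT'), Nat.cast_one, one_mul (F.cumulant _ _ _), heq]
      exact hl.le

end ExpFamily

theorem pulls_pos_of_one_le {K τ₁ t : ℕ} {arm : ℕ → Fin K} {a : Fin K}
    (h : 1 ≤ pulls arm a τ₁ (τ₁ + t)) : 0 < pulls arm a 0 (τ₁ + t) := by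
  rw [← pulls_add arm a (Nat.zero_le _) (Nat.le_add_right τ₁ t)]
  omega

section WrongOutput

variable {F : ExpFamily} {K τ₁ : ℕ} {δ ε : ℝ}

/-- The stopping test uses all `τ₁ + t` samples, which are at least those of the two arms. The level
`l`, strictly below the true one, leaves a strict gap for the approximation by rational parameters.
-/
theorem IsStopTime.level_lt_glr {arm : ℕ → Fin K} {reward : ℕ → ℝ} {istar : ℕ → Fin K} {t : ℕ}
    (h : IsStopTime F τ₁ δ arm reward istar t)
    (hrun : IsBatchTrackAndStopRun F τ₁ δ ε arm reward istar) {j : Fin K} (hj : istar t ≠ j)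
    {l : ℝ} (hl : 0 ≤ l) (hlt : l < Real.log (((K : ℝ) - 1) / δ)) :
    1 ≤ pulls arm (istar t) τ₁ (τ₁ + t) ∧ 1 ≤ pulls arm j τ₁ (τ₁ + t) ∧
    ENNReal.ofReal (baseLevel l +
        sampleLevel (pulls arm (istar t) 0 (τ₁ + t) + pulls arm j 0 (τ₁ + t))) <
      F.glr (pulls arm (istar t) 0 (τ₁ + t)) (empMean arm reward (istar t) (τ₁ + t))
        (pulls arm j 0 (τ₁ + t)) (empMean arm reward j (τ₁ + t)) := by
  obtain ⟨⟨hK, htest⟩, -⟩ := h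
  obtain ⟨-, hinit, -⟩ := hrun
  have hone : ∀ a, 1 ≤ pulls arm a τ₁ (τ₁ + t) := fun a =>
    (hinit a).symm.le.trans (pulls_mono arm a τ₁ (by omega))
  refine ⟨hone _, hone _, ?_⟩
  have hsplit : ∀ a, pulls arm a 0 (τ₁ + t) = pulls arm a 0 τ₁ + pulls arm a τ₁ (τ₁ + t) :=
    fun a => (pulls_add arm a (Nat.zero_le _) (Nat.le_add_right _ _)).symm
  have hle := htest j (Ne.symm hj)
  rw [Zstat, ← Nat.cast_add, ← Nat.cast_add, ← hsplit, ← hsplit, threshold_eq] at hle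
  refine lt_of_lt_of_le ?_ hle
  have h1 := hone (istar t)
  have h2 := hone j
  have h3 := hsplit (istar t)
  have h4 := hsplit j
  have h5 := pulls_add_pulls_le arm hj 0 (τ₁ + t)
  have h6 := sampleLevel_mono (s := pulls arm (istar t) 0 (τ₁ + t) + pulls arm j 0 (τ₁ + t))
    (t := τ₁ + t) (by omega) (by omega)
  have h7 := sampleLevel_nonneg (t := τ₁ + t) (by omega)
  have h8 := baseLevel_strictMono hl hlt
  have h9 := le_baseLevel hl
  rw [ENNReal.ofReal_lt_ofReal_iff (by linarith)]
  linarith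

variable {θ : Fin K → ℝ} {Ω : Type*} [mΩ : MeasurableSpace Ω] {P : Measure Ω}
  [IsProbabilityMeasure P] {ℱ : Filtration ℕ mΩ} {A : ℕ → Ω → Fin K} {X : ℕ → Ω → ℝ}
  {istar : ℕ → Ω → Fin K}

theorem measure_output_eq_le_of_large (hθ : ∀ a, θ a ∈ F.Θ) (hproc : IsBanditProcess P F θ ℱ A X)
    (halg : ∀ᵐ ω ∂P, IsBatchTrackAndStopRun F τ₁ δ ε (fun l => A l ω) (fun l => X l ω)
      (fun t => istar t ω)) {i j : Fin K} (hij : i ≠ j) (hlt : θ i < θ j) {l : ℝ}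
    (hl : 69 / 100 ≤ l) (hlt' : l < Real.log (((K : ℝ) - 1) / δ)) :
    P {ω | ∃ t, IsStopTime F τ₁ δ (fun l => A l ω) (fun l => X l ω) (fun s => istar s ω) t ∧
      istar t ω = i} ≤ ENNReal.ofReal (Real.exp (-l)) := by
  have i1 := isProbabilityMeasure_map_mul F (hθ i) 1
  have i0 := isProbabilityMeasure_map_mul F (hθ j) (-1)
  obtain ⟨e, he⟩ := exists_surjective_nat ℚ
  refine hproc.measure_le_of_eventually hθ hij 1 (-1) rfl rfl
    (E := fun T => {p | ∃ n m, 1 ≤ n ∧ 1 ≤ m ∧ p ∈ crossing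
      (F.isCumulantBound_left (hθ i) hlt e T) (F.isCumulantBound_right (hθ j) e T) T
      (baseLevel l) n m}) (fun T => ?_) (fun T _ => measure_exists_crossing_le _ _ T hl) ?_
  · simp only [Set.ofPred_exists, Set.ofPred_and]
    exact MeasurableSet.iUnion fun n => MeasurableSet.iUnion fun m =>
      (MeasurableSet.const _).inter ((MeasurableSet.const _).inter
        (measurableSet_crossing _ _ _ _ _ _))
  · filter_upwards [halg] with ω hω
    rintro ⟨t, ht, rfl⟩
    obtain ⟨h1, h2, h3⟩ := ht.level_lt_glr hω hij (by linarith) hlt'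
    have h1' := pulls_pos_of_one_le h1
    have h2' := pulls_pos_of_one_le h2
    obtain ⟨T₀, hT₀⟩ := F.mem_crossing_of_lt_glr he (hθ _) (hθ j) hlt h1' h2' (hω.1 t ht.1.1 j) h3
    exact ⟨T₀, fun T hT p => ⟨_, _, h1', h2', hT₀ T hT p⟩⟩

end WrongOutput

/-! ### Two arms at small levels -/

section TwoArms

variable {F : ExpFamily} {τ₁ : ℕ} {δ ε : ℝ} {θ : Fin 2 → ℝ} {Ω : Type*} [mΩ : MeasurableSpace Ω]
  {P : Measure Ω} [IsProbabilityMeasure P] {ℱ : Filtration ℕ mΩ} {A : ℕ → Ω → Fin 2}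
  {X : ℕ → Ω → ℝ} {istar : ℕ → Ω → Fin 2}

/-- The possible pairs of sample sizes of two arms at the stopping time. -/
theorem IsStopTime.pulls_cases {arm : ℕ → Fin 2} {reward : ℕ → ℝ} {istar : ℕ → Fin 2} {t : ℕ}
    (h : IsStopTime F τ₁ δ arm reward istar t)
    (hrun : IsBatchTrackAndStopRun F τ₁ δ ε arm reward istar) {i j : Fin 2} (hij : i ≠ j) :
    (2 ≤ pulls arm i 0 (τ₁ + t) ∧ 2 ≤ pulls arm j 0 (τ₁ + t)) ∨
    (pulls arm i 0 (τ₁ + t) = 1 ∧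
      (pulls arm j 0 (τ₁ + t) = τ₁ + 1 ∨ pulls arm j 0 (τ₁ + t) = τ₁ + 2)) ∨
    (pulls arm j 0 (τ₁ + t) = 1 ∧
      (pulls arm i 0 (τ₁ + t) = τ₁ + 1 ∨ pulls arm i 0 (τ₁ + t) = τ₁ + 2)) := by
  have hsplit : ∀ a, pulls arm a 0 (τ₁ + t) = pulls arm a 0 τ₁ + pulls arm a τ₁ (τ₁ + t) :=
    fun a => (pulls_add arm a (Nat.zero_le _) (Nat.le_add_right _ _)).symm
  have h3 := hsplit i
  have h4 := hsplit j
  have h5 := pulls_add_pulls_eq arm hij 0 τ₁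
  have h6 := pulls_add_pulls_eq arm hij τ₁ (τ₁ + t)
  have h2 : 2 ≤ t := h.1.1
  have hone : ∀ a, 1 ≤ pulls arm a τ₁ (τ₁ + t) := fun a =>
    (hrun.2.1 a).symm.le.trans (pulls_mono arm a τ₁ (by omega))
  have h7 := hone i
  have h8 := hone j
  -- An arm with one sample in total has no offline data, so the other arm has the remaining `τ₁ + t
  -- - 1` samples. From `t = 4` on both arms have two online samples.
  rcases Nat.lt_or_ge t 4 with ht | ht
  · omega
  · have hns : ∀ s, 2 ≤ s → s ≤ 3 → ¬ StopTest F τ₁ δ arm reward s (istar s) :=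
        fun s hs hs' hst => by
      have : t ≤ s := h.2 ⟨hs, hst⟩
      omega
    have h9 := (hrun.two_le_pulls hns hij).trans (pulls_mono arm i τ₁ (by omega : τ₁ + 4 ≤ τ₁ + t))
    have h10 := (hrun.two_le_pulls hns hij.symm).trans
      (pulls_mono arm j τ₁ (by omega : τ₁ + 4 ≤ τ₁ + t))
    omega

theorem measure_output_eq_le_of_small (hθ : ∀ a, θ a ∈ F.Θ) (hproc : IsBanditProcess P F θ ℱ A X)
    (halg : ∀ᵐ ω ∂P, IsBatchTrackAndStopRun F τ₁ δ ε (fun l => A l ω) (fun l => X l ω)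
      (fun t => istar t ω)) {i j : Fin 2} (hij : i ≠ j) (hlt : θ i < θ j) {l : ℝ}
    (hl : 0 < l) (hl' : l ≤ 69 / 100) (hlt' : l < Real.log ((((2 : ℕ) : ℝ) - 1) / δ)) :
    P {ω | ∃ t, IsStopTime F τ₁ δ (fun l => A l ω) (fun l => X l ω) (fun s => istar s ω) t ∧
      istar t ω = i} ≤ ENNReal.ofReal (Real.exp (-l)) := by
  have i1 := isProbabilityMeasure_map_mul F (hθ i) 1
  have i0 := isProbabilityMeasure_map_mul F (hθ j) (-1)
  obtain ⟨e, he⟩ := exists_surjective_nat ℚ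
  set C : ∀ T : ℕ, ℕ → ℕ → Set ((Fin T → ℝ) × (Fin T → ℝ)) := fun T =>
    crossing (F.isCumulantBound_left (hθ i) hlt e T) (F.isCumulantBound_right (hθ j) e T) T
      (baseLevel l) with hC
  have hCm : ∀ T n m, MeasurableSet (C T n m) := fun T n m => measurableSet_crossing _ _ _ _ _ _
  have hCU : ∀ T,
      MeasurableSet (⋃ n, ⋃ m, {_p : (Fin T → ℝ) × (Fin T → ℝ) | 2 ≤ n ∧ 2 ≤ m} ∩ C T n m) :=
    fun T => MeasurableSet.iUnion fun n => MeasurableSet.iUnion fun m =>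
      (MeasurableSet.const _).inter (hCm T n m)
  -- Without offline data the pair `(1, 1)` occurs and needs the bound by `501/1000`. With offline
  -- data a pair containing `1` has the other size `τ₁ + 1 ≥ 2` or `τ₁ + 2 ≥ 3`.
  rcases Nat.eq_zero_or_pos τ₁ with h0 | h0
  · set S : ∀ T : ℕ, Set ((Fin T → ℝ) × (Fin T → ℝ)) := fun T =>
      ExpFamily.firstCrossing (F.isCumulantBound_left (hθ i) hlt e T)
        (F.isCumulantBound_right (hθ j) e T) T (baseLevel l) with hS
    have hSm : ∀ T, MeasurableSet (S T) := fun T => ExpFamily.measurableSet_firstCrossing _ _ _ _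
    refine hproc.measure_le_of_eventually hθ hij 1 (-1) rfl rfl
      (E := fun T => S T ∪ (C T 1 2 ∪ (C T 2 1 ∪
        ⋃ n, ⋃ m, {_p : (Fin T → ℝ) × (Fin T → ℝ) | 2 ≤ n ∧ 2 ≤ m} ∩ C T n m)))
      (fun T => (hSm T).union ((hCm T _ _).union ((hCm T _ _).union (hCU T)))) (fun T hT => ?_) ?_
    · refine measure_union_crossing_le _ _ T hl hl' (hSm T)
        (ExpFamily.isUpperSet_firstCrossing _ _ _ _)
        (F.measure_firstCrossing_le (hθ i) (hθ j) hlt hT _)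
        ((measure_mono Set.inter_subset_right).trans ?_) le_rfl
      have hbl : 0 < baseLevel l := hl.trans_le (le_baseLevel hl.le)
      refine (measure_crossing_le _ _ T le_rfl le_rfl (s := 0) (sampleLevel_nonneg le_rfl)
        (by linarith)).trans_eq ?_
      rw [add_zero]
    · filter_upwards [halg] with ω hω
      rintro ⟨t, ht, rfl⟩
      obtain ⟨h1, h2, h3⟩ := ht.level_lt_glr hω hij hl.le hlt'
      have hcases := ht.pulls_cases hω hij
      have hmean := hω.1 t ht.1.1 j
      by_cases h11 : pulls (fun l => A l ω) (istar t ω) 0 (τ₁ + t) = 1 ∧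
          pulls (fun l => A l ω) j 0 (τ₁ + t) = 1
      · obtain ⟨T₀, hT₀⟩ := F.mem_firstCrossing_of_lt_glr he (hθ _) (hθ j) hlt h11.1 h11.2 hmean h3
        exact ⟨T₀, fun T hT p => Or.inl (hT₀ T hT p)⟩
      · obtain ⟨T₀, hT₀⟩ := F.mem_crossing_of_lt_glr he (hθ _) (hθ j) hlt
          (pulls_pos_of_one_le h1) (pulls_pos_of_one_le h2) hmean h3
        refine ⟨T₀, fun T hT p => Or.inr ?_⟩
        have hmem := hT₀ T hT p
        rcases hcases with hc | ⟨hc, hc'⟩ | ⟨hc, hc'⟩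
        · exact Or.inr (Or.inr (Set.mem_iUnion₂.2 ⟨_, _, hc, hmem⟩))
        · have : pulls (fun l => A l ω) j 0 (τ₁ + t) = 2 := by omega
          rw [hc, this] at hmem
          exact Or.inl hmem
        · have : pulls (fun l => A l ω) (istar t ω) 0 (τ₁ + t) = 2 := by omega
          rw [hc, this] at hmem
          exact Or.inr (Or.inl hmem)
  · refine hproc.measure_le_of_eventually hθ hij 1 (-1) rfl rfl
      (E := fun T => (C T 1 (τ₁ + 1 + 1) ∪ C T (τ₁ + 1 + 1) 1) ∪ (C T 1 (τ₁ + 1) ∪ (C T (τ₁ + 1) 1 ∪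
        ⋃ n, ⋃ m, {_p : (Fin T → ℝ) × (Fin T → ℝ) | 2 ≤ n ∧ 2 ≤ m} ∩ C T n m)))
      (fun T => ((hCm T _ _).union (hCm T _ _)).union
        ((hCm T _ _).union ((hCm T _ _).union (hCU T))))
      (fun T hT => measure_union_crossing_le_of_two_le _ _ T hl hl' (by omega)) ?_
    filter_upwards [halg] with ω hω
    rintro ⟨t, ht, rfl⟩
    obtain ⟨h1, h2, h3⟩ := ht.level_lt_glr hω hij hl.le hlt'
    have hcases := ht.pulls_cases hω hij
    have hmean := hω.1 t ht.1.1 j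
    obtain ⟨T₀, hT₀⟩ := F.mem_crossing_of_lt_glr he (hθ _) (hθ j) hlt
      (pulls_pos_of_one_le h1) (pulls_pos_of_one_le h2) hmean h3
    refine ⟨T₀, fun T hT p => ?_⟩
    have hmem := hT₀ T hT p
    rcases hcases with hc | ⟨hc, hc' | hc'⟩ | ⟨hc, hc' | hc'⟩
    · exact Or.inr (Or.inr (Or.inr (Set.mem_iUnion₂.2 ⟨_, _, hc, hmem⟩)))
    · rw [hc, hc'] at hmem
      exact Or.inr (Or.inl hmem)
    · rw [hc, hc'] at hmem
      exact Or.inl (Or.inl hmem)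
    · rw [hc, hc'] at hmem
      exact Or.inr (Or.inr (Or.inl hmem))
    · rw [hc, hc'] at hmem
      exact Or.inl (Or.inr hmem)

end TwoArms

section WrongOutput

variable {F : ExpFamily} {K τ₁ : ℕ} {δ ε : ℝ} {θ : Fin K → ℝ} {Ω : Type*} [mΩ : MeasurableSpace Ω]
  {P : Measure Ω} [IsProbabilityMeasure P] {ℱ : Filtration ℕ mΩ} {A : ℕ → Ω → Fin K}
  {X : ℕ → Ω → ℝ} {istar : ℕ → Ω → Fin K}

theorem measure_output_eq_le (hK : 2 ≤ K) (hδ₀ : 0 < δ) (hδ₁ : δ < 1) (hθ : ∀ a, θ a ∈ F.Θ)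
    (hproc : IsBanditProcess P F θ ℱ A X)
    (halg : ∀ᵐ ω ∂P, IsBatchTrackAndStopRun F τ₁ δ ε (fun l => A l ω) (fun l => X l ω)
      (fun t => istar t ω)) {i j : Fin K} (hij : i ≠ j) (hlt : θ i < θ j) :
    P {ω | ∃ t, IsStopTime F τ₁ δ (fun l => A l ω) (fun l => X l ω) (fun s => istar s ω) t ∧
      istar t ω = i} ≤ ENNReal.ofReal (δ / ((K : ℝ) - 1)) := by
  have hK' : (2 : ℝ) ≤ K := by exact_mod_cast hK
  set L := Real.log (((K : ℝ) - 1) / δ) with hLdef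
  have hratio : 0 < ((K : ℝ) - 1) / δ := div_pos (by linarith) hδ₀
  have hexpL : Real.exp (-L) = δ / ((K : ℝ) - 1) := by
    rw [Real.exp_neg, hLdef, Real.exp_log hratio, inv_div]
  have hL0 : 0 < L := Real.log_pos (by rw [lt_div_iff₀ hδ₀]; linarith)
  -- The bounds hold for all `l < L` close to `L`, and `l` then tends to `L`. Levels `L ≤ 69/100`
  -- force `K = 2`, since `K ≥ 3` gives `L ≥ log 2 > 0.69`.
  have key : ∀ᶠ l in nhdsWithin L (Set.Iio L), P {ω | ∃ t, IsStopTime F τ₁ δ (fun l => A l ω)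
      (fun l => X l ω) (fun s => istar s ω) t ∧ istar t ω = i} ≤
          ENNReal.ofReal (Real.exp (-l)) := by
    rcases lt_or_ge (69 / 100) L with hL | hL
    · filter_upwards [Ioo_mem_nhdsLT hL] with l hl
      exact measure_output_eq_le_of_large hθ hproc halg hij hlt hl.1.le hl.2
    · have hK2 : K = 2 := by
        by_contra hne
        have h3 : (3 : ℝ) ≤ K := by exact_mod_cast (by omega : 3 ≤ K)
        have : Real.log 2 ≤ L := Real.log_le_log (by norm_num) (by
          rw [le_div_iff₀ hδ₀]; nlinarith)
        linarith [Real.log_two_gt_d9]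
      subst hK2
      filter_upwards [Ioo_mem_nhdsLT hL0] with l hl
      exact measure_output_eq_le_of_small hθ hproc halg hij hlt hl.1 (hl.2.le.trans hL) hl.2
  rw [← hexpL]
  refine ge_of_tendsto ?_ key
  refine ((ENNReal.continuous_ofReal.comp
      (Real.continuous_exp.comp continuous_neg)).tendsto L).mono_left
    nhdsWithin_le_nhds

theorem measure_output_ne_le (hK : 2 ≤ K) (hδ₀ : 0 < δ) (hδ₁ : δ < 1) (hθ : ∀ a, θ a ∈ F.Θ)
    (hproc : IsBanditProcess P F θ ℱ A X)
    (halg : ∀ᵐ ω ∂P, IsBatchTrackAndStopRun F τ₁ δ ε (fun l => A l ω) (fun l => X l ω)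
      (fun t => istar t ω)) {best : Fin K} (hbest : ∀ a, a ≠ best → θ a < θ best) :
    P {ω | ∃ t, IsStopTime F τ₁ δ (fun l => A l ω) (fun l => X l ω) (fun s => istar s ω) t ∧
      istar t ω ≠ best} ≤ ENNReal.ofReal δ := by
  have hK' : (2 : ℝ) ≤ K := by exact_mod_cast hK
  have hsub : {ω | ∃ t, IsStopTime F τ₁ δ (fun l => A l ω) (fun l => X l ω) (fun s => istar s ω) t ∧
      istar t ω ≠ best} ⊆ ⋃ i ∈ Finset.univ.erase best, {ω | ∃ t, IsStopTime F τ₁ δ (fun l => A l ω)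
        (fun l => X l ω) (fun s => istar s ω) t ∧ istar t ω = i} := by
    rintro ω ⟨t, ht, hne⟩
    exact Set.mem_iUnion₂.2 ⟨istar t ω, Finset.mem_erase.2 ⟨hne, Finset.mem_univ _⟩, t, ht, rfl⟩
  refine (measure_mono hsub).trans ((measure_biUnion_finset_le _ _).trans ?_)
  refine (Finset.sum_le_sum fun i hi => measure_output_eq_le hK hδ₀ hδ₁ hθ hproc halg
    (Finset.ne_of_mem_erase hi) (hbest i (Finset.ne_of_mem_erase hi))).trans_eq ?_
  rw [Finset.sum_const, Finset.card_erase_of_mem (Finset.mem_univ _), Finset.card_univ,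
    Fintype.card_fin, nsmul_eq_mul, ← ENNReal.ofReal_natCast,
    ← ENNReal.ofReal_mul (Nat.cast_nonneg _), Nat.cast_sub (by omega), Nat.cast_one]
  congr 1
  field_simp [show (K : ℝ) - 1 ≠ 0 by linarith]

end WrongOutput

/-! ### Every arm is sampled often until the algorithm stops -/

/-- A number of online samples after which each of `K` arms has been sampled more than `M` times,
unless the algorithm has stopped. -/
def trackTime (K M : ℕ) : ℕ := 2 * (K * ((2 * M) ^ 2 + 1)) + 2 * K + 1

section Tracking

variable {F : ExpFamily} {K τ₁ : ℕ} {δ ε : ℝ} {arm : ℕ → Fin K} {reward : ℕ → ℝ}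
  {istar : ℕ → Fin K}

/-- The state of the sampling rule up to time `E`, in terms of `W t a = t * w t a`. -/
theorem IsBatchTrackAndStopRun.exists_weights (hK : 1 ≤ K)
    (h : IsBatchTrackAndStopRun F τ₁ δ ε arm reward istar) {E : ℕ}
    (hns : ∀ s, K ≤ s → s < E → ¬ StopTest F τ₁ δ arm reward s (istar s)) :
    ∃ W : ℕ → Fin K → ℝ, (∀ a, W K a = 1) ∧ (∀ t, K ≤ t → t < E →
      (∀ a, W t a ≤ W (t + 1) a) ∧ ∑ a, W (t + 1) a = ∑ a, W t a + 1 ∧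
      (IsSquare (t / K) → ∀ a, W (t + 1) a = W t a + 1 / K) ∧
      (∀ a, W (t + 1) a / pulls arm a τ₁ (τ₁ + t) ≤
        W (t + 1) (arm (τ₁ + t)) / pulls arm (arm (τ₁ + t)) τ₁ (τ₁ + t))) := by
  obtain ⟨-, -, count, w, what, hc, hw, hloop⟩ := h
  have hK0 : (0 : ℝ) < K := by exact_mod_cast hK
  have hstep := fun t (ht : K ≤ t) (htE : t < E) =>
    hloop t ht fun s hs hs' => hns s hs (by omega)
  have hsq : ∀ t, K ≤ t → t < 2 * K → IsSquare (t / K) := fun t h1 h2 => by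
    have : t / K = 1 := Nat.div_eq_of_lt_le (by omega) (by omega)
    exact ⟨1, by rw [this]⟩
  -- The rounds `K ≤ t < 2K` all explore, so the counter first reaches a multiple of `K` at `t = 2K
  -- - 1`. The fractions `what` are thus defined from time `2K` on, before any tracking step uses
  -- them.
  have hcount : ∀ i, i < K → K + i ≤ E → count (K + i) = i := by
    intro i
    induction i with
    | zero => intro _ _; exact hc
    | succ i ih =>
      intro hi hE
      have hci := ih (by omega) (by omega)
      have := ((hstep (K + i) (by omega) (by omega)).1 (hsq _ (by omega) (by omega))).2.2
      rw [hci] at this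
      exact (this (Nat.not_dvd_of_pos_of_lt (by omega) hi)).2
  have hwhat : ∀ t, 2 * K ≤ t → t ≤ E → what t ∈ stdSimplex ℝ (Fin K) := by
    intro t ht
    induction t, ht using Nat.le_induction with
    | base =>
      intro hE
      obtain ⟨k, rfl⟩ : ∃ k, K = k + 1 := ⟨K - 1, by omega⟩
      have hci := hcount k (by omega) (by omega)
      have := ((hstep (k + 1 + k) (by omega) (by omega)).1 (hsq _ (by omega) (by omega))).2.1
      rw [hci] at this
      have h2 := (this dvd_rfl).1.1
      rwa [show k + 1 + k + 1 = 2 * (k + 1) by ring] at h2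
    | succ t ht ih =>
      intro hE
      obtain ⟨h1, h2, -⟩ := hstep t (by omega) (by omega)
      by_cases hs : IsSquare (t / K)
      · by_cases hd : K ∣ count t + 1
        · exact ((h1 hs).2.1 hd).1.1
        · rw [((h1 hs).2.2 hd).1]
          exact ih (by omega)
      · rw [(h2 hs).1]
        exact ih (by omega)
  refine ⟨fun t a => t * w t a, fun a => by simp only [hw a]; field_simp, fun t ht htE => ?_⟩
  obtain ⟨h1, h2, h3⟩ := hstep t ht htE
  have hdiv : ∀ a, ((t + 1 : ℕ) : ℝ) * w (t + 1) a / pulls arm a τ₁ (τ₁ + t) ≤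
      ((t + 1 : ℕ) : ℝ) * w (t + 1) (arm (τ₁ + t)) / pulls arm (arm (τ₁ + t)) τ₁ (τ₁ + t) :=
    fun a => by
      rw [mul_div_assoc, mul_div_assoc]
      exact mul_le_mul_of_nonneg_left (h3 a) (Nat.cast_nonneg _)
  have ht1 : (t : ℝ) + 1 ≠ 0 := by positivity
  by_cases hs : IsSquare (t / K)
  · have hW : ∀ a, ((t + 1 : ℕ) : ℝ) * w (t + 1) a = t * w t a + 1 / K := fun a => by
      rw [(h1 hs).1 a, Nat.cast_succ]
      field_simp
    refine ⟨fun a => ?_, ?_, fun _ => hW, hdiv⟩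
    · beta_reduce
      rw [hW a]
      exact le_add_of_nonneg_right (by positivity)
    · simp only [hW, Finset.sum_add_distrib, Finset.sum_const, Finset.card_univ, Fintype.card_fin,
        nsmul_eq_mul]
      field_simp
  · have hW : ∀ a, ((t + 1 : ℕ) : ℝ) * w (t + 1) a = t * w t a + what (t + 1) a := fun a => by
      rw [(h2 hs).2.2 a, Nat.cast_succ]
      field_simp
    have h2K : 2 * K ≤ t := by
      by_contra hlt
      exact hs (hsq t ht (by omega))
    have hmem := hwhat (t + 1) (by omega) (by omega)
    refine ⟨fun a => ?_, ?_, fun h => absurd h hs, hdiv⟩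
    · beta_reduce
      rw [hW a]
      exact le_add_of_nonneg_right (hmem.1 a)
    · simp only [hW, Finset.sum_add_distrib, hmem.2]

/-- By time `s₀ = K * ((2M)² + 1)` exploration has given each arm cumulative weight at least `2M +
1`. If arm `a` still had at most `M` samples at the end, its ratio would exceed `2` from then on, so
only arms with `N_c ≤ W_c / 2` could be pulled. Summing the resulting bounds over the arms gives `E
≤ s₀ + E / 2 + K`, contrary to `E = 2 s₀ + 2K + 1`. -/
theorem IsBatchTrackAndStopRun.lt_pulls (hK : 1 ≤ K)
    (h : IsBatchTrackAndStopRun F τ₁ δ ε arm reward istar) {M : ℕ} (hM : 1 ≤ M)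
    (hns : ∀ s, K ≤ s → s < trackTime K M → ¬ StopTest F τ₁ δ arm reward s (istar s)) (a : Fin K) :
    M < pulls arm a τ₁ (τ₁ + trackTime K M) := by
  obtain ⟨W, hWK, hW⟩ := h.exists_weights hK hns
  have hK0 : (0 : ℝ) < K := by exact_mod_cast hK
  have hone : ∀ c t, K ≤ t → 1 ≤ pulls arm c τ₁ (τ₁ + t) := fun c t ht =>
    (h.2.1 c).symm.le.trans (pulls_mono arm c τ₁ (by omega))
  set E := trackTime K M with hE
  have hmono : ∀ c s t, K ≤ s → s ≤ t → t ≤ E → W s c ≤ W t c := by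
    intro c s t hs hst
    induction t, hst using Nat.le_induction with
    | base => exact fun _ => le_rfl
    | succ t ht ih => exact fun htE => (ih (by omega)).trans ((hW t (by omega) (by omega)).1 c)
  have hsum : ∀ t, K ≤ t → t ≤ E → ∑ c, W t c = t := by
    intro t ht
    induction t, ht using Nat.le_induction with
    | base => intro _; simp [hWK]
    | succ t ht ih =>
      intro htE
      rw [(hW t ht (by omega)).2.1, ih (by omega), Nat.cast_succ]
  have hrow : ∀ j i, 1 ≤ j → i ≤ K → K * j ^ 2 + K ≤ E →
      W (K * j ^ 2) a + (i : ℝ) / K ≤ W (K * j ^ 2 + i) a := by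
    intro j i hj
    have hKj : K ≤ K * j ^ 2 := Nat.le_mul_of_pos_right K (by positivity)
    induction i with
    | zero => intro _ _; simp
    | succ i ih =>
      intro hi hjE
      have hdiv : (K * j ^ 2 + i) / K = j * j := by
        rw [Nat.mul_add_div (by omega), Nat.div_eq_of_lt (by omega), add_zero, sq]
      have h1 := (hW (K * j ^ 2 + i) (by omega) (by omega)).2.2.1 ⟨j, hdiv⟩ a
      have h2 := ih (by omega) hjE
      rw [← add_assoc, h1, Nat.cast_succ, add_div, ← add_assoc]
      exact add_le_add_left h2 _
  have hexpl : ∀ j, K * j ^ 2 + K ≤ E → (j : ℝ) + 1 ≤ W (K * j ^ 2 + K) a := by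
    intro j
    induction j with
    | zero => intro _; simp [hWK]
    | succ j ih =>
      intro hjE
      have hle : K * j ^ 2 + K ≤ K * (j + 1) ^ 2 := by
        nlinarith [Nat.zero_le (K * j)]
      have h1 := hrow (j + 1) K (by omega) le_rfl hjE
      have h2 := hmono a _ _ (by omega : K ≤ K * j ^ 2 + K) hle (by omega)
      have h3 := ih (by omega)
      rw [div_self hK0.ne'] at h1
      push_cast at h1 ⊢
      linarith
  by_contra hcon
  set s₀ := K * ((2 * M) ^ 2 + 1) with hs₀
  have hs₀' : K * (2 * M) ^ 2 + K = s₀ := by rw [hs₀]; ring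
  have hE' : E = 2 * s₀ + 2 * K + 1 := rfl
  have hKs : K ≤ s₀ := by omega
  have hWs := hexpl (2 * M) (by omega)
  rw [hs₀'] at hWs
  push_cast at hWs
  have hM0 : (0 : ℝ) < M := by exact_mod_cast hM
  have hinv : ∀ c t, s₀ ≤ t → t ≤ E →
      (pulls arm c τ₁ (τ₁ + t) : ℝ) ≤ pulls arm c τ₁ (τ₁ + s₀) + W t c / 2 + 1 := by
    intro c t ht
    induction t, ht using Nat.le_induction with
    | base =>
      intro _
      have h1 := hmono c K s₀ le_rfl hKs (by omega)
      rw [hWK] at h1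
      linarith
    | succ t ht ih =>
      intro htE
      have h1 := ih (by omega)
      have hstep := hW t (by omega) (by omega)
      have h2 := hstep.1 c
      have h3 : pulls arm c τ₁ (τ₁ + (t + 1)) = _ := pulls_succ arm c (t := τ₁ + t) (by omega)
      rw [h3]
      by_cases hc : arm (τ₁ + t) = c
      · have h4 := hstep.2.2.2 a
        rw [hc] at h4
        have hNa : pulls arm a τ₁ (τ₁ + t) ≤ M :=
          (pulls_mono arm a τ₁ (by omega)).trans (not_lt.1 hcon)
        have hNa' : (pulls arm a τ₁ (τ₁ + t) : ℝ) ≤ M := by exact_mod_cast hNa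
        have hNa1 : (1 : ℝ) ≤ pulls arm a τ₁ (τ₁ + t) := by exact_mod_cast hone a t (by omega)
        have hNc1 : (1 : ℝ) ≤ pulls arm c τ₁ (τ₁ + t) := by exact_mod_cast hone c t (by omega)
        have hWa := hmono a s₀ (t + 1) hKs (by omega) htE
        have h5 : 2 ≤ W (t + 1) a / pulls arm a τ₁ (τ₁ + t) := by
          rw [le_div_iff₀ (by linarith)]
          linarith
        have h6 := h5.trans h4
        rw [le_div_iff₀ (by linarith)] at h6
        rw [if_pos hc]
        push_cast
        have h7 : (0 : ℝ) ≤ pulls arm c τ₁ (τ₁ + s₀) := Nat.cast_nonneg _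
        linarith
      · rw [if_neg hc, add_zero]
        linarith
  have htot := Finset.sum_le_sum fun c (_ : c ∈ Finset.univ) => hinv c E (by omega) le_rfl
  have hp : ∀ t, ∑ c, (pulls arm c τ₁ (τ₁ + t) : ℝ) = t := fun t => by
    have := sum_pulls arm τ₁ (τ₁ + t)
    rw [Nat.add_sub_cancel_left] at this
    exact_mod_cast this
  rw [Finset.sum_add_distrib, Finset.sum_add_distrib, hp, hp, ← Finset.sum_div,
    hsum E (by omega) le_rfl] at htot
  simp only [Finset.sum_const, Finset.card_univ, Fintype.card_fin, nsmul_eq_mul, mul_one] at htot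
  have hE'' : (E : ℝ) = 2 * s₀ + 2 * K + 1 := by exact_mod_cast hE'
  linarith

end Tracking

/-! ### Concentration of the empirical means, and the growth of the statistic -/

namespace ExpFamily

variable (F : ExpFamily)

theorem hasDerivAt_b {θ : ℝ} (hθ : θ ∈ F.Θ) : HasDerivAt F.b (F.mean θ) θ := by
  have hint : θ ∈ interior (integrableExpSet id F.ρ) :=
    interior_maximal (fun t ht => F.integrable_exp t ht) F.isOpen_param hθ
  have h1 : F.b = cgf id F.ρ := rfl
  have h2 : F.mean θ = deriv (cgf id F.ρ) θ := by
    rw [← integral_tilted_mul_self hint, mean, F.dist_eq_tilted hθ]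
    rfl
  rw [h1, h2]
  exact (analyticAt_cgf hint).differentiableAt.hasDerivAt

/-- An exponent for a large deviation bound of the level `x` beyond the mean, in the direction of
the sign `c`. -/
theorem exists_exponent_of_mean_lt {θ c x : ℝ} (hθ : θ ∈ F.Θ) (hx : c * F.mean θ < c * x) :
    ∃ l, 0 < l ∧ θ + c * l ∈ F.Θ ∧ F.b (θ + c * l) - F.b θ < l * (c * x) := by
  -- The Chernoff exponent has positive slope at `0`, so a small `l > 0` already gives a positive
  -- rate.
  have hd : HasDerivAt (fun l => l * (c * x) - F.b (θ + c * l)) (c * x - F.mean θ * c) 0 := by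
    have h0 : HasDerivAt (fun l : ℝ => θ + c * l) c 0 := by
      simpa using ((hasDerivAt_id (0 : ℝ)).const_mul c).const_add θ
    have h1 : HasDerivAt F.b (F.mean θ) (θ + c * 0) := by simpa using F.hasDerivAt_b hθ
    have h2 := h1.comp (0 : ℝ) h0
    have h3 := ((hasDerivAt_id (0 : ℝ)).mul_const (c * x)).sub h2
    rw [one_mul] at h3
    exact h3
  have hslope := hd.tendsto_slope_zero_right.eventually_const_lt
    (show (0 : ℝ) < c * x - F.mean θ * c by linarith)
  have hmem : ∀ᶠ l in nhdsWithin (0 : ℝ) (Set.Ioi 0), θ + c * l ∈ F.Θ := by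
    refine (((continuous_const.add (continuous_const.mul continuous_id)).tendsto (0 : ℝ)).eventually
      (F.isOpen_param.mem_nhds ?_)).filter_mono nhdsWithin_le_nhds
    simpa using hθ
  obtain ⟨l, hl1, hl2, hl3⟩ := (hslope.and (hmem.and self_mem_nhdsWithin)).exists
  have hl0 : 0 < l := hl3
  refine ⟨l, hl0, hl2, ?_⟩
  simp only [zero_add, smul_eq_mul, zero_mul, mul_zero, add_zero] at hl1
  have := (mul_pos_iff_of_pos_left (inv_pos.2 hl0)).1 hl1
  linarith

/-- A level between the means of two members, beyond which the divergence from all members on the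
far side of the second one is bounded below. -/
theorem exists_le_kl {x z : ℝ} (hx : x ∈ F.Θ) (hz : z ∈ F.Θ) (hne : x ≠ z) :
    ∃ r c, 0 < c ∧ 0 < (x - z) * (F.mean x - r) ∧ 0 < (x - z) * (r - F.mean z) ∧
      ∀ p, 0 ≤ (x - z) * (p - r) → ∀ θ ∈ F.Θ, 0 ≤ (x - z) * (z - θ) →
        ENNReal.ofReal c ≤ F.kl p θ := by
  have hxz : x - z ≠ 0 := sub_ne_zero.2 hne
  have hstrict : F.b x - F.b z < (x - z) * F.mean x := by
    have h1 := F.strictConvexOn_logPartition.2 hx hz hne (half_pos one_pos) (half_pos one_pos)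
      (add_halves 1)
    change F.b _ < (1 / 2 : ℝ) • F.b x + (1 / 2 : ℝ) • F.b z at h1
    have hmid : (1 / 2 : ℝ) • x + (1 / 2 : ℝ) • z ∈ F.Θ :=
      F.convexOn_b.1 hx hz (by norm_num) (by norm_num) (by norm_num)
    have h2 := F.mul_mean_le hx hmid
    simp only [smul_eq_mul] at h1 h2
    nlinarith
  -- Half of the divergence of the member `x` from `z`. The level `r` is where the log-likelihood
  -- ratio of `x` against `z` equals `c`, hence strictly between the two means.
  set c := ((x - z) * F.mean x - (F.b x - F.b z)) / 2 with hc
  set r := ((F.b x - F.b z) + c) / (x - z) with hr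
  have hrx : (x - z) * r = F.b x - F.b z + c := by rw [hr]; field_simp
  have hz' := F.mul_mean_le hz hx
  have hc0 : 0 < c := by rw [hc]; linarith
  refine ⟨r, c, hc0, ?_, ?_, fun p hp θ hθ hside => ?_⟩
  · rw [mul_sub, hrx]
    linarith
  · rw [mul_sub, hrx]
    linarith
  · refine le_trans (ENNReal.ofReal_le_ofReal ?_) (le_iSup₂_of_le x hx le_rfl)
    have h1 := F.mul_mean_le hz hθ
    have h2 : 0 < (x - z) * (p - F.mean z) := by nlinarith
    have h3 : 0 ≤ (z - θ) * (p - F.mean z) := by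
      have := mul_nonneg hside h2.le
      have hsq : 0 < (x - z) ^ 2 := by positivity
      nlinarith
    nlinarith

/-- Every common parameter lies on one side of the midpoint `z`, hence is far from one of the two
averages, and that sample alone contributes at least `M * c`. -/
theorem exists_le_glr {x y : ℝ} (hx : x ∈ F.Θ) (hy : y ∈ F.Θ) (hlt : y < x) :
    ∃ r r' c, 0 < c ∧ F.mean y < r' ∧ r' < r ∧ r < F.mean x ∧
      ∀ p q, r ≤ p → q ≤ r' → ∀ M n m : ℝ, 0 ≤ M → M ≤ n → M ≤ m →
        ENNReal.ofReal (M * c) ≤ F.glr n p m q := by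
  set z := (x + y) / 2 with hzdef
  have hz : z ∈ F.Θ := F.ordConnected_param.out hy hx ⟨by linarith, by linarith⟩
  obtain ⟨r, c, hc, h1, h2, h3⟩ := F.exists_le_kl hx hz (by linarith)
  obtain ⟨r', c', hc', h1', h2', h3'⟩ := F.exists_le_kl hy hz (by linarith)
  have hp : 0 < x - z := by linarith
  have hn : 0 < z - y := by linarith
  have g1 := (mul_pos_iff_of_pos_left hp).1 h1
  have g2 := (mul_pos_iff_of_pos_left hp).1 h2
  have g1' : r' - F.mean y > 0 := (mul_pos_iff_of_pos_left hn).1 (by linarith)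
  have g2' : F.mean z - r' > 0 := (mul_pos_iff_of_pos_left hn).1 (by linarith)
  refine ⟨r, r', min c c', lt_min hc hc', by linarith, by linarith, by linarith,
    fun p q hpr hqr M n m hM hMn hMm => le_iInf₂ fun θ hθ => ?_⟩
  rw [ENNReal.ofReal_mul hM]
  rcases le_total θ z with hθz | hθz
  · refine le_trans ?_ le_self_add
    exact mul_le_mul' (ENNReal.ofReal_le_ofReal hMn)
      ((ENNReal.ofReal_le_ofReal (min_le_left _ _)).trans (h3 p
        (mul_nonneg hp.le (by linarith)) θ hθ (mul_nonneg hp.le (by linarith))))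
  · refine le_trans ?_ le_add_self
    exact mul_le_mul' (ENNReal.ofReal_le_ofReal hMm)
      ((ENNReal.ofReal_le_ofReal (min_le_right _ _)).trans (h3' q
        (mul_nonneg_of_nonpos_of_nonpos (by linarith) (by linarith)) θ hθ
        (mul_nonneg_of_nonpos_of_nonpos (by linarith) (by linarith))))

end ExpFamily

/-- Ville's inequality for a single exponent, uniform over all sizes `n ≥ M`; this uniformity allows
for the random number of samples of an arm. -/
theorem measure_exists_mul_le_prefixSum_le {μ : Measure ℝ} [IsProbabilityMeasure μ] {l ψ y : ℝ}
    (hl : 0 < l) (hμ : ∫⁻ x, ENNReal.ofReal (Real.exp (l * x - ψ)) ∂μ ≤ 1) (hy : ψ ≤ l * y)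
    (M T : ℕ) :
    (Measure.pi fun _ : Fin T => μ) {u | ∃ n ≤ T, M ≤ n ∧ n * y ≤ prefixSum n u}
      ≤ ENNReal.ofReal (Real.exp (-(M * (l * y - ψ)))) := by
  have h := measure_exists_mixture_le {()} (fun _ => l) (fun _ => ψ) μ (fun _ _ => hμ) T
    (fun _ => ENNReal.ofReal (Real.exp (-(M * (l * y - ψ)))))
  simp only [Finset.sum_singleton] at h
  refine (measure_mono ?_).trans h
  rintro u ⟨n, hn, hMn, hle⟩
  refine ⟨n, hn, ?_⟩
  rw [← ENNReal.ofReal_mul (Real.exp_nonneg _), ← Real.exp_add, ENNReal.one_le_ofReal,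
    Real.one_le_exp_iff]
  have h1 := mul_le_mul_of_nonneg_left hle hl.le
  have h2 : (M : ℝ) * (l * y - ψ) ≤ n * (l * y - ψ) :=
    mul_le_mul_of_nonneg_right (by exact_mod_cast hMn) (by linarith)
  nlinarith

section

variable {F : ExpFamily} {K : ℕ} {θ : Fin K → ℝ} {Ω : Type*} [mΩ : MeasurableSpace Ω]
  {P : Measure Ω} {ℱ : Filtration ℕ mΩ} {A : ℕ → Ω → Fin K} {X : ℕ → Ω → ℝ}

/-- The arm `j` is auxiliary: the coupling is stated for pairs, and the event concerns only the
stack of `i`. -/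
theorem IsBanditProcess.measure_deviation_le [IsProbabilityMeasure P]
    (h : IsBanditProcess P F θ ℱ A X) (hθ : ∀ a, θ a ∈ F.Θ) {i j : Fin K} (hij : i ≠ j) {c x l : ℝ}
    (hl : 0 < l) (hmem : θ i + c * l ∈ F.Θ) (hx : F.b (θ i + c * l) - F.b (θ i) ≤ l * (c * x))
    (M : ℕ) (hM : 1 ≤ M) (s : ℕ) :
    P {ω | M ≤ pulls (fun l => A l ω) i 0 s ∧
      c * x ≤ c * empMean (fun l => A l ω) (fun l => X l ω) i s}
      ≤ ENNReal.ofReal (Real.exp (-(M * (l * (c * x) - (F.b (θ i + c * l) - F.b (θ i)))))) := by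
  have i1 := isProbabilityMeasure_map_mul F (hθ i) c
  have i2 := isProbabilityMeasure_map_mul F (hθ j) 1
  have hms : ∀ T : ℕ,
      MeasurableSet {u : Fin T → ℝ | ∃ n ≤ T, M ≤ n ∧ n * (c * x) ≤ prefixSum n u} := by
    intro T
    simp only [Set.ofPred_exists, Set.ofPred_and]
    exact MeasurableSet.iUnion fun n => (MeasurableSet.const _).inter
      ((MeasurableSet.const _).inter (measurableSet_le measurable_const (measurable_prefixSum n)))
  refine h.measure_le_of_eventually hθ hij c 1 rfl rfl
    (E := fun T => Prod.fst ⁻¹' {u | ∃ n ≤ T, M ≤ n ∧ n * (c * x) ≤ prefixSum n u})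
    (fun T => measurable_fst (hms T)) (fun T _ => ?_) (ae_of_all _ ?_)
  · rw [measurePreserving_fst.measure_preimage (hms T).nullMeasurableSet]
    refine measure_exists_mul_le_prefixSum_le hl ?_ hx M T
    rw [lintegral_map (by fun_prop) (by fun_prop), ← F.lintegral_exp_dist (θ := θ i) hmem]
    refine lintegral_mono fun y => ENNReal.ofReal_le_ofReal (Real.exp_le_exp.2 (le_of_eq ?_))
    ring
  · rintro ω ⟨h1, h2⟩
    refine ⟨s, fun T hT p => ⟨_, (pulls_le _ i 0 s).trans hT, h1, ?_⟩⟩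
    change _ ≤ prefixSum _ (completed T (fun l => A l ω) (fun l => X l ω) i c p.1)
    rw [prefixSum_completed _ _ i c hT (by omega)]
    have := mul_le_mul_of_nonneg_left h2 (Nat.cast_nonneg (α := ℝ) (pulls (fun l => A l ω) i 0 s))
    linarith

/-- The probability that an empirical mean deviates after `M` samples is asymptotically
negligible. -/
theorem IsBanditProcess.tendsto_measure_deviation [IsProbabilityMeasure P]
    (h : IsBanditProcess P F θ ℱ A X) (hθ : ∀ a, θ a ∈ F.Θ) {i j : Fin K} (hij : i ≠ j) {c x : ℝ}
    (hx : c * F.mean (θ i) < c * x) (s : ℕ → ℕ) :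
    Filter.Tendsto (fun M : ℕ => P {ω | M ≤ pulls (fun l => A l ω) i 0 (s M) ∧
      c * x ≤ c * empMean (fun l => A l ω) (fun l => X l ω) i (s M)}) Filter.atTop (nhds 0) := by
  obtain ⟨l, hl, hmem, hlt⟩ := F.exists_exponent_of_mean_lt (hθ i) hx
  have hκ : 0 < l * (c * x) - (F.b (θ i + c * l) - F.b (θ i)) := by linarith
  have hlim : Filter.Tendsto (fun M : ℕ => ENNReal.ofReal (Real.exp
      (-((M : ℝ) * (l * (c * x) - (F.b (θ i + c * l) - F.b (θ i))))))) Filter.atTop (nhds 0) := by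
    rw [← ENNReal.ofReal_zero]
    refine ENNReal.tendsto_ofReal (Real.tendsto_exp_atBot.comp
      (Filter.tendsto_neg_atTop_atBot.comp ?_))
    exact tendsto_natCast_atTop_atTop.atTop_mul_const hκ
  refine tendsto_of_tendsto_of_tendsto_of_le_of_le' tendsto_const_nhds hlim
    (Filter.Eventually.of_forall fun _ => zero_le) ?_
  filter_upwards [Filter.eventually_ge_atTop 1] with M hM
  exact h.measure_deviation_le hθ hij hl hmem hlt.le M hM (s M)

end

/-- `trackTime K M` is quadratic in `M`, so the threshold is at most a constant plus `12 log M`. The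
two halves of `M * c` absorb these two parts. -/
theorem eventually_threshold_le {c : ℝ} (hc : 0 < c) (K τ₁ : ℕ) (δ : ℝ) :
    ∀ᶠ M : ℕ in Filter.atTop, threshold K δ (τ₁ + trackTime K M) ≤ M * c := by
  set B := Real.log (((K : ℝ) - 1) / δ) with hB
  set C : ℝ := τ₁ + 12 * K + 1 with hC
  have hC0 : 0 < C := by positivity
  have hlog : ∀ᶠ M : ℕ in Filter.atTop, Real.log (M : ℝ) ≤ c / 24 * M := by
    have := (Real.isLittleO_log_id_atTop.comp_tendsto tendsto_natCast_atTop_atTop).def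
      (show 0 < c / 24 by positivity)
    filter_upwards [this] with M hM
    simp only [Function.comp, id, Real.norm_eq_abs, Nat.abs_cast] at hM
    exact (le_abs_self _).trans hM
  have hlin : ∀ᶠ M : ℕ in Filter.atTop,
      baseLevel B + 6 * Real.log C ≤ (M : ℝ) * (c / 2) :=
    (tendsto_natCast_atTop_atTop.atTop_mul_const (half_pos hc)).eventually_ge_atTop _
  filter_upwards [hlog, hlin, Filter.eventually_ge_atTop 1] with M h1 h2 hM
  have hM' : (1 : ℝ) ≤ M := by exact_mod_cast hM
  have hs : ((τ₁ + trackTime K M : ℕ) : ℝ) = τ₁ + (2 * (K * ((2 * M) ^ 2 + 1)) + 2 * K + 1) := by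
    simp [trackTime]
  have hs1 : (1 : ℝ) ≤ ((τ₁ + trackTime K M : ℕ) : ℝ) := by
    exact_mod_cast (by unfold trackTime; omega : 1 ≤ τ₁ + trackTime K M)
  have hsC : ((τ₁ + trackTime K M : ℕ) : ℝ) ≤ C * (M : ℝ) ^ 2 := by
    rw [hs, hC]
    have hsq : (1 : ℝ) ≤ (M : ℝ) ^ 2 := one_le_pow₀ hM'
    have hτ : (0 : ℝ) ≤ τ₁ := Nat.cast_nonneg _
    have hK : (0 : ℝ) ≤ K := Nat.cast_nonneg _
    nlinarith [mul_le_mul_of_nonneg_left hsq hτ, mul_le_mul_of_nonneg_left hsq hK]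
  have hlogs : Real.log ((τ₁ + trackTime K M : ℕ) : ℝ) ≤ Real.log C + 2 * Real.log M := by
    refine (Real.log_le_log (by linarith) hsC).trans_eq ?_
    rw [Real.log_mul hC0.ne' (by positivity), Real.log_pow]
    norm_num
  have hlevel : sampleLevel (τ₁ + trackTime K M) ≤ 6 * Real.log ((τ₁ + trackTime K M : ℕ) : ℝ) := by
    by_cases hsmall : ((τ₁ + trackTime K M : ℕ) : ℝ) < 2
    · have hone : τ₁ + trackTime K M = 1 := by
        have : τ₁ + trackTime K M < 2 := by exact_mod_cast hsmall
        have : 1 ≤ τ₁ + trackTime K M := by exact_mod_cast hs1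
        omega
      rw [hone, sampleLevel, Nat.cast_one, Real.log_one, mul_zero]
      have hl2 := Real.log_two_lt_d9
      have h12 : Real.log (1 / 2) = -Real.log 2 := by rw [one_div, Real.log_inv]
      rw [h12]
      have := Real.log_nonpos (x := -Real.log 2 + 1) (by linarith) (by
        linarith [Real.log_two_gt_d9])
      linarith
    · push Not at hsmall
      have h0 : 0 ≤ Real.log (((τ₁ + trackTime K M : ℕ) : ℝ) / 2) :=
        Real.log_nonneg (by linarith)
      have h3 := Real.log_le_sub_one_of_pos
        (x := Real.log (((τ₁ + trackTime K M : ℕ) : ℝ) / 2) + 1) (by linarith)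
      have h4 : Real.log (((τ₁ + trackTime K M : ℕ) : ℝ) / 2)
          ≤ Real.log ((τ₁ + trackTime K M : ℕ) : ℝ) :=
        Real.log_le_log (by linarith) (by linarith)
      rw [sampleLevel]
      linarith
  rw [threshold_eq]
  nlinarith

/-! ### The algorithm stops -/

section Stopping

variable {F : ExpFamily} {K τ₁ : ℕ} {δ ε : ℝ} {θ : Fin K → ℝ} {Ω : Type*} [mΩ : MeasurableSpace Ω]
  {P : Measure Ω} [IsProbabilityMeasure P] {ℱ : Filtration ℕ mΩ} {A : ℕ → Ω → Fin K}
  {X : ℕ → Ω → ℝ} {istar : ℕ → Ω → Fin K}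

/-- Outside events of asymptotically negligible probability, two arms that have been sampled `M`
times each are distinguished by the stopping test. -/
theorem IsBanditProcess.exists_tendsto_measure (hproc : IsBanditProcess P F θ ℱ A X)
    (hθ : ∀ a, θ a ∈ F.Θ) {i j : Fin K} (hlt : θ j < θ i) (τ₁ : ℕ) (δ : ℝ) :
    ∃ bad : ℕ → Set Ω, Filter.Tendsto (fun M => P (bad M)) Filter.atTop (nhds 0) ∧
      ∀ᶠ M : ℕ in Filter.atTop, ∀ ω, ω ∉ bad M →
        M ≤ pulls (fun l => A l ω) i 0 (τ₁ + trackTime K M) →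
        M ≤ pulls (fun l => A l ω) j 0 (τ₁ + trackTime K M) →
        empMean (fun l => A l ω) (fun l => X l ω) j (τ₁ + trackTime K M) <
            empMean (fun l => A l ω) (fun l => X l ω) i (τ₁ + trackTime K M) ∧
          ENNReal.ofReal (threshold K δ (τ₁ + trackTime K M)) ≤
            F.glr (pulls (fun l => A l ω) i 0 (τ₁ + trackTime K M))
              (empMean (fun l => A l ω) (fun l => X l ω) i (τ₁ + trackTime K M))
              (pulls (fun l => A l ω) j 0 (τ₁ + trackTime K M))
              (empMean (fun l => A l ω) (fun l => X l ω) j (τ₁ + trackTime K M)) := by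
  have hij : i ≠ j := fun h => by rw [h] at hlt; exact lt_irrefl _ hlt
  obtain ⟨r, r', c, hc, h1, h2, h3, hglr⟩ := F.exists_le_glr (hθ i) (hθ j) hlt
  have t1 := hproc.tendsto_measure_deviation hθ hij (c := -1) (x := r) (by linarith)
    fun M => τ₁ + trackTime K M
  have t2 := hproc.tendsto_measure_deviation hθ hij.symm (c := 1) (x := r') (by linarith)
    fun M => τ₁ + trackTime K M
  have t12 := t1.add t2
  rw [add_zero] at t12
  refine ⟨fun M => _ ∪ _, tendsto_of_tendsto_of_tendsto_of_le_of_le tendsto_const_nhds t12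
    (fun _ => zero_le) (fun M => measure_union_le _ _), ?_⟩
  filter_upwards [eventually_threshold_le hc K τ₁ δ] with M hM ω hω hi hj
  simp only [Set.mem_union, Set.mem_ofPred_eq, not_or, not_and, not_le] at hω
  have g1 := hω.1 hi
  have g2 := hω.2 hj
  refine ⟨by linarith, (ENNReal.ofReal_le_ofReal hM).trans (hglr _ _ (by linarith) (by linarith) M
    _ _ (Nat.cast_nonneg _) (by exact_mod_cast hi) (by exact_mod_cast hj))⟩

theorem ae_exists_isStopTime (hK : 2 ≤ K) (hθ : ∀ a, θ a ∈ F.Θ)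
    (hproc : IsBanditProcess P F θ ℱ A X)
    (halg : ∀ᵐ ω ∂P, IsBatchTrackAndStopRun F τ₁ δ ε (fun l => A l ω) (fun l => X l ω)
      (fun t => istar t ω)) {best : Fin K} (hbest : ∀ a, a ≠ best → θ a < θ best) :
    ∀ᵐ ω ∂P, ∃ t, IsStopTime F τ₁ δ (fun l => A l ω) (fun l => X l ω) (fun s => istar s ω) t := by
  classical
  have hex : ∀ a, ∃ bad : ℕ → Set Ω, Filter.Tendsto (fun M => P (bad M)) Filter.atTop (nhds 0) ∧
      (a ≠ best → ∀ᶠ M : ℕ in Filter.atTop, ∀ ω, ω ∉ bad M →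
        M ≤ pulls (fun l => A l ω) best 0 (τ₁ + trackTime K M) →
        M ≤ pulls (fun l => A l ω) a 0 (τ₁ + trackTime K M) →
        empMean (fun l => A l ω) (fun l => X l ω) a (τ₁ + trackTime K M) <
            empMean (fun l => A l ω) (fun l => X l ω) best (τ₁ + trackTime K M) ∧
          ENNReal.ofReal (threshold K δ (τ₁ + trackTime K M)) ≤
            F.glr (pulls (fun l => A l ω) best 0 (τ₁ + trackTime K M))
              (empMean (fun l => A l ω) (fun l => X l ω) best (τ₁ + trackTime K M))
              (pulls (fun l => A l ω) a 0 (τ₁ + trackTime K M))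
              (empMean (fun l => A l ω) (fun l => X l ω) a (τ₁ + trackTime K M))) := by
    intro a
    by_cases ha : a = best
    · exact ⟨fun _ => ∅, by simp, fun h => absurd ha h⟩
    · obtain ⟨bad, hb1, hb2⟩ := hproc.exists_tendsto_measure hθ (hbest a ha) τ₁ δ
      exact ⟨bad, hb1, fun _ => hb2⟩
  choose bad hbad hgood using hex
  -- The event of never stopping does not depend on `M`. On it, and outside the bad sets, every arm
  -- has been sampled `M` times, the best arm leads, and the test at `trackTime K M` would be
  -- passed; so its probability is bounded by a quantity tending to `0`.
  have hev : ∀ᶠ M : ℕ in Filter.atTop, P {ω | ¬ ∃ t, IsStopTime F τ₁ δ (fun l => A l ω)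
      (fun l => X l ω) (fun s => istar s ω) t} ≤ ∑ a, P (bad a M) := by
    have hall : ∀ᶠ M : ℕ in Filter.atTop, ∀ a, a ≠ best → _ :=
      Filter.eventually_all.2 fun a => Filter.eventually_imp_distrib_left.2 (hgood a)
    filter_upwards [hall, Filter.eventually_ge_atTop 1] with M hM hM1
    refine (measure_mono_ae ?_).trans (measure_iUnion_fintype_le P fun a => bad a M)
    filter_upwards [halg] with ω hω hnot
    by_contra hnb
    have hnb' : ∀ a, ω ∉ bad a M := fun a ha => hnb (Set.mem_iUnion.2 ⟨a, ha⟩)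
    have hns : ∀ s, K ≤ s → ¬ StopTest F τ₁ δ (fun l => A l ω) (fun l => X l ω) s (istar s ω) := by
      intro s hs hst
      have hne : ∃ s, K ≤ s ∧ StopTest F τ₁ δ (fun l => A l ω) (fun l => X l ω) s (istar s ω) :=
        ⟨s, hs, hst⟩
      exact hnot ⟨Nat.find hne, Nat.find_spec hne, fun s' hs' => Nat.find_min' hne hs'⟩
    have hKE : K ≤ trackTime K M := by unfold trackTime; omega
    have hpulls : ∀ a, M ≤ pulls (fun l => A l ω) a 0 (τ₁ + trackTime K M) := fun a => by
      have := hω.lt_pulls (by omega) hM1 (fun s hs _ => hns s hs) a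
      rw [← pulls_add (fun l => A l ω) a (Nat.zero_le _) (Nat.le_add_right τ₁ (trackTime K M))]
      omega
    have hbest' : istar (trackTime K M) ω = best := by
      by_contra hne
      have h1 := (hM _ hne ω (hnb' _) (hpulls _) (hpulls _)).1
      exact absurd (hω.1 _ hKE best) (not_le.2 h1)
    refine hns _ hKE fun a ha => ?_
    rw [hbest'] at ha ⊢
    have h2 := (hM a ha ω (hnb' a) (hpulls _) (hpulls _)).2
    rw [Zstat, ← Nat.cast_add, ← Nat.cast_add, pulls_add _ _ (Nat.zero_le _) (Nat.le_add_right _ _),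
      pulls_add _ _ (Nat.zero_le _) (Nat.le_add_right _ _)]
    exact h2
  have hlim : Filter.Tendsto (fun M => ∑ a, P (bad a M)) Filter.atTop (nhds 0) := by
    have := tendsto_finsetSum Finset.univ fun a (_ : a ∈ Finset.univ) => hbad a
    simpa using this
  exact le_antisymm (ge_of_tendsto hlim hev) zero_le

end Stopping

theorem theorem3 (F : ExpFamily) {K : ℕ} (hK : 2 ≤ K)
    (θ : Fin K → ℝ) (hθ : ∀ a, θ a ∈ F.Θ)
    (best : Fin K) (hbest : ∀ a, a ≠ best → F.mean (θ a) < F.mean (θ best))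
    (δ : ℝ) (hδ₀ : 0 < δ) (hδ₁ : δ < 1) (ε : ℝ) (hε : 0 ≤ ε) (τ₁ : ℕ)
    {Ω : Type*} [mΩ : MeasurableSpace Ω] (P : Measure Ω) [IsProbabilityMeasure P]
    (ℱ : Filtration ℕ mΩ) (A : ℕ → Ω → Fin K) (X : ℕ → Ω → ℝ)
    (hproc : IsBanditProcess P F θ ℱ A X)
    (istar : ℕ → Ω → Fin K)
    (halg : ∀ᵐ ω ∂P, IsBatchTrackAndStopRun F τ₁ δ ε (fun l => A l ω) (fun l => X l ω)
      (fun t => istar t ω)) :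
    IsDeltaCorrect P δ best
      (fun t ω => IsStopTime F τ₁ δ (fun l => A l ω) (fun l => X l ω) (fun s => istar s ω) t)
      istar := by
  have hlt : ∀ a, a ≠ best → θ a < θ best := fun a ha => F.lt_of_mean_lt (hθ a) (hθ best) (hbest a ha)
  exact ⟨ae_exists_isStopTime hK hθ hproc halg hlt,
    measure_output_ne_le hK hδ₀ hδ₁ hθ hproc halg hlt⟩
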